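/- **Setting.** Let $Q$ be a smooth finite-dimensional (Hausdorff) manifold without boundary and let $\tau\colon A\to Q$ be a Lie algebroid: a smooth real vector bundle of finite rank with a real Lie bracket $[\cdot,\cdot]$ on $\Gamma(A)$ and a smooth bundle map $\rho\colon A\to TQ$ such that $[X,fY]=\rho(X)[f]\,Y+f[X,Y]$ for all $X,Y\in\Gamma(A)$, $f\in C^\infty(Q)$. Let $\pi\colon A^*\to Q$ be the dual bundle, $\nabla$ a smooth $TQ$-connection on $A$, and $\nabla^*$ its dual connection on $A^*$. Let $\overline\nabla_XY=\nabla_{\rho(Y)}X+[X,Y]$ be the induced $A$-connection on $A$, and $\overline\nabla^*$ the dual $A$-connection on $A^*$, $\langle\overline\nabla^*_X\sigma,Y\rangle=\rho(X)[\langle\sigma,Y\rangle]-\langle\sigma,\overline\nabla_XY\rangle$. Let $I=[t_0,t_1]$ with $t_0<t_1$. An *$(A\oplus A^*)$-path* is a $C^1$ path $(a,p)\colon I\to A\oplus A^*$ over a $C^2$ base path $q=\tau\circ a=\pi\circ p$ such that $\dot q=\rho(a)$. For such a path and a $C^1$ path $u$ in $A$ (respectively $A^*$) over $q$, put $\overline\nabla_au(t)=\partial_t\eta(t,q(t))+(\overline\nabla_\xi\eta)(t,q(t))$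 (respectively with $\overline\nabla^*$), where $\xi,\eta$ are time-dependent sections with $\xi(t,q(t))=a(t)$, $\eta(t,q(t))=u(t)$; this does not depend on the choice of $\xi,\eta$. The connections $\nabla$, $\nabla^*$ give horizontal lifts and hence splittings $T_aA\cong A_q\oplus T_qQ$ and $T_pA^*\cong A_q^*\oplus T_qQ$ into vertical and horizontal parts. Dually, for $H\in C^\infty(A^*)$, $\mathrm dH(p)$ has parts $\mathrm dH^{\mathrm{ver}}(p)\in A_q$ and $\mathrm dH^{\mathrm{hor}}(p)\in T_q^*Q$, obtained by composing $\mathrm dH(p)$ with the vertical lift $A^*_q\to T_pA^*$ and the horizontal lift $T_qQ\to T_pA^*$. An *admissible variation* of an $(A\oplus A^*)$-path $(a,p)$ is a variation $(\delta a,\delta p)$ with $$\delta a^{\mathrm{ver}}=\overline\nabla_ab,\qquad \delta p^{\mathrm{ver}}=r,\qquad \delta a^{\mathrm{hor}}=\delta p^{\mathrm{hor}}=\rho(b),$$ where $(b,r)$ is a $C^1$ path in $A\oplus A^*$ over $q$ with $b(t_0)=0$, $b(t_1)=0$. The path $(a,p)$ is a *critical point* of a functional $S$ *under admissible variations* if $\frac{\mathrm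 d}{\mathrm d\epsilon}S(a_\epsilon,p_\epsilon)\big|_{\epsilon=0}$ exists and equals $0$ for every family $(a_\epsilon,p_\epsilon)$ of $(A\oplus A^*)$-paths, jointly $C^1$ in $(\epsilon,t)$ for $\epsilon$ near $0$, with $(a_0,p_0)=(a,p)$ whose velocity $\frac{\mathrm d}{\mathrm d\epsilon}(a_\epsilon,p_\epsilon)\big|_{\epsilon=0}$ is an admissible variation. **Theorem.** Let $H\in C^\infty(A^*)$, let $(a,p)$ be an $(A\oplus A^*)$-path on $I$, and fix one of the two signs in $\pm$ (with $\mp$ its opposite). Then $(a,p)$ satisfies the $(\pm)$ generalized Lie–Poisson equations $$\dot q=\rho(a),\qquad \overline\nabla^*_a\,p=\pm\rho^*\bigl(\mathrm dH^{\mathrm{hor}}(p)\bigr),\qquad\text{with } a=\mp\,\mathrm dH^{\mathrm{ver}}(p),$$ on $I$ if and only if $(a,p)$ is a critical point of $$S(a,p)=\int_I\bigl(\langle p,a\rangle\pm H(p)\bigr)\,\mathrm dt$$ under admissible variations. -/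

import Mathlib

open Set Filter Bundle
open scoped Manifold ContDiff Topology

noncomputable section

namespace AlgebroidMechanics

/-! ### Vector bundles: vertical and horizontal lifts, dual covariant derivative

`Q` is a smooth finite-dimensional manifold without boundary, modelled on `E`; `V → Q` and `A → Q`
are smooth real vector bundles of finite rank with typical fibre `F`. -/

section Lifts

variable {E : Type*} [NormedAddCommGroup E] [NormedSpace ℝ E]
  {Q : Type*} [TopologicalSpace Q] [ChartedSpace E Q]
  {F : Type*} [NormedAddCommGroup F] [NormedSpace ℝ F]
  {V : Q → Type*} [TopologicalSpace (TotalSpace F V)]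
  [∀ x, AddCommGroup (V x)] [∀ x, Module ℝ (V x)] [∀ x, TopologicalSpace (V x)]
  [∀ x, IsTopologicalAddGroup (V x)] [∀ x, ContinuousSMul ℝ (V x)]
  [FiberBundle F V]

variable (E F) in
/-- The tangent space `T_e V` of the total space of `V` at a point `e ∈ V_x`. -/
abbrev TotalTangent {x : Q} (e : V x) : Type _ :=
  TangentSpace (𝓘(ℝ, E).prod 𝓘(ℝ, F)) (TotalSpace.mk' F x e)

variable (E F) in
/-- The vertical lift `V_e u = d/dε (e + ε u) |_{ε = 0} ∈ T_e V` of `u ∈ V_x` at `e ∈ V_x`. -/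
def vertLift {x : Q} (e u : V x) : TotalTangent E F e :=
  mfderiv 𝓘(ℝ, ℝ) (𝓘(ℝ, E).prod 𝓘(ℝ, F))
    (fun ε : ℝ ↦ TotalSpace.mk' F x (e + ε • u)) 0 (1 : ℝ)

/-- The horizontal lift `H_e v = Tσ(v) - V_e(∇_v σ) ∈ T_e V` of `v ∈ T_x Q` at `e ∈ V_x` for a
covariant derivative `∇` on `V`, where `σ` is a section with `σ x = e`. The result does not depend
on `σ`; we use Mathlib's extension of `e`, which is smooth near `x`. -/
def horLift (cov : CovariantDerivative 𝓘(ℝ, E) F V) {x : Q} (e : V x)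
    (v : TangentSpace 𝓘(ℝ, E) x) : TotalTangent E F e :=
  let Tσv : TotalTangent E F e :=
    mfderiv 𝓘(ℝ, E) (𝓘(ℝ, E).prod 𝓘(ℝ, F))
      (fun y ↦ TotalSpace.mk' F y (FiberBundle.extend F e y)) x v
  Tσv - vertLift E F e (cov (FiberBundle.extend F e) x v)

end Lifts

variable {E : Type*} [NormedAddCommGroup E] [NormedSpace ℝ E]
  {Q : Type*} [TopologicalSpace Q] [ChartedSpace E Q]
  {F : Type*} [NormedAddCommGroup F] [NormedSpace ℝ F]
  {A : Q → Type*} [TopologicalSpace (TotalSpace F A)]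
  [∀ x, AddCommGroup (A x)] [∀ x, Module ℝ (A x)] [∀ x, TopologicalSpace (A x)]
  [FiberBundle F A] [VectorBundle ℝ F A]

/-- The fibres of the dual bundle `A*`. -/
abbrev Dual (A : Q → Type*) [∀ x, AddCommGroup (A x)] [∀ x, Module ℝ (A x)]
    [∀ x, TopologicalSpace (A x)] (x : Q) : Type _ := A x →L[ℝ] ℝ

theorem mdifferentiableAt_pairing {σ : ∀ x, Dual A x} {s : ∀ x, A x} {x : Q}
    (hσ : MDifferentiableAt 𝓘(ℝ, E) (𝓘(ℝ, E).prod 𝓘(ℝ, F →L[ℝ] ℝ))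
      (fun y ↦ TotalSpace.mk' (F →L[ℝ] ℝ) y (σ y)) x)
    (hs : MDifferentiableAt 𝓘(ℝ, E) (𝓘(ℝ, E).prod 𝓘(ℝ, F))
      (fun y ↦ TotalSpace.mk' F y (s y)) x) :
    MDifferentiableAt 𝓘(ℝ, E) 𝓘(ℝ, ℝ) (fun y ↦ σ y (s y)) x := by
  have := MDifferentiableAt.clm_bundle_apply (F₁ := F) (F₂ := ℝ) (E₂ := Bundle.Trivial Q ℝ)
    (b := fun y ↦ y) hσ hs
  rw [mdifferentiableAt_totalSpace] at this
  exact this.2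

variable [∀ x, IsTopologicalAddGroup (A x)] [∀ x, ContinuousSMul ℝ (A x)]

/-- For fixed `σ`, `∇` and `v ∈ T_x Q`, the operation `s ↦ v[⟨σ, s⟩] - ⟨σ, ∇_v s⟩`. -/
def dualDeriv (cov : CovariantDerivative 𝓘(ℝ, E) F A) (σ : ∀ x, Dual A x) (x : Q)
    (v : TangentSpace 𝓘(ℝ, E) x) (s : ∀ x, A x) : ℝ :=
  mvfderiv 𝓘(ℝ, E) (fun y ↦ σ y (s y)) x v - σ x (cov s x v)

theorem tensorialAt_dualDeriv (cov : CovariantDerivative 𝓘(ℝ, E) F A) {σ : ∀ x, Dual A x} {x : Q}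
    (hσ : MDifferentiableAt 𝓘(ℝ, E) (𝓘(ℝ, E).prod 𝓘(ℝ, F →L[ℝ] ℝ))
      (fun y ↦ TotalSpace.mk' (F →L[ℝ] ℝ) y (σ y)) x)
    (v : TangentSpace 𝓘(ℝ, E) x) :
    TensorialAt 𝓘(ℝ, E) F (dualDeriv cov σ x v) x where
  smul {f s} hf hs := by
    have h1 := cov.isCovariantDerivativeOnUniv.leibniz hs hf (mem_univ x)
    have h2 : (fun y ↦ σ y ((f • s) y)) = f • (fun y ↦ σ y (s y)) := by
      ext y; simp
    unfold dualDeriv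
    rw [h1, h2, mvfderiv_smul hf (mdifferentiableAt_pairing hσ hs)]
    simp
    ring
  add {s s'} hs hs' := by
    have h1 := cov.isCovariantDerivativeOnUniv.add hs hs' (mem_univ x)
    have h2 : (fun y ↦ σ y ((s + s') y)) = (fun y ↦ σ y (s y)) + (fun y ↦ σ y (s' y)) := by
      ext y; simp
    unfold dualDeriv
    rw [h1, h2, mvfderiv_add (mdifferentiableAt_pairing hσ hs) (mdifferentiableAt_pairing hσ hs')]
    simp
    ring

variable [FiniteDimensional ℝ E] [FiniteDimensional ℝ F]

section DualConnection

variable [ContMDiffVectorBundle 1 F A 𝓘(ℝ, E)]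

open Classical in
/-- The value `v ↦ (∇*_v σ)(x)` at `x` of the dual covariant derivative of a section `σ` of `A*`. -/
def dualCovAux (cov : CovariantDerivative 𝓘(ℝ, E) F A) (σ : ∀ x, Dual A x) (x : Q) :
    TangentSpace 𝓘(ℝ, E) x →L[ℝ] Dual A x :=
  if hσ : MDifferentiableAt 𝓘(ℝ, E) (𝓘(ℝ, E).prod 𝓘(ℝ, F →L[ℝ] ℝ))
      (fun y ↦ TotalSpace.mk' (F →L[ℝ] ℝ) y (σ y)) x then
    haveI : T2Space (TangentSpace 𝓘(ℝ, E) x) := inferInstanceAs (T2Space E)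
    haveI : FiniteDimensional ℝ (TangentSpace 𝓘(ℝ, E) x) :=
      inferInstanceAs (FiniteDimensional ℝ E)
    LinearMap.toContinuousLinearMap (E := TangentSpace 𝓘(ℝ, E) x) (F' := Dual A x)
      { toFun := fun v ↦ TensorialAt.mkHom (dualDeriv cov σ x v) x (tensorialAt_dualDeriv cov hσ v)
        map_add' := fun v w ↦ by
          ext u
          simp only [TensorialAt.mkHom_apply_eq_extend, dualDeriv, map_add, add_apply]
          ring
        map_smul' := fun c v ↦ by
          ext u
          simp only [TensorialAt.mkHom_apply_eq_extend, dualDeriv, map_smul, smul_apply,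
            RingHom.id_apply, smul_eq_mul]
          ring }
  else 0

/-- The defining property of the dual covariant derivative:
`⟨∇*_v σ, s⟩ = v[⟨σ, s⟩] - ⟨σ, ∇_v s⟩`. -/
theorem dualCovAux_apply (cov : CovariantDerivative 𝓘(ℝ, E) F A) {σ : ∀ x, Dual A x}
    {s : ∀ x, A x} {x : Q}
    (hσ : MDifferentiableAt 𝓘(ℝ, E) (𝓘(ℝ, E).prod 𝓘(ℝ, F →L[ℝ] ℝ))
      (fun y ↦ TotalSpace.mk' (F →L[ℝ] ℝ) y (σ y)) x)
    (hs : MDifferentiableAt 𝓘(ℝ, E) (𝓘(ℝ, E).prod 𝓘(ℝ, F))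
      (fun y ↦ TotalSpace.mk' F y (s y)) x) (v : TangentSpace 𝓘(ℝ, E) x) :
    dualCovAux cov σ x v (s x) =
      mvfderiv 𝓘(ℝ, E) (fun y ↦ σ y (s y)) x v - σ x (cov s x v) := by
  unfold dualCovAux
  rw [dif_pos hσ]
  exact TensorialAt.mkHom_apply (tensorialAt_dualDeriv cov hσ v) hs

/-- The dual connection `∇*` on `A*` of a connection `∇` on `A`. -/
def dualCov (cov : CovariantDerivative 𝓘(ℝ, E) F A) :
    CovariantDerivative 𝓘(ℝ, E) (F →L[ℝ] ℝ) (Dual A) where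
  toFun := dualCovAux cov
  isCovariantDerivativeOnUniv :=
    { add := by
        intro σ σ' x hσ hσ' _
        ext v u
        have hs := FiberBundle.mdifferentiableAt_extend 𝓘(ℝ, E) F u
        have h := dualCovAux_apply cov (mdifferentiableAt_add_section hσ hσ') hs v
        have h1 := dualCovAux_apply cov hσ hs v
        have h2 := dualCovAux_apply cov hσ' hs v
        have h3 : (fun y ↦ (σ + σ') y (FiberBundle.extend F u y)) =
          (fun y ↦ σ y (FiberBundle.extend F u y)) + (fun y ↦ σ' y (FiberBundle.extend F u y)) := by
          ext y; simp
        rw [h3, mvfderiv_add (mdifferentiableAt_pairing hσ hs)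
          (mdifferentiableAt_pairing hσ' hs)] at h
        simp only [FiberBundle.extend_apply_self] at h h1 h2
        simp only [add_apply, Pi.add_apply] at h ⊢
        rw [h, h1, h2]
        ring
      leibniz := by
        intro σ g x hσ hg _
        ext v u
        have hs := FiberBundle.mdifferentiableAt_extend 𝓘(ℝ, E) F u
        have h := dualCovAux_apply cov (hg.smul_section hσ) hs v
        have h1 := dualCovAux_apply cov hσ hs v
        have h3 : (fun y ↦ (g • σ) y (FiberBundle.extend F u y)) =
          g • (fun y ↦ σ y (FiberBundle.extend F u y)) := by
          ext y; simp
        rw [h3, mvfderiv_smul hg (mdifferentiableAt_pairing hσ hs)] at h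
        simp only [FiberBundle.extend_apply_self] at h h1
        simp at h ⊢
        rw [h, h1]
        ring }

end DualConnection

/-! ### Lie algebroids -/

variable [IsManifold 𝓘(ℝ, E) ∞ Q] [ContMDiffVectorBundle ∞ F A 𝓘(ℝ, E)]

variable (E F A) in
/-- The space `Γ(A)` of smooth sections of `A`. -/
abbrev Sec : Type _ := ContMDiffSection 𝓘(ℝ, E) F ∞ A

/-- The product `f X` of a smooth function and a smooth section. -/
def smulSec (f : ContMDiffMap 𝓘(ℝ, E) 𝓘(ℝ, ℝ) Q ℝ ∞) (X : Sec E F A) : Sec E F A :=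
  ⟨fun x ↦ f x • X x, f.contMDiff.smul_section X.contMDiff⟩

variable (E F A) in
/-- A Lie algebroid structure on the vector bundle `A → Q`: a real Lie bracket on `Γ(A)` and a
smooth bundle map `ρ : A → TQ` over the identity, related by the Leibniz rule. -/
structure LieAlgebroid where
  /-- the bracket on sections -/
  bracket : Sec E F A → Sec E F A → Sec E F A
  /-- the anchor -/
  anchor : ∀ x, A x →L[ℝ] TangentSpace 𝓘(ℝ, E) x
  contMDiff_anchor : ContMDiff 𝓘(ℝ, E) (𝓘(ℝ, E).prod 𝓘(ℝ, F →L[ℝ] E)) ∞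
    (fun x ↦ TotalSpace.mk' (F →L[ℝ] E)
      (E := fun x : Q ↦ A x →L[ℝ] TangentSpace 𝓘(ℝ, E) x) x (anchor x))
  bracket_add_left : ∀ X Y Z, bracket (X + Y) Z = bracket X Z + bracket Y Z
  bracket_smul_left : ∀ (c : ℝ) X Y, bracket (c • X) Y = c • bracket X Y
  bracket_add_right : ∀ X Y Z, bracket X (Y + Z) = bracket X Y + bracket X Z
  bracket_smul_right : ∀ (c : ℝ) X Y, bracket X (c • Y) = c • bracket X Y
  bracket_self : ∀ X, bracket X X = 0
  jacobi : ∀ X Y Z,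
    bracket X (bracket Y Z) + bracket Y (bracket Z X) + bracket Z (bracket X Y) = 0
  leibniz : ∀ (X Y : Sec E F A) (f : ContMDiffMap 𝓘(ℝ, E) 𝓘(ℝ, ℝ) Q ℝ ∞) (x : Q),
    bracket X (smulSec f Y) x =
      mvfderiv 𝓘(ℝ, E) f x (anchor x (X x)) • Y x + f x • bracket X Y x

/-- The `A`-connection `∇̄_X Y = ∇_{ρ(Y)} X + [X, Y]` on `A` induced by a `TQ`-connection `∇`. -/
def barNabla (L : LieAlgebroid E F A) (cov : CovariantDerivative 𝓘(ℝ, E) F A)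
    (X Y : Sec E F A) (x : Q) : A x :=
  cov (fun y ↦ X y) x (L.anchor x (Y x)) + L.bracket X Y x

/-- `ν ∈ A*_x` is the value `(∇̄*_X σ)(x)` of the dual `A`-connection of `∇̄`, which is given by
`⟨∇̄*_X σ, s⟩ = ρ(X)[⟨σ, s⟩] - ⟨σ, ∇̄_X s⟩` for `s ∈ Γ(A)`. -/
def IsBarNablaDual (L : LieAlgebroid E F A) (cov : CovariantDerivative 𝓘(ℝ, E) F A)
    (X : Sec E F A) (σ : Sec E (F →L[ℝ] ℝ) (Dual A)) (x : Q) (ν : Dual A x) : Prop :=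
  ∀ s : Sec E F A, ν (s x) =
    mvfderiv 𝓘(ℝ, E) (fun y ↦ σ y (s y)) x (L.anchor x (X x)) - σ x (barNabla L cov X s x)

/-! ### Paths and covariant derivatives along paths -/

/-- `η` is a time-dependent section of `V`, defined for times in `[t₀, t₁]`, smooth at each fixed
time and jointly `C¹` near `(t, q t)`, with `η (s, q s) = u s` for all times `s` near `t`. -/
def ExtendsNear {W : Type*} [NormedAddCommGroup W] [NormedSpace ℝ W] {V : Q → Type*}
    [TopologicalSpace (TotalSpace W V)] [∀ x, TopologicalSpace (V x)] [FiberBundle W V]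
    (t₀ t₁ : ℝ) (q : ℝ → Q) (u : ∀ t, V (q t)) (t : ℝ) (η : ℝ → Sec E W V) : Prop :=
  ContMDiffWithinAt (𝓘(ℝ, ℝ).prod 𝓘(ℝ, E)) (𝓘(ℝ, E).prod 𝓘(ℝ, W)) 1
      (fun z : ℝ × Q ↦ TotalSpace.mk' W z.2 (η z.1 z.2)) (Icc t₀ t₁ ×ˢ univ) (t, q t) ∧
    ∀ᶠ s in 𝓝[Icc t₀ t₁] t, η s (q s) = u s

/-- `w = ∇̄_a b (t)`, i.e. `w = ∂_t η (t, q t) + (∇̄_ξ η) (t, q t)` for time-dependent sections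
`ξ`, `η` extending `a`, `b`; only the value of `ξ` at time `t` enters, and it is denoted `X`. -/
def IsBarNablaAlong (L : LieAlgebroid E F A) (cov : CovariantDerivative 𝓘(ℝ, E) F A) (t₀ t₁ : ℝ)
    (q : ℝ → Q) (a b : ∀ t, A (q t)) (t : ℝ) (w : A (q t)) : Prop :=
  ∃ (X : Sec E F A) (η : ℝ → Sec E F A), X (q t) = a t ∧ ExtendsNear t₀ t₁ q b t η ∧
    w = derivWithin (fun s ↦ η s (q t)) (Icc t₀ t₁) t + barNabla L cov X (η t) (q t)

/-- `w = ∇̄*_a p (t)`, i.e. `w = ∂_t μ (t, q t) + (∇̄*_ξ μ) (t, q t)` for time-dependent sections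
`ξ`, `μ` of `A`, `A*` extending `a`, `p`. -/
def IsBarNablaDualAlong (L : LieAlgebroid E F A) (cov : CovariantDerivative 𝓘(ℝ, E) F A)
    (t₀ t₁ : ℝ) (q : ℝ → Q) (a : ∀ t, A (q t)) (p : ∀ t, Dual A (q t)) (t : ℝ)
    (w : Dual A (q t)) : Prop :=
  ∃ (X : Sec E F A) (μ : ℝ → Sec E (F →L[ℝ] ℝ) (Dual A)) (ν : Dual A (q t)),
    X (q t) = a t ∧ ExtendsNear t₀ t₁ q p t μ ∧ IsBarNablaDual L cov X (μ t) (q t) ν ∧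
    w = derivWithin (fun s ↦ μ s (q t)) (Icc t₀ t₁) t + ν

/-- A path `t ↦ (a t, p t)` in `A ⊕ A*` over a base path `q`. Only times in a given interval
`[t₀, t₁]` will matter. -/
structure PairPath (A : Q → Type*) [∀ x, AddCommGroup (A x)] [∀ x, Module ℝ (A x)]
    [∀ x, TopologicalSpace (A x)] where
  /-- the base path -/
  q : ℝ → Q
  /-- the component in `A` -/
  a : ∀ t, A (q t)
  /-- the component in `A*` -/
  p : ∀ t, Dual A (q t)

variable (E F) in
/-- A path `u` in a vector bundle `V`, over `q`, is of class `C¹` on `[t₀, t₁]`. -/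
def IsC1Along {V : Q → Type*} [TopologicalSpace (TotalSpace F V)] [∀ x, TopologicalSpace (V x)]
    [FiberBundle F V] (t₀ t₁ : ℝ) (q : ℝ → Q) (u : ∀ t, V (q t)) : Prop :=
  ContMDiffOn 𝓘(ℝ, ℝ) (𝓘(ℝ, E).prod 𝓘(ℝ, F)) 1 (fun t ↦ TotalSpace.mk' F (q t) (u t)) (Icc t₀ t₁)

/-- `(a, p)` is an `(A ⊕ A*)`-path on `[t₀, t₁]`: it is `C¹`, its base path `q` is `C²`, and
`q' = ρ(a)`. -/
structure IsPairPath (L : LieAlgebroid E F A) (t₀ t₁ : ℝ) (γ : PairPath A) : Prop where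
  base : ContMDiffOn 𝓘(ℝ, ℝ) 𝓘(ℝ, E) 2 γ.q (Icc t₀ t₁)
  fst : IsC1Along E F t₀ t₁ γ.q γ.a
  snd : IsC1Along E (F →L[ℝ] ℝ) t₀ t₁ γ.q γ.p
  anchor : ∀ t ∈ Icc t₀ t₁,
    mfderivWithin 𝓘(ℝ, ℝ) 𝓘(ℝ, E) γ.q (Icc t₀ t₁) t (1 : ℝ) = L.anchor (γ.q t) (γ.a t)

/-! ### Variations, the action, and the Lie-Poisson equations -/

/-- A homotopy of `(A ⊕ A*)`-paths: a family `ε ↦ Γ ε`, jointly `C¹` in `(ε, t)` for `ε` near `0`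
and `t ∈ [t₀, t₁]`, each of whose members with `ε` near `0` is an `(A ⊕ A*)`-path. -/
def IsHomotopy (L : LieAlgebroid E F A) (t₀ t₁ : ℝ) (Γ : ℝ → PairPath A) : Prop :=
  ∃ δ > (0 : ℝ), (∀ ε ∈ Ioo (-δ) δ, IsPairPath L t₀ t₁ (Γ ε)) ∧
    ContMDiffOn 𝓘(ℝ, ℝ × ℝ) (𝓘(ℝ, E).prod 𝓘(ℝ, F)) 1
      (fun z : ℝ × ℝ ↦ TotalSpace.mk' F ((Γ z.1).q z.2) ((Γ z.1).a z.2))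
      (Ioo (-δ) δ ×ˢ Icc t₀ t₁) ∧
    ContMDiffOn 𝓘(ℝ, ℝ × ℝ) (𝓘(ℝ, E).prod 𝓘(ℝ, F →L[ℝ] ℝ)) 1
      (fun z : ℝ × ℝ ↦ TotalSpace.mk' (F →L[ℝ] ℝ) ((Γ z.1).q z.2) ((Γ z.1).p z.2))
      (Ioo (-δ) δ ×ˢ Icc t₀ t₁)

/-- The `A`-component `δa (t) = d/dε a_ε (t) |_{ε = 0}` of the velocity of a family of paths. -/
def velFst (Γ : ℝ → PairPath A) (t : ℝ) : TotalTangent E F ((Γ 0).a t) :=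
  mfderiv 𝓘(ℝ, ℝ) (𝓘(ℝ, E).prod 𝓘(ℝ, F))
    (fun ε ↦ TotalSpace.mk' F ((Γ ε).q t) ((Γ ε).a t)) 0 (1 : ℝ)

/-- The `A*`-component `δp (t) = d/dε p_ε (t) |_{ε = 0}` of the velocity of a family of paths. -/
def velSnd (Γ : ℝ → PairPath A) (t : ℝ) : TotalTangent E (F →L[ℝ] ℝ) ((Γ 0).p t) :=
  mfderiv 𝓘(ℝ, ℝ) (𝓘(ℝ, E).prod 𝓘(ℝ, F →L[ℝ] ℝ))
    (fun ε ↦ TotalSpace.mk' (F →L[ℝ] ℝ) ((Γ ε).q t) ((Γ ε).p t)) 0 (1 : ℝ)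

/-- `(δa, δp)` is an admissible variation of `(a, p)`: there are `C¹` paths `b` in `A` and `r` in
`A*` over `q`, with `b` vanishing at the end points, such that, in the splittings induced by `∇`
and `∇*`, the vertical parts are `δa^ver = ∇̄_a b`, `δp^ver = r` and the horizontal parts are
`δa^hor = δp^hor = ρ(b)`. -/
def IsAdmissible (L : LieAlgebroid E F A) (cov : CovariantDerivative 𝓘(ℝ, E) F A) (t₀ t₁ : ℝ)
    (γ : PairPath A) (δa : ∀ t, TotalTangent E F (γ.a t))
    (δp : ∀ t, TotalTangent E (F →L[ℝ] ℝ) (γ.p t)) : Prop :=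
  ∃ (b : ∀ t, A (γ.q t)) (r : ∀ t, Dual A (γ.q t)),
    IsC1Along E F t₀ t₁ γ.q b ∧ IsC1Along E (F →L[ℝ] ℝ) t₀ t₁ γ.q r ∧ b t₀ = 0 ∧ b t₁ = 0 ∧
    ∀ t ∈ Icc t₀ t₁, ∃ w : A (γ.q t), IsBarNablaAlong L cov t₀ t₁ γ.q γ.a b t w ∧
      δa t = horLift cov (γ.a t) (L.anchor _ (b t)) + vertLift E F (γ.a t) w ∧
      δp t = horLift (dualCov cov) (γ.p t) (L.anchor _ (b t)) +
        vertLift E (F →L[ℝ] ℝ) (γ.p t) (r t)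

/-- `(a, p)` is a critical point of the functional `S` on `(A ⊕ A*)`-paths with respect to
admissible variations: `d/dε S(a_ε, p_ε) |_{ε = 0}` exists and vanishes for each homotopy of
`(A ⊕ A*)`-paths through `(a, p)` whose velocity at `ε = 0` is an admissible variation. -/
def IsCritical (L : LieAlgebroid E F A) (cov : CovariantDerivative 𝓘(ℝ, E) F A) (t₀ t₁ : ℝ)
    (S : PairPath A → ℝ) (γ : PairPath A) : Prop :=
  ∀ Γ : ℝ → PairPath A, Γ 0 = γ → IsHomotopy L t₀ t₁ Γ →
    IsAdmissible L cov t₀ t₁ (Γ 0) (velFst Γ) (velSnd Γ) →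
    HasDerivAt (fun ε ↦ S (Γ ε)) 0 0

/-- The action `∫ (⟨p, a⟩ + s H(p)) dt`; the sign is `s = ±1`. -/
def action (s : ℝ) (H : TotalSpace (F →L[ℝ] ℝ) (Dual A) → ℝ) (t₀ t₁ : ℝ) (γ : PairPath A) : ℝ :=
  ∫ t in t₀..t₁, (γ.p t (γ.a t) + s * H (TotalSpace.mk' (F →L[ℝ] ℝ) (γ.q t) (γ.p t)))

variable (E) in
/-- `dH(p)`, applied to tangent vectors of the total space of `A*` at `p`. -/
def diffH (H : TotalSpace (F →L[ℝ] ℝ) (Dual A) → ℝ) {x : Q} (p : Dual A x)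
    (v : TotalTangent E (F →L[ℝ] ℝ) p) : ℝ :=
  mvfderiv (𝓘(ℝ, E).prod 𝓘(ℝ, F →L[ℝ] ℝ)) H (TotalSpace.mk' (F →L[ℝ] ℝ) x p) v

variable (E) in
/-- `u ∈ A_x` is the vertical part `dH^ver(p)` of `dH(p)`: `⟨r, u⟩ = ⟨dH(p), V_p r⟩` for
all `r ∈ A*_x`. -/
def IsVerticalPart (H : TotalSpace (F →L[ℝ] ℝ) (Dual A) → ℝ) {x : Q} (p : Dual A x)
    (u : A x) : Prop :=
  ∀ r : Dual A x, r u = diffH E H p (vertLift E (F →L[ℝ] ℝ) p r)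

/-- The horizontal part `dH^hor(p)` of `dH(p)`: `⟨dH^hor(p), v⟩ = ⟨dH(p), H_p v⟩`, where the
horizontal lift is that of `∇*`. -/
def horizontalPart (cov : CovariantDerivative 𝓘(ℝ, E) F A)
    (H : TotalSpace (F →L[ℝ] ℝ) (Dual A) → ℝ) {x : Q} (p : Dual A x)
    (v : TangentSpace 𝓘(ℝ, E) x) : ℝ :=
  diffH E H p (horLift (dualCov cov) p v)

/-- The generalized Lie-Poisson equations with sign `s = ±1`, on `[t₀, t₁]`:
`q' = ρ(a)` and `∇̄*_a p = s ρ*(dH^hor(p))`, where `a = -s dH^ver(p)`. -/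
structure LiePoissonEquations (L : LieAlgebroid E F A) (cov : CovariantDerivative 𝓘(ℝ, E) F A)
    (s : ℝ) (H : TotalSpace (F →L[ℝ] ℝ) (Dual A) → ℝ) (t₀ t₁ : ℝ) (γ : PairPath A) : Prop where
  legendre : ∀ t ∈ Icc t₀ t₁, ∃ u : A (γ.q t),
    IsVerticalPart E H (γ.p t) u ∧ γ.a t = -(s • u)
  horizontal : ∀ t ∈ Icc t₀ t₁,
    mfderivWithin 𝓘(ℝ, ℝ) 𝓘(ℝ, E) γ.q (Icc t₀ t₁) t (1 : ℝ) = L.anchor (γ.q t) (γ.a t)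
  vertical : ∀ t ∈ Icc t₀ t₁, ∃ w : Dual A (γ.q t),
    IsBarNablaDualAlong L cov t₀ t₁ γ.q γ.a γ.p t w ∧
    ∀ u : A (γ.q t), w u = s * horizontalPart cov H (γ.p t) (L.anchor (γ.q t) u)

end AlgebroidMechanics
end

open AlgebroidMechanics

noncomputable section

set_option linter.unusedSectionVars false

namespace AlgebroidMechanics

/-! ### Calculus: superposition operators, local flows, parametric integrals -/

section Flow

open MeasureTheory

variable {Z : Type*} [NormedAddCommGroup Z] [NormedSpace ℝ Z]

/-! Let a family of paths have as velocity the admissible variation given by (b, r). Since ∇* is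
dual to ∇, the connection terms in the derivative of ⟨p, a⟩ cancel, and the integrand ⟨p, a⟩ + s
H(p) has derivative ⟨r, a⟩ + ⟨p, ∇̄_a b⟩ + s (⟨dH^hor(p), ρ(b)⟩ + ⟨r, dH^ver(p)⟩)
(`hasDerivAt_lagrangian`). The relation q' = ρ(a) yields the product rule ⟨p, b⟩' = ⟨p, ∇̄_a b⟩ +
⟨∇̄*_a p, b⟩ (`hasDerivWithinAt_pairing_barNabla`). If the equations hold, the terms in r cancel and
what remains is ⟨p, b⟩', whose integral is zero because b vanishes at both ends.

For the converse, criticality only speaks of velocities of actual families of paths obeying q' =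
ρ(a), so enough admissible variations must be integrated to such families. Near a given time take b
= φ σ(q), with σ of constant fibre coordinate u and φ a cutoff in time. In coordinates, the flow of
(x, a) ↦ (ρ(x) u, [ã, σ](x)), where ã is the section with constant coordinate a, preserves the
relation q' = ρ(a); this is the compatibility of anchor and bracket, a consequence of the Jacobi and
Leibniz identities (`LieAlgebroid.act_bracket`, `FrameAt.fderiv_anchorCoord`). When the flow is run
for the time-dependent parameter ε φ(t), the chain rule adds ε φ'(t) ρ(u) to the velocity of the
base path, and a translation of the fibre coordinate by ε φ'(t) u absorbs it
(`exists_anchored_flow`). The coordinate of p is varied affinely in ε. Thus every pair (φ σ, φ μ),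
with μ a section of A* of constant coordinate, is realized (`PathFlow.exists_admissible`).

Criticality then reads ∫ (φ' ⟨p, σ⟩ + φ g) = 0 for all cutoffs φ, with g the rest of the first
variation, so ⟨p, σ⟩' = g by the fundamental lemma (`derivWithin_eq_of_forall_integral_eq_zero`).
The left side does not involve μ: varying μ gives a = -s dH^ver(p), while μ = 0 and the product rule
give the equation for ∇̄*_a p. -/

set_option synthInstance.maxHeartbeats 400000 in
/-- Pointwise application of a continuous family of operators to continuous paths. -/
def pathApplyAux (M : C(unitInterval, Z →L[ℝ] Z)) : C(unitInterval, Z) →L[ℝ] C(unitInterval, Z) :=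
  LinearMap.mkContinuous
    { toFun := fun h ↦ ⟨fun τ ↦ M τ (h τ), M.continuous.clm_apply h.continuous⟩
      map_add' := fun h k ↦ by ext τ; simp
      map_smul' := fun c h ↦ by ext τ; simp } ‖M‖ (fun h ↦ by
    rw [ContinuousMap.norm_le _ (by positivity)]
    intro τ
    exact ((M τ).le_opNorm _).trans
      (mul_le_mul (M.norm_coe_le_norm τ) (h.norm_coe_le_norm τ) (norm_nonneg _)
        ((norm_nonneg _).trans (M.norm_coe_le_norm τ))))

theorem pathApplyAux_apply (M : C(unitInterval, Z →L[ℝ] Z)) (h : C(unitInterval, Z))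
    (τ : unitInterval) : pathApplyAux M h τ = M τ (h τ) := rfl

set_option synthInstance.maxHeartbeats 400000 in
/-- Pointwise application of continuous families of operators to continuous paths. -/
def pathApply : C(unitInterval, Z →L[ℝ] Z) →L[ℝ] C(unitInterval, Z) →L[ℝ] C(unitInterval, Z) :=
  LinearMap.mkContinuous (E := C(unitInterval, Z →L[ℝ] Z))
    { toFun := pathApplyAux
      map_add' := fun M N ↦ by ext h τ; simp [pathApplyAux_apply]
      map_smul' := fun c M ↦ by ext h τ; simp [pathApplyAux_apply] } 1 (fun M ↦ by
    rw [one_mul]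
    refine ContinuousLinearMap.opNorm_le_bound _ ((norm_nonneg _).trans (M.norm_coe_le_norm 0))
      fun h ↦ ?_
    rw [ContinuousMap.norm_le _ (mul_nonneg ((norm_nonneg _).trans (M.norm_coe_le_norm 0))
      ((norm_nonneg _).trans (h.norm_coe_le_norm 0)))]
    intro τ
    exact ((M τ).le_opNorm _).trans
      (mul_le_mul (M.norm_coe_le_norm τ) (h.norm_coe_le_norm τ) (norm_nonneg _)
        ((norm_nonneg _).trans (M.norm_coe_le_norm τ))))

/-- The primitive of a continuous path, vanishing at `0`. -/
def pathPrimitive : C(unitInterval, Z) →L[ℝ] C(unitInterval, Z) :=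
  LinearMap.mkContinuous
    { toFun := fun f ↦ ⟨fun τ ↦ ∫ σ in (0 : ℝ)..τ, IccExtend zero_le_one f σ,
        (intervalIntegral.continuous_primitive
          (fun a b ↦ f.continuous.Icc_extend'.intervalIntegrable a b) 0).comp
          continuous_subtype_val⟩
      map_add' := fun f g ↦ by
        ext τ
        simp only [ContinuousMap.coe_mk, ContinuousMap.add_apply]
        rw [← intervalIntegral.integral_add]
        · rfl
        · exact f.continuous.Icc_extend'.intervalIntegrable _ _
        · exact g.continuous.Icc_extend'.intervalIntegrable _ _
      map_smul' := fun c f ↦ by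
        ext τ
        simp only [ContinuousMap.coe_mk, ContinuousMap.smul_apply, RingHom.id_apply]
        rw [← intervalIntegral.integral_smul]
        rfl } 1 (fun f ↦ by
    rw [ContinuousMap.norm_le _ (by positivity)]
    intro τ
    simp only [LinearMap.coe_mk, AddHom.coe_mk, ContinuousMap.coe_mk, one_mul]
    refine (intervalIntegral.norm_integral_le_of_norm_le_const (C := ‖f‖)
      fun σ _ ↦ f.norm_coe_le_norm _).trans ?_
    rw [sub_zero, abs_of_nonneg τ.2.1]
    exact mul_le_of_le_one_right (norm_nonneg _) τ.2.2)

theorem pathPrimitive_apply (f : C(unitInterval, Z)) (τ : unitInterval) :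
    pathPrimitive f τ = ∫ σ in (0 : ℝ)..τ, IccExtend zero_le_one f σ := rfl

theorem pathPrimitive_zero (f : C(unitInterval, Z)) : pathPrimitive f 0 = 0 := by
  simp [pathPrimitive_apply]

theorem hasDerivWithinAt_pathPrimitive [CompleteSpace Z] (f : C(unitInterval, Z)) (τ : unitInterval) :
    HasDerivWithinAt (IccExtend zero_le_one (pathPrimitive f)) (f τ) (Icc 0 1) τ := by
  have hc : Continuous (IccExtend zero_le_one f) := f.continuous.Icc_extend'
  have h := (intervalIntegral.integral_hasDerivAt_right (hc.intervalIntegrable 0 (τ : ℝ))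
    (hc.stronglyMeasurableAtFilter _ _) hc.continuousAt).hasDerivWithinAt (s := Icc 0 1)
  rw [IccExtend_val] at h
  refine h.congr (fun σ hσ ↦ ?_) ?_
  · rw [IccExtend_of_mem _ _ hσ]; rfl
  · rw [IccExtend_val]; rfl

-- Compact support makes the derivative of W globally Lipschitz, so the first-order Taylor remainder
-- of W is at most K ‖b - a‖², uniformly in the base point. This pointwise bound passes to the sup
-- norm on paths. The derivative is continuous because postcomposition with a continuous map is.
set_option synthInstance.maxHeartbeats 400000 in
theorem contDiff_postcomp {W : Z → Z} (hW : ContDiff ℝ 2 W) (hs : HasCompactSupport W) :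
    ContDiff ℝ 1 (fun y : C(unitInterval, Z) ↦ (⟨W, hW.continuous⟩ : C(Z, Z)).comp y) ∧
    ∀ y : C(unitInterval, Z), fderiv ℝ (fun y : C(unitInterval, Z) ↦ (⟨W, hW.continuous⟩ : C(Z, Z)).comp y) y =
      pathApply ((⟨fderiv ℝ W, hW.continuous_fderiv two_ne_zero⟩ : C(Z, Z →L[ℝ] Z)).comp y) := by
  have hW' : ContDiff ℝ 1 (fderiv ℝ W) := hW.fderiv_right (by norm_num)
  obtain ⟨K, hK⟩ := ContDiff.lipschitzWith_of_hasCompactSupport (hs.fderiv (𝕜 := ℝ)) hW' one_ne_zero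
  have key : ∀ a b : Z, ‖W b - W a - fderiv ℝ W a (b - a)‖ ≤ K * ‖b - a‖ * ‖b - a‖ := by
    intro a b
    refine Convex.norm_image_sub_le_of_norm_hasFDerivWithin_le' (s := segment ℝ a b)
      (f' := fderiv ℝ W) (𝕜 := ℝ)
      (fun x _ ↦ (hW.differentiable two_ne_zero x).hasFDerivAt.hasFDerivWithinAt) ?_
      (convex_segment a b) (left_mem_segment ℝ a b) (right_mem_segment ℝ a b)
    intro x hx
    rw [← dist_eq_norm]
    refine (hK.dist_le_mul x a).trans ?_
    gcongr
    rw [dist_eq_norm]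
    obtain ⟨θ, hθ, rfl⟩ := (segment_eq_image' ℝ a b ▸ hx)
    rw [add_sub_cancel_left, norm_smul, Real.norm_of_nonneg hθ.1]
    exact mul_le_of_le_one_left (norm_nonneg _) hθ.2
  have hder : ∀ y : C(unitInterval, Z), HasFDerivAt (fun y : C(unitInterval, Z) ↦ (⟨W, hW.continuous⟩ : C(Z, Z)).comp y)
      (pathApply ((⟨fderiv ℝ W, hW.continuous_fderiv two_ne_zero⟩ : C(Z, Z →L[ℝ] Z)).comp y))
      y := by
    intro y
    refine HasFDerivAt.of_isLittleO ?_
    refine Asymptotics.IsBigO.trans_isLittleO (g := fun x ↦ ‖x - y‖ * ‖x - y‖) ?_ ?_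
    · refine Asymptotics.IsBigO.of_bound K (Eventually.of_forall fun x ↦ ?_)
      rw [ContinuousMap.norm_le _ (by positivity)]
      intro τ
      change ‖W (x τ) - W (y τ) - fderiv ℝ W (y τ) (x τ - y τ)‖ ≤ _
      refine (key (y τ) (x τ)).trans ?_
      have := (x - y).norm_coe_le_norm τ
      rw [ContinuousMap.sub_apply] at this
      rw [norm_mul, norm_norm, mul_assoc]
      gcongr
    · have h1 : Tendsto (fun x : C(unitInterval, Z) ↦ ‖x - y‖) (𝓝 y) (𝓝 0) := by
        simpa using ((continuous_id.sub continuous_const).norm.tendsto y :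
          Tendsto (fun x : C(unitInterval, Z) ↦ ‖id x - y‖) _ _)
      have h2 : (fun x : C(unitInterval, Z) ↦ ‖x - y‖) =o[𝓝 y] (fun _ ↦ (1 : ℝ)) :=
        (Asymptotics.isLittleO_one_iff ℝ).2 h1
      simpa using h2.mul_isBigO (Asymptotics.isBigO_refl (fun x : C(unitInterval, Z) ↦ ‖x - y‖) (𝓝 y))
  refine ⟨contDiff_one_iff_hasFDerivAt.2 ⟨_, ?_, hder⟩, fun y ↦ (hder y).fderiv⟩
  exact pathApply.continuous.comp (ContinuousMap.continuous_postcomp _)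

/-- The local flow of a `C²` vector field `W` near `z₀`, run up to time `τ ∈ [0, 1]` with speed `s`,
is of class `C¹` in the speed and the initial value, and satisfies the variational equation. -/
theorem exists_flow [FiniteDimensional ℝ Z] {W : Z → Z} {O : Set Z} (hO : IsOpen O)
    (hW : ContDiffOn ℝ 2 W O) {z₀ : Z} (hz₀ : z₀ ∈ O) :
    ∃ (U : Set (ℝ × Z)) (y : ℝ × Z → ℝ → Z) (D : ℝ × Z → ℝ → (ℝ × Z →L[ℝ] Z)),
      IsOpen U ∧ (0, z₀) ∈ U ∧
      (∀ x ∈ U, ∀ τ ∈ Icc (0 : ℝ) 1, y x τ ∈ O) ∧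
      (∀ x ∈ U, y x 0 = x.2) ∧
      (∀ x ∈ U, ∀ τ ∈ Icc (0 : ℝ) 1, HasDerivWithinAt (y x) (x.1 • W (y x τ)) (Icc 0 1) τ) ∧
      (∀ x ∈ U, ∀ τ ∈ Icc (0 : ℝ) 1, HasFDerivAt (fun x ↦ y x τ) (D x τ) x) ∧
      (∀ τ ∈ Icc (0 : ℝ) 1, ContinuousOn (fun x ↦ D x τ) U) ∧
      (∀ x ∈ U, ∀ v, D x 0 v = v.2) ∧
      (∀ x ∈ U, ∀ v, ∀ τ ∈ Icc (0 : ℝ) 1, HasDerivWithinAt (fun τ ↦ D x τ v)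
        (v.1 • W (y x τ) + x.1 • fderiv ℝ W (y x τ) (D x τ v)) (Icc 0 1) τ) := by
  have : CompleteSpace Z := FiniteDimensional.complete ℝ Z
  -- W is replaced by V = χ W, which is defined and C² on all of Z with compact support, so that y ↦
  -- V ∘ y is a C¹ operator on the Banach space of continuous paths. Near z₀ nothing changes.
  obtain ⟨χ, hχO, hχc, hχ, -, hχ1⟩ : ∃ χ : Z → ℝ, tsupport χ ⊆ O ∧ HasCompactSupport χ ∧
      ContDiff ℝ ∞ χ ∧ (∀ x, χ x ∈ Icc (0:ℝ) 1) ∧ ∀ᶠ x in 𝓝 z₀, χ x = 1 := by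
    obtain ⟨r, hr, hrO⟩ := Metric.isOpen_iff.1 hO z₀ hz₀
    let f : ContDiffBump z₀ := ⟨r / 4, r / 2, by positivity, by linarith⟩
    refine ⟨f, ?_, f.hasCompactSupport, f.contDiff, fun x ↦ ⟨f.nonneg, f.le_one⟩,
      f.eventuallyEq_one⟩
    rw [f.tsupport_eq]
    exact (Metric.closedBall_subset_ball (by simp [f]; linarith)).trans hrO
  obtain ⟨O', hO'1, hO', hz₀'⟩ := eventually_nhds_iff.1 hχ1
  set V : Z → Z := fun z ↦ χ z • W z with hV
  have hVs : HasCompactSupport V := hχc.smul_right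
  have hVd : ContDiff ℝ 2 V := by
    rw [contDiff_iff_contDiffAt]
    intro z
    by_cases hz : z ∈ tsupport χ
    · exact (hχ.contDiffAt.of_le (by norm_cast)).smul
        (hW.contDiffAt (hO.mem_nhds (hχO hz)))
    · refine contDiffAt_const (c := 0) |>.congr_of_eventuallyEq ?_
      filter_upwards [(isClosed_tsupport χ).isOpen_compl.mem_nhds hz] with x hx
      simp [V, image_eq_zero_of_notMem_tsupport hx]
  obtain ⟨hN, hN'⟩ := contDiff_postcomp hVd hVs
  set N : C(unitInterval, Z) → C(unitInterval, Z) := fun y ↦ (⟨V, hVd.continuous⟩ : C(Z, Z)).comp y with hNdef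
  let cst : Z →L[ℝ] C(unitInterval, Z) := LinearMap.mkContinuous
    { toFun := fun z ↦ ContinuousMap.const unitInterval z
      map_add' := fun _ _ ↦ rfl
      map_smul' := fun _ _ ↦ rfl } 1 (fun z ↦ by
        rw [ContinuousMap.norm_le _ (by positivity)]
        intro τ
        rw [one_mul]
        exact le_rfl)
  have hcst : ∀ z τ, cst z τ = z := fun z τ ↦ rfl
  -- A path y is a zero of G at (s, z) exactly when y(τ) = z + s ∫₀^τ V(y), the integral form of the
  -- flow equation with speed s.
  set G : (ℝ × Z) × C(unitInterval, Z) → C(unitInterval, Z) := fun w ↦ w.2 - cst w.1.2 - w.1.1 • pathPrimitive (N w.2)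
    with hG
  have hGd : ContDiff ℝ 1 G := by
    have h1 : ContDiff ℝ 1 (fun w : (ℝ × Z) × C(unitInterval, Z) ↦ N w.2) := hN.comp contDiff_snd
    have h2 : ContDiff ℝ 1 (fun w : (ℝ × Z) × C(unitInterval, Z) ↦ pathPrimitive (N w.2)) :=
      (pathPrimitive (Z := Z)).contDiff.comp h1
    exact (contDiff_snd.sub (cst.contDiff.comp (contDiff_snd.comp contDiff_fst))).sub
      ((contDiff_fst.comp contDiff_fst).smul h2)
  have hGf : ∀ w : (ℝ × Z) × C(unitInterval, Z), ∀ v, fderiv ℝ G w v = v.2 - cst v.1.2 -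
      (v.1.1 • pathPrimitive (N w.2) + w.1.1 • pathPrimitive (fderiv ℝ N w.2 v.2)) := by
    intro w v
    have h1 : HasFDerivAt (fun w : (ℝ × Z) × C(unitInterval, Z) ↦ N w.2) _ w :=
      ((hN.differentiable one_ne_zero) w.2).hasFDerivAt.comp w hasFDerivAt_snd
    have h2 : HasFDerivAt (fun w : (ℝ × Z) × C(unitInterval, Z) ↦ pathPrimitive (N w.2)) _ w :=
      (pathPrimitive (Z := Z)).hasFDerivAt.comp w h1
    have h3 := (hasFDerivAt_snd (𝕜 := ℝ) (p := w)).sub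
      (cst.hasFDerivAt.comp w ((hasFDerivAt_snd (𝕜 := ℝ)).comp w (hasFDerivAt_fst (𝕜 := ℝ))))
    have h4 := h3.sub (((hasFDerivAt_fst (𝕜 := ℝ)).comp w (hasFDerivAt_fst (𝕜 := ℝ))).smul h2)
    have h5 : fderiv ℝ G w = _ := h4.fderiv
    rw [h5]
    simp
    abel
  set u : (ℝ × Z) × C(unitInterval, Z) := ((0, z₀), cst z₀) with hu
  have hGu : G u = 0 := by simp [hG, hu]
  -- At speed 0 the integral term disappears and the derivative in the path variable is the
  -- identity. The implicit function theorem therefore gives solutions on all of [0, 1] for small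
  -- speeds.
  have hinv : (fderiv ℝ G u ∘L .inr ℝ (ℝ × Z) C(unitInterval, Z)).IsInvertible := by
    have : fderiv ℝ G u ∘L .inr ℝ (ℝ × Z) C(unitInterval, Z) = ContinuousLinearMap.id ℝ _ := by
      ext h τ
      simp [hGf, hu]
    rw [this]
    exact ⟨ContinuousLinearEquiv.refl ℝ _, rfl⟩
  have cdf : ContDiffAt ℝ 1 G u := hGd.contDiffAt
  set Y := cdf.implicitFunction one_ne_zero hinv with hY
  have hY0 : Y (0, z₀) = cst z₀ := cdf.implicitFunction_apply_self one_ne_zero hinv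
  have hYd : ContDiffAt ℝ 1 Y (0, z₀) := cdf.contDiffAt_implicitFunction one_ne_zero hinv
  have hYe : ∀ᶠ x in 𝓝 ((0 : ℝ), z₀), G (x, Y x) = 0 := by
    have := cdf.eventually_apply_implicitFunction one_ne_zero hinv
    rwa [hGu] at this
  have hYd' : ∀ᶠ x in 𝓝 ((0 : ℝ), z₀), ContDiffAt ℝ 1 Y x := hYd.eventually (by simp)
  have hYO : ∀ᶠ x in 𝓝 ((0 : ℝ), z₀), ∀ τ, Y x τ ∈ O ∩ O' := by
    have h1 : ∀ᶠ f : C(unitInterval, Z) in 𝓝 (cst z₀), MapsTo f univ (O ∩ O') :=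
      ContinuousMap.eventually_mapsTo isCompact_univ (hO.inter hO') (fun τ _ ↦ ⟨hz₀, hz₀'⟩)
    have h2 := hYd.continuousAt.tendsto
    rw [hY0] at h2
    filter_upwards [h2.eventually h1] with x hx τ using hx (mem_univ τ)
  obtain ⟨U, hU, hUo, hU0⟩ := eventually_nhds_iff.1 (hYe.and (hYd'.and hYO))
  have hYder : ∀ x ∈ U, HasFDerivAt Y (fderiv ℝ Y x) x := fun x hx ↦
    ((hU x hx).2.1.differentiableAt one_ne_zero).hasFDerivAt
  have hYC : ContDiffOn ℝ 1 Y U := fun x hx ↦ (hU x hx).2.1.contDiffWithinAt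
  have hYfc : ContinuousOn (fderiv ℝ Y) U := hYC.continuousOn_fderiv_of_isOpen hUo le_rfl
  -- The solutions stay in the open set O', where χ = 1, so V and its derivative may be replaced by
  -- those of W.
  have hVW : ∀ x ∈ U, ∀ τ, V (Y x τ) = W (Y x τ) ∧ fderiv ℝ V (Y x τ) = fderiv ℝ W (Y x τ) := by
    intro x hx τ
    have hm := ((hU x hx).2.2 τ).2
    refine ⟨by simp [V, hO'1 _ hm], ?_⟩
    refine Filter.EventuallyEq.fderiv_eq ?_
    filter_upwards [hO'.mem_nhds hm] with z hz
    simp [V, hO'1 _ hz]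
  have eq1 : ∀ x ∈ U, Y x = cst x.2 + x.1 • pathPrimitive (N (Y x)) := by
    intro x hx
    have := (hU x hx).1
    simp only [hG] at this
    rw [sub_sub, sub_eq_zero] at this
    exact this
  -- Differentiating G(x, Y x) = 0 in x gives the variational equation in integrated form.
  have eq2 : ∀ x ∈ U, ∀ v, fderiv ℝ Y x v = cst v.2 + (v.1 • pathPrimitive (N (Y x)) +
      x.1 • pathPrimitive (fderiv ℝ N (Y x) (fderiv ℝ Y x v))) := by
    intro x hx v
    have h1 : HasFDerivAt (fun x ↦ G (x, Y x)) _ x :=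
      (hGd.differentiable one_ne_zero (x, Y x)).hasFDerivAt.comp x
        ((hasFDerivAt_id x).prodMk (hYder x hx))
    have h2 : (fun x ↦ G (x, Y x)) =ᶠ[𝓝 x] fun _ ↦ 0 := by
      filter_upwards [hUo.mem_nhds hx] with z hz using (hU z hz).1
    have h3 := h1.unique ((hasFDerivAt_const (0 : C(unitInterval, Z)) x).congr_of_eventuallyEq h2)
    have h4 := congrArg (fun L ↦ L v) h3
    simp [hGf] at h4
    rw [sub_sub, sub_eq_zero] at h4
    exact h4
  refine ⟨U, fun x ↦ IccExtend zero_le_one (Y x),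
    fun x τ ↦ (ContinuousMap.evalCLM ℝ (projIcc 0 1 zero_le_one τ)).comp (fderiv ℝ Y x),
    hUo, hU0, fun x hx τ hτ ↦ ((hU x hx).2.2 _).1, ?_, ?_, ?_, ?_, ?_, ?_⟩
  · intro x hx
    have h0 : (0 : ℝ) ∈ Icc (0 : ℝ) 1 := ⟨le_rfl, zero_le_one⟩
    change IccExtend zero_le_one (Y x) 0 = x.2
    rw [IccExtend_of_mem _ _ h0, eq1 x hx, ContinuousMap.add_apply, ContinuousMap.smul_apply]
    have : pathPrimitive (N (Y x)) ⟨0, h0⟩ = 0 := pathPrimitive_zero _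
    rw [this, smul_zero, add_zero, hcst]
  · intro x hx τ hτ
    have h1 := ((hasDerivWithinAt_pathPrimitive (N (Y x)) ⟨τ, hτ⟩).const_smul x.1).const_add x.2
    have h2 : (N (Y x)) ⟨τ, hτ⟩ = W (IccExtend zero_le_one (Y x) τ) := by
      rw [IccExtend_of_mem _ _ hτ, ← (hVW x hx _).1]; rfl
    rw [h2] at h1
    refine h1.congr_of_mem (fun σ hσ ↦ ?_) hτ
    change IccExtend zero_le_one (Y x) σ = _
    rw [IccExtend_of_mem _ _ hσ, eq1 x hx]
    simp only [ContinuousMap.add_apply, ContinuousMap.smul_apply, hcst, Pi.smul_apply]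
    rw [IccExtend_of_mem _ _ hσ, ← eq1 x hx]
  · intro x hx τ hτ
    exact (ContinuousMap.evalCLM ℝ (projIcc 0 1 zero_le_one τ)).hasFDerivAt.comp x (hYder x hx)
  · intro τ hτ
    exact continuousOn_const.clm_comp hYfc
  · intro x hx v
    have h0 : (0 : ℝ) ∈ Icc (0 : ℝ) 1 := ⟨le_rfl, zero_le_one⟩
    change fderiv ℝ Y x v (projIcc 0 1 zero_le_one 0) = v.2
    have hz : ∀ f : C(unitInterval, Z), pathPrimitive f (projIcc 0 1 zero_le_one 0) = 0 := by
      intro f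
      have : projIcc (0 : ℝ) 1 zero_le_one 0 = 0 := by
        rw [projIcc_of_mem _ h0]; rfl
      rw [this, pathPrimitive_zero]
    rw [eq2 x hx v]
    simp only [ContinuousMap.add_apply, ContinuousMap.smul_apply, hz, hcst, smul_zero, add_zero]
  · intro x hx v τ hτ
    have h1 := ((hasDerivWithinAt_pathPrimitive (N (Y x)) ⟨τ, hτ⟩).const_smul v.1).add
      ((hasDerivWithinAt_pathPrimitive (fderiv ℝ N (Y x) (fderiv ℝ Y x v)) ⟨τ, hτ⟩).const_smul x.1)
    have h1 := h1.const_add v.2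
    have h2 : (N (Y x)) ⟨τ, hτ⟩ = W (IccExtend zero_le_one (Y x) τ) := by
      rw [IccExtend_of_mem _ _ hτ, ← (hVW x hx _).1]; rfl
    have h3 : (fderiv ℝ N (Y x) (fderiv ℝ Y x v)) ⟨τ, hτ⟩ =
        fderiv ℝ W (IccExtend zero_le_one (Y x) τ) (IccExtend zero_le_one (fderiv ℝ Y x v) τ) := by
      rw [IccExtend_of_mem _ _ hτ, IccExtend_of_mem _ _ hτ, ← (hVW x hx _).2, hN']
      rfl
    rw [h2, h3] at h1
    refine h1.congr_of_mem (fun σ hσ ↦ ?_) hτ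
    change fderiv ℝ Y x v (projIcc 0 1 zero_le_one σ) = _
    conv_lhs => rw [eq2 x hx v]
    simp only [ContinuousMap.add_apply, ContinuousMap.smul_apply, hcst, Pi.smul_apply, Pi.add_apply]
    rfl

end Flow

/-! ### Flows preserving the anchor relation, parametric integrals, the fundamental lemma -/

section ParametricIntegrals

open MeasureTheory

theorem eq_of_hasDerivWithinAt_zero_unitInterval {G : Type*} [NormedAddCommGroup G]
    [NormedSpace ℝ G] {f : ℝ → G} (hf : ∀ τ ∈ Icc (0 : ℝ) 1, HasDerivWithinAt f 0 (Icc 0 1) τ) :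
    f 1 = f 0 := by
  have h1 : ((1 : ℝ)) ∈ Icc (0 : ℝ) 1 := ⟨zero_le_one, le_rfl⟩
  refine constant_of_derivWithin_zero (fun τ hτ ↦ (hf τ hτ).differentiableWithinAt)
    (fun τ hτ ↦ (hf τ (Ico_subset_Icc_self hτ)).derivWithin ?_) 1 h1
  exact uniqueDiffOn_Icc zero_lt_one τ (Ico_subset_Icc_self hτ)

/-- Let `ρ` and `c` be the coordinate expressions of an anchor and of the bracket with a constant
section `u`. The flow of `(x, a) ↦ (ρ x u, c x a)` deforms paths with `q' = ρ a` into such paths. -/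
theorem exists_anchored_flow {E F : Type*} [NormedAddCommGroup E] [NormedSpace ℝ E]
    [FiniteDimensional ℝ E] [NormedAddCommGroup F] [NormedSpace ℝ F] [FiniteDimensional ℝ F]
    {O : Set E} (hO : IsOpen O) {ρ : E → F →L[ℝ] E} {c : E → F →L[ℝ] F} {u : F}
    (hρ : ContDiffOn ℝ 2 ρ O) (hc : ContDiffOn ℝ 2 c O)
    (hρc : ∀ x ∈ O, ∀ a, fderiv ℝ ρ x (ρ x u) a + ρ x (c x a) = fderiv ℝ ρ x (ρ x a) u)
    {z₀ : E × F} (hz₀ : z₀.1 ∈ O) :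
    ∃ (U : Set (ℝ × (E × F))) (y : ℝ × (E × F) → E × F),
      IsOpen U ∧ (0, z₀) ∈ U ∧ ContDiffOn ℝ 1 y U ∧ (∀ x ∈ U, (y x).1 ∈ O) ∧
      (∀ z, (0, z) ∈ U → y (0, z) = z) ∧
      (∀ z, (0, z) ∈ U → fderiv ℝ y (0, z) (1, 0) = (ρ z.1 u, c z.1 z.2)) ∧
      (∀ x ∈ U, ∀ (r : ℝ) (b : F), (fderiv ℝ y x (r, (ρ x.2.1 x.2.2, b))).1 =
        ρ (y x).1 ((y x).2 + r • u)) := by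
  have h1I : ((1 : ℝ)) ∈ Icc (0 : ℝ) 1 := ⟨zero_le_one, le_rfl⟩
  set W : E × F → E × F := fun z ↦ (ρ z.1 u, c z.1 z.2) with hWdef
  have hO' : IsOpen (O ×ˢ (univ : Set F)) := hO.prod isOpen_univ
  have hfst : MapsTo (Prod.fst : E × F → E) (O ×ˢ (univ : Set F)) O := fun z hz ↦ hz.1
  have hW : ContDiffOn ℝ 2 W (O ×ˢ univ) :=
    ((hρ.comp contDiffOn_fst hfst).clm_apply contDiffOn_const).prodMk
      ((hc.comp contDiffOn_fst hfst).clm_apply contDiffOn_snd)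
  have hρd : ∀ x ∈ O, HasFDerivAt ρ (fderiv ℝ ρ x) x := fun x hx ↦
    ((hρ.contDiffAt (hO.mem_nhds hx)).differentiableAt two_ne_zero).hasFDerivAt
  have hWf : ∀ z : E × F, z.1 ∈ O → ∀ v, (fderiv ℝ W z v).1 = fderiv ℝ ρ z.1 v.1 u := by
    intro z hz v
    have hd : DifferentiableAt ℝ W z :=
      (hW.contDiffAt (hO'.mem_nhds ⟨hz, mem_univ _⟩)).differentiableAt two_ne_zero
    have h1 : HasFDerivAt (fun z : E × F ↦ ρ z.1 u) _ z :=
      ((hρd _ hz).comp z hasFDerivAt_fst).clm_apply (hasFDerivAt_const u z)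
    have h2 := (hasFDerivAt_fst (𝕜 := ℝ)).comp z hd.hasFDerivAt
    have h3 := congrArg (fun L ↦ L v) (h2.unique h1)
    simpa using h3
  obtain ⟨U, y, D, hU, h0, hyO, hy0, hy, hyD, hDc, hD0, hD⟩ := exists_flow hO' hW
    (z₀ := z₀) ⟨hz₀, mem_univ _⟩
  have hfd : ∀ x ∈ U, fderiv ℝ (fun x ↦ y x 1) x = D x 1 := fun x hx ↦ (hyD x hx 1 h1I).fderiv
  have hconst : ∀ z, (0, z) ∈ U → ∀ τ ∈ Icc (0 : ℝ) 1, y (0, z) τ = z := by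
    intro z hz τ hτ
    refine Eq.trans ?_ (hy0 _ hz)
    refine constant_of_derivWithin_zero (f := y (0, z))
      (fun τ hτ ↦ (hy _ hz τ hτ).differentiableWithinAt) (fun τ hτ ↦ ?_) τ hτ
    rw [(hy _ hz τ (Ico_subset_Icc_self hτ)).derivWithin
      (uniqueDiffOn_Icc zero_lt_one τ (Ico_subset_Icc_self hτ))]
    exact zero_smul ℝ _
  refine ⟨U, fun x ↦ y x 1, hU, h0, ?_, fun x hx ↦ (hyO x hx 1 h1I).1, ?_, ?_, ?_⟩
  · rw [show (1 : WithTop ℕ∞) = 0 + 1 from rfl, contDiffOn_succ_iff_fderiv_of_isOpen hU]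
    refine ⟨fun x hx ↦ (hyD x hx 1 h1I).differentiableAt.differentiableWithinAt,
      fun h ↦ by simp at h, ?_⟩
    rw [contDiffOn_zero]
    exact (hDc 1 h1I).congr fun x hx ↦ hfd x hx
  · intro z hz
    exact hconst z hz 1 h1I
  · intro z hz
    rw [hfd _ hz]
    -- At speed 0 the trajectory is constant, and the variational equation in the direction (1, 0)
    -- reduces to D' = W z with D(0) = 0, so D(τ) = τ W z.
    have h1 : ∀ τ ∈ Icc (0 : ℝ) 1, HasDerivWithinAt
        (fun τ ↦ D (0, z) τ (1, 0) - τ • W z) 0 (Icc 0 1) τ := by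
      intro τ hτ
      have h2 := (hD _ hz (1, 0) τ hτ).sub ((hasDerivWithinAt_id τ (Icc 0 1)).smul_const (W z))
      refine h2.congr_deriv ?_
      simp [hconst z hz τ hτ]
    have h3 := eq_of_hasDerivWithinAt_zero_unitInterval h1
    simp only [hD0 _ hz, one_smul, zero_smul, sub_zero] at h3
    rw [sub_eq_zero.1 h3]
  · intro x hx r b
    rw [hfd _ hx]
    set v : ℝ × (E × F) := (r, (ρ x.2.1 x.2.2, b)) with hv
    have hyc : ContinuousOn (y x) (Icc 0 1) := fun τ hτ ↦ (hy x hx τ hτ).continuousWithinAt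
    have hyO1 : ∀ τ ∈ Icc (0 : ℝ) 1, (y x τ).1 ∈ O := fun τ hτ ↦ (hyO x hx τ hτ).1
    have hfc : ContinuousOn (fun τ ↦ fderiv ℝ ρ (y x τ).1) (Icc 0 1) :=
      (hρ.continuousOn_fderiv_of_isOpen hO one_le_two).comp
        (continuous_fst.comp_continuousOn hyc) hyO1
    -- With y = (y₁, y₂), both the base component of D v and ρ(y₁)(y₂ + τ r u) solve the linear
    -- equation ξ' = r ρ(y₁) u + B ξ with the same value at τ = 0; for the second curve this is
    -- where `hρc` enters. Uniqueness, read at τ = 1, is the claim.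
    let B : ℝ → E →L[ℝ] E := fun τ ↦ x.1 • (fderiv ℝ ρ (y x τ).1).flip u
    have hBc : ContinuousOn B (Icc 0 1) := by
      exact (((ContinuousLinearMap.flipₗᵢ ℝ E F E).continuous.comp_continuousOn hfc).clm_apply
        continuousOn_const).const_smul x.1
    obtain ⟨K, hK⟩ := isCompact_Icc.exists_bound_of_continuousOn hBc
    let w : ℝ → E → E := fun τ ξ ↦ r • ρ (y x τ).1 u + B τ ξ
    have hlip : ∀ τ ∈ Ico (0 : ℝ) 1, LipschitzOnWith K.toNNReal (w τ) univ := by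
      intro τ hτ
      refine LipschitzOnWith.of_dist_le_mul fun ξ _ ζ _ ↦ ?_
      rw [dist_eq_norm, dist_eq_norm, add_sub_add_left_eq_sub, ← map_sub]
      refine ((B τ).le_opNorm _).trans ?_
      gcongr
      exact (hK τ (Ico_subset_Icc_self hτ)).trans (Real.le_coe_toNNReal K)
    have hf : ∀ τ ∈ Icc (0 : ℝ) 1, HasDerivWithinAt (fun τ ↦ (D x τ v).1)
        (w τ (D x τ v).1) (Icc 0 1) τ := by
      intro τ hτ
      have h1 := (hasFDerivAt_fst (𝕜 := ℝ) (p := D x τ v)).comp_hasDerivWithinAt τ (hD x hx v τ hτ)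
      refine h1.congr_deriv ?_
      simp [w, B, hWf _ (hyO1 τ hτ), W, v]
    have hg : ∀ τ ∈ Icc (0 : ℝ) 1, HasDerivWithinAt
        (fun τ ↦ ρ (y x τ).1 ((y x τ).2 + τ • r • u))
        (w τ (ρ (y x τ).1 ((y x τ).2 + τ • r • u))) (Icc 0 1) τ := by
      intro τ hτ
      have e1 : HasDerivWithinAt (fun τ ↦ (y x τ).1) _ (Icc 0 1) τ :=
        (hasFDerivAt_fst (𝕜 := ℝ) (p := y x τ)).comp_hasDerivWithinAt τ (hy x hx τ hτ)
      have e2 : HasDerivWithinAt (fun τ ↦ (y x τ).2) _ (Icc 0 1) τ :=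
        (hasFDerivAt_snd (𝕜 := ℝ) (p := y x τ)).comp_hasDerivWithinAt τ (hy x hx τ hτ)
      have e3 := (hρd _ (hyO1 τ hτ)).comp_hasDerivWithinAt τ e1
      have e4 := e3.clm_apply (e2.add ((hasDerivWithinAt_id τ (Icc 0 1)).smul_const (r • u)))
      refine e4.congr_deriv ?_
      have := hρc _ (hyO1 τ hτ) (y x τ).2
      simp only [W, w, B, map_add, map_smul, ContinuousLinearMap.coe_fst',
        ContinuousLinearMap.coe_snd', Function.comp_apply, id_eq,
        Pi.add_apply, add_apply, smul_apply, ContinuousLinearMap.flip_apply, smul_add, one_smul,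
        ← this]
      module
    have hEq := ODE_solution_unique_of_mem_Icc_right hlip
      (fun τ hτ ↦ (hf τ hτ).continuousWithinAt)
      (fun τ hτ ↦ (hf τ (Ico_subset_Icc_self hτ)).mono_of_mem_nhdsWithin
        (Icc_mem_nhdsGE_of_mem hτ)) (fun _ _ ↦ mem_univ _)
      (fun τ hτ ↦ (hg τ hτ).continuousWithinAt)
      (fun τ hτ ↦ (hg τ (Ico_subset_Icc_self hτ)).mono_of_mem_nhdsWithin
        (Icc_mem_nhdsGE_of_mem hτ)) (fun _ _ ↦ mem_univ _)
      (by simp [hD0 x hx, hy0 x hx, v])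
    have := hEq h1I
    simpa using this

/-- Differentiation under the integral sign for a `C¹` family. -/
theorem hasDerivAt_integral_of_contDiffOn {t₀ t₁ δ : ℝ} (ht : t₀ < t₁) (hδ : 0 < δ)
    {f : ℝ → ℝ → ℝ} (hf : ContDiffOn ℝ 1 (Function.uncurry f) (Ioo (-δ) δ ×ˢ Icc t₀ t₁)) :
    HasDerivAt (fun ε ↦ ∫ t in t₀..t₁, f ε t) (∫ t in t₀..t₁, deriv (fun ε ↦ f ε t) 0) 0 := by
  set S := Ioo (-δ) δ ×ˢ Icc t₀ t₁ with hS
  have hu : UniqueDiffOn ℝ S := (uniqueDiffOn_Ioo _ _).prod (uniqueDiffOn_Icc ht)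
  have hfc : ContinuousOn (fderivWithin ℝ (Function.uncurry f) S) S :=
    hf.continuousOn_fderivWithin hu le_rfl
  have hder : ∀ ε ∈ Ioo (-δ) δ, ∀ t ∈ Icc t₀ t₁,
      HasDerivAt (fun ε ↦ f ε t) (fderivWithin ℝ (Function.uncurry f) S (ε, t) (1, 0)) ε := by
    intro ε hε t htt
    have h1 := (hf.differentiableOn one_ne_zero (ε, t) ⟨hε, htt⟩).hasFDerivWithinAt
    have h2 : HasDerivWithinAt (fun ε : ℝ ↦ (ε, t)) ((1 : ℝ), (0 : ℝ)) (Ioo (-δ) δ) ε :=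
      (hasDerivWithinAt_id ε _).prodMk (hasDerivWithinAt_const ε _ t)
    exact (h1.comp_hasDerivWithinAt ε h2 (fun x hx ↦ mk_mem_prod hx htt)).hasDerivAt
      (isOpen_Ioo.mem_nhds hε)
  -- On the halved interval of parameters the ε-derivative is bounded by compactness; the bound C
  -- serves as the dominating function.
  have hK : IsCompact (Icc (-(δ / 2)) (δ / 2) ×ˢ Icc t₀ t₁) := isCompact_Icc.prod isCompact_Icc
  have hKS : Icc (-(δ / 2)) (δ / 2) ×ˢ Icc t₀ t₁ ⊆ S := by
    refine prod_mono (fun x hx ↦ ⟨?_, ?_⟩) subset_rfl <;> linarith [hx.1, hx.2]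
  obtain ⟨C, hC⟩ := hK.exists_bound_of_continuousOn
    ((hfc.clm_apply continuousOn_const).mono hKS : ContinuousOn
      (fun z ↦ fderivWithin ℝ (Function.uncurry f) S z (1, 0)) _)
  have hsec : ∀ ε ∈ Ioo (-δ) δ, ContinuousOn (f ε) (Icc t₀ t₁) := fun ε hε ↦
    hf.continuousOn.comp (continuousOn_const.prodMk continuousOn_id) (fun t h ↦ ⟨hε, h⟩)
  have h00 : (0 : ℝ) ∈ Ioo (-δ) δ := ⟨by linarith, hδ⟩
  have hIoc : uIoc t₀ t₁ ⊆ Icc t₀ t₁ := by rw [uIoc_of_le ht.le]; exact Ioc_subset_Icc_self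
  have hms : MeasurableSet (uIoc t₀ t₁) := measurableSet_uIoc
  have hd0 : ContinuousOn (fun t ↦ deriv (fun ε ↦ f ε t) 0) (Icc t₀ t₁) := by
    have : ContinuousOn (fun t ↦ fderivWithin ℝ (Function.uncurry f) S (0, t) (1, 0))
        (Icc t₀ t₁) :=
      (hfc.comp (continuousOn_const.prodMk continuousOn_id) (fun t h ↦ ⟨h00, h⟩)).clm_apply
        continuousOn_const
    exact this.congr fun t h ↦ (hder 0 h00 t h).deriv
  refine (intervalIntegral.hasDerivAt_integral_of_dominated_loc_of_deriv_le
    (F := f) (F' := fun ε t ↦ deriv (fun ε ↦ f ε t) ε) (bound := fun _ ↦ C)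
    (s := Ioo (-(δ / 2)) (δ / 2)) (Ioo_mem_nhds (by linarith) (by linarith)) ?_ ?_ ?_ ?_ ?_ ?_).2
  · filter_upwards [isOpen_Ioo.mem_nhds h00] with ε hε
    exact ((hsec ε hε).mono hIoc).aestronglyMeasurable hms
  · exact (hsec 0 h00).intervalIntegrable_of_Icc ht.le
  · exact (hd0.mono hIoc).aestronglyMeasurable hms
  · refine Eventually.of_forall fun t h ε hε ↦ ?_
    rw [(hder ε ⟨by linarith [hε.1], by linarith [hε.2]⟩ t (hIoc h)).deriv]
    exact hC (ε, t) ⟨Ioo_subset_Icc_self hε, hIoc h⟩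
  · exact intervalIntegrable_const
  · refine Eventually.of_forall fun t h ε hε ↦ ?_
    exact (hder ε ⟨by linarith [hε.1], by linarith [hε.2]⟩ t (hIoc h)).differentiableAt.hasDerivAt

/-- The fundamental lemma of the calculus of variations, in the form `(d/dt) P = g`. -/
theorem derivWithin_eq_of_forall_integral_eq_zero {t₀ t₁ t : ℝ} (ht : t₀ < t₁)
    (htI : t ∈ Icc t₀ t₁) {K : Set ℝ} (hK : IsOpen K) (htK : t ∈ K) {P g : ℝ → ℝ}
    (hP : ContDiffOn ℝ 1 P (Icc t₀ t₁ ∩ K)) (hg : ContinuousOn g (Icc t₀ t₁ ∩ K))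
    (h : ∀ φ : ℝ → ℝ, ContDiff ℝ ∞ φ → HasCompactSupport φ → tsupport φ ⊆ K ∩ Ioo t₀ t₁ →
      ∫ x in t₀..t₁, (deriv φ x * P x + φ x * g x) = 0) :
    derivWithin P (Icc t₀ t₁) t = g t := by
  set U := K ∩ Ioo t₀ t₁ with hU
  have hUo : IsOpen U := hK.inter isOpen_Ioo
  have hUS : U ⊆ Icc t₀ t₁ ∩ K := fun x hx ↦ ⟨Ioo_subset_Icc_self hx.2, hx.1⟩
  have hu : UniqueDiffOn ℝ (Icc t₀ t₁ ∩ K) := (uniqueDiffOn_Icc ht).inter hK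
  have hdw : ∀ x ∈ Icc t₀ t₁ ∩ K,
      derivWithin P (Icc t₀ t₁ ∩ K) x = derivWithin P (Icc t₀ t₁) x := fun x hx ↦
    derivWithin_inter (hK.mem_nhds hx.2)
  have hPc : ContinuousOn (derivWithin P (Icc t₀ t₁)) (Icc t₀ t₁ ∩ K) :=
    (hP.continuousOn_derivWithin hu le_rfl).congr fun x hx ↦ (hdw x hx).symm
  set G : ℝ → ℝ := fun x ↦ g x - derivWithin P (Icc t₀ t₁) x with hG
  have hGc : ContinuousOn G (Icc t₀ t₁ ∩ K) := hg.sub hPc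
  have hPd : ∀ x ∈ U, HasDerivAt P (derivWithin P (Icc t₀ t₁) x) x := by
    intro x hx
    rw [← hdw x (hUS hx)]
    exact ((hP.differentiableOn one_ne_zero x (hUS hx)).hasDerivWithinAt).hasDerivAt
      (mem_of_superset (hUo.mem_nhds hx) hUS)
  -- Since P is C¹, integrating φ' P by parts turns the hypothesis into ∫ φ G = 0 for every test
  -- function supported in U.
  have hae : ∀ᵐ x ∂volume, x ∈ U → G x = 0 := by
    refine hUo.ae_eq_zero_of_integral_contDiff_smul_eq_zero
      ((hGc.mono hUS).locallyIntegrableOn hUo.measurableSet) fun φ hφ hφc hφU ↦ ?_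
    have hφ0 : ∀ x, x ∉ U → φ x = 0 := fun x hx ↦
      image_eq_zero_of_notMem_tsupport fun h ↦ hx (hφU h)
    have hφ0' : ∀ x, x ∉ U → deriv φ x = 0 := fun x hx ↦
      image_eq_zero_of_notMem_tsupport fun h ↦ hx (hφU (tsupport_deriv_subset h))
    have hcont : ∀ {ψ k : ℝ → ℝ}, Continuous ψ → tsupport ψ ⊆ U → ContinuousOn k U →
        Continuous fun x ↦ ψ x * k x := by
      intro ψ k hψ hψU hk
      rw [continuous_iff_continuousAt]
      intro x
      by_cases hx : x ∈ tsupport ψ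
      · exact hψ.continuousAt.mul (hk.continuousAt (hUo.mem_nhds (hψU hx)))
      · refine continuousAt_const (y := (0 : ℝ)) |>.congr ?_
        filter_upwards [(isClosed_tsupport ψ).isOpen_compl.mem_nhds hx] with z hz
        simp [image_eq_zero_of_notMem_tsupport hz]
    have hφ1 : Continuous φ := hφ.continuous
    have hφ2 : Continuous (deriv φ) := hφ.continuous_deriv (by norm_cast)
    have c1 := hcont hφ1 hφU (hP.continuousOn.mono hUS)
    have c2 := hcont hφ2 (tsupport_deriv_subset.trans hφU) (hP.continuousOn.mono hUS)
    have c3 := hcont hφ1 hφU (hPc.mono hUS)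
    have c4 := hcont hφ1 hφU (hg.mono hUS)
    have c5 := hcont hφ1 hφU (hGc.mono hUS)
    have i1 : ∫ x in t₀..t₁, (deriv φ x * P x + φ x * derivWithin P (Icc t₀ t₁) x) = 0 := by
      have e := intervalIntegral.integral_eq_sub_of_hasDerivAt_of_le ht.le
        (f := fun x ↦ φ x * P x)
        (f' := fun x ↦ deriv φ x * P x + φ x * derivWithin P (Icc t₀ t₁) x)
        c1.continuousOn (fun x hx ↦ ?_) ((c2.add c3).intervalIntegrable _ _)
      · rw [e, hφ0 t₁ (fun h ↦ h.2.2.ne rfl), hφ0 t₀ (fun h ↦ h.2.1.ne rfl)]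
        simp
      · by_cases hxU : x ∈ U
        · exact ((hφ.differentiable (by simp)) x).hasDerivAt.mul (hPd x hxU)
        · rw [hφ0 x hxU, hφ0' x hxU, zero_mul, zero_mul, add_zero]
          refine (hasDerivAt_const x (0 : ℝ)).congr_of_eventuallyEq ?_
          filter_upwards [(isClosed_tsupport φ).isOpen_compl.mem_nhds
            (fun h ↦ hxU (hφU h))] with z hz
          simp [image_eq_zero_of_notMem_tsupport hz]
    have i2 : ∫ x in t₀..t₁, φ x * G x = 0 := by
      have e : ∀ x, φ x * G x = (deriv φ x * P x + φ x * g x) -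
          (deriv φ x * P x + φ x * derivWithin P (Icc t₀ t₁) x) := fun x ↦ by
        simp only [hG]; ring
      simp_rw [e]
      have e' := intervalIntegral.integral_sub ((c2.add c4).intervalIntegrable (μ := volume) t₀ t₁)
        ((c2.add c3).intervalIntegrable t₀ t₁)
      simp only [Pi.add_apply] at e'
      rw [e', i1, h φ hφ hφc hφU, sub_zero]
    rw [intervalIntegral.integral_of_le ht.le] at i2
    rw [← i2]
    refine (setIntegral_eq_integral_of_forall_compl_eq_zero fun x hx ↦ ?_).symm
    rw [hφ0 x (fun h ↦ hx (Ioo_subset_Ioc_self h.2)), zero_smul]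
  have hGU : EqOn G 0 U := by
    refine Measure.eqOn_open_of_ae_eq (μ := volume) ?_ hUo (hGc.mono hUS) continuousOn_const
    rw [EventuallyEq, ae_restrict_iff' hUo.measurableSet]
    exact hae
  -- The time t may be an end point of the interval. It is still a limit of points of U, and G is
  -- continuous up to it.
  have hcl : t ∈ closure U := by
    have h1 : t ∈ closure (Ioo t₀ t₁) := by rw [closure_Ioo ht.ne]; exact htI
    exact hK.inter_closure ⟨htK, h1⟩
  have hGt : G t = 0 := by
    have : (𝓝[U] t).NeBot := mem_closure_iff_nhdsWithin_neBot.1 hcl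
    refine tendsto_nhds_unique (((hGc t ⟨htI, htK⟩).mono hUS).tendsto)
      (Tendsto.congr' ?_ tendsto_const_nhds)
    filter_upwards [self_mem_nhdsWithin] with x hx using (hGU hx).symm
  exact (sub_eq_zero.1 hGt).symm

end ParametricIntegrals

/-! ### Coordinates on the total space of a vector bundle -/

section Coordinates

variable {E : Type*} [NormedAddCommGroup E] [NormedSpace ℝ E]
  {Q : Type*} [TopologicalSpace Q] [ChartedSpace E Q]
  {F : Type*} [NormedAddCommGroup F] [NormedSpace ℝ F]
  {V : Q → Type*} [TopologicalSpace (TotalSpace F V)]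
  [∀ x, AddCommGroup (V x)] [∀ x, Module ℝ (V x)] [∀ x, TopologicalSpace (V x)]
  [FiberBundle F V]

variable (E F V) in
/-- The common domain of the preferred chart and the preferred trivialization at `x₀`. -/
def coordSet (x₀ : Q) : Set Q := (chartAt E x₀).source ∩ (trivializationAt F V x₀).baseSet

theorem isOpen_coordSet (x₀ : Q) : IsOpen (coordSet E F V x₀) :=
  (chartAt E x₀).open_source.inter (trivializationAt F V x₀).open_baseSet

theorem mem_coordSet_self (x₀ : Q) : x₀ ∈ coordSet E F V x₀ :=
  ⟨mem_chart_source E x₀, FiberBundle.mem_baseSet_trivializationAt' x₀⟩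

/-- The fibre coordinate given by the preferred trivialization at `x₀`. -/
def fibCoord (F : Type*) [NormedAddCommGroup F] {V : Q → Type*} [TopologicalSpace (TotalSpace F V)]
    [∀ x, TopologicalSpace (V x)] [FiberBundle F V] (x₀ : Q) {x : Q} (u : V x) : F :=
  (trivializationAt F V x₀ (TotalSpace.mk' F x u)).2

variable (E) in
/-- The coordinates on the total space given by the preferred chart and trivialization at `x₀`. -/
def bundleCoord (x₀ : Q) (z : TotalSpace F V) : E × F :=
  (extChartAt 𝓘(ℝ, E) x₀ z.proj, fibCoord F x₀ z.2)

/-- The chart of the total space at a point depends only on the base point, so the chart at the zero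
vector over x₀ covers everything over `coordSet`. This lets one coordinate system serve for all
points of the fibres, and makes the manifold API for extended charts available for `bundleCoord`. -/
theorem mem_extChartAt_zero_source {x₀ : Q} {z : TotalSpace F V} :
    z ∈ (extChartAt (𝓘(ℝ, E).prod 𝓘(ℝ, F)) (TotalSpace.mk' F x₀ (0 : V x₀))).source ↔
      z.proj ∈ coordSet E F V x₀ := by
  rw [FiberBundle.extChartAt, PartialEquiv.trans_source]
  simp only [coordSet, mem_inter_iff, mem_preimage, PartialEquiv.prod_source,
    PartialEquiv.refl_source, mem_prod, mem_univ, and_true, extChartAt_source]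
  constructor
  · rintro ⟨h1, h2⟩
    have h1 : z.proj ∈ (trivializationAt F V x₀).baseSet :=
      (trivializationAt F V x₀).mem_source.1 h1
    refine ⟨?_, h1⟩
    have : (trivializationAt F V x₀ z).1 = z.proj := (trivializationAt F V x₀).coe_fst' h1
    rw [← this]; exact h2
  · rintro ⟨h2, h1⟩
    refine ⟨(trivializationAt F V x₀).mem_source.2 h1, ?_⟩
    have : (trivializationAt F V x₀ z).1 = z.proj := (trivializationAt F V x₀).coe_fst' h1
    change (trivializationAt F V x₀ z).1 ∈ _
    rw [this]; exact h2

theorem extChartAt_zero_eq {x₀ : Q} {z : TotalSpace F V} (hz : z.proj ∈ coordSet E F V x₀) :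
    extChartAt (𝓘(ℝ, E).prod 𝓘(ℝ, F)) (TotalSpace.mk' F x₀ (0 : V x₀)) z = bundleCoord E x₀ z := by
  rw [FiberBundle.extChartAt]
  change (extChartAt 𝓘(ℝ, E) x₀ (trivializationAt F V x₀ z).1, _) = _
  rw [(trivializationAt F V x₀).coe_fst' hz.2]
  rfl

theorem extChartAt_zero_eventuallyEq {x₀ : Q} {z : TotalSpace F V}
    (hz : z.proj ∈ coordSet E F V x₀) :
    bundleCoord E x₀ =ᶠ[𝓝 z]
      extChartAt (𝓘(ℝ, E).prod 𝓘(ℝ, F)) (TotalSpace.mk' F x₀ (0 : V x₀)) := by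
  have : Continuous (TotalSpace.proj (F := F) (E := V)) := FiberBundle.continuous_proj F V
  filter_upwards [((isOpen_coordSet x₀).preimage this).mem_nhds hz] with y hy
  exact (extChartAt_zero_eq hy).symm

variable (E) in
/-- The derivative of the coordinates `bundleCoord E x₀`. -/
def coordDeriv (x₀ : Q) (z : TotalSpace F V) :
    TangentSpace (𝓘(ℝ, E).prod 𝓘(ℝ, F)) z →L[ℝ] E × F :=
  mvfderiv (𝓘(ℝ, E).prod 𝓘(ℝ, F)) (bundleCoord E x₀) z

/-- The derivative of the preferred chart at `x₀`. -/
def chartDeriv (x₀ x : Q) : TangentSpace 𝓘(ℝ, E) x →L[ℝ] E :=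
  mvfderiv 𝓘(ℝ, E) (extChartAt 𝓘(ℝ, E) x₀) x

/-- Chain rule for `mvfderiv`. -/
theorem mvfderiv_comp_eq {EM : Type*} [NormedAddCommGroup EM] [NormedSpace ℝ EM] {HM : Type*}
    [TopologicalSpace HM] {IM : ModelWithCorners ℝ EM HM} {M : Type*} [TopologicalSpace M]
    [ChartedSpace HM M] {EN : Type*} [NormedAddCommGroup EN] [NormedSpace ℝ EN] {HN : Type*}
    [TopologicalSpace HN] {IN : ModelWithCorners ℝ EN HN} {N : Type*} [TopologicalSpace N]
    [ChartedSpace HN N] {G : Type*} [NormedAddCommGroup G] [NormedSpace ℝ G] {g : N → G} {f : M → N}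
    {x : M} (hg : MDifferentiableAt IN 𝓘(ℝ, G) g (f x)) (hf : MDifferentiableAt IM IN f x)
    (v : TangentSpace IM x) :
    mvfderiv IM (fun y ↦ g (f y)) x v = mvfderiv IN g (f x) (mfderiv IM IN f x v) :=
  congrArg (fun L ↦ L v) (mfderiv_comp x hg hf)

theorem hasDerivAt_of_mdifferentiableAt {G : Type*} [NormedAddCommGroup G] [NormedSpace ℝ G]
    {f : ℝ → G} {t : ℝ} (hf : MDifferentiableAt 𝓘(ℝ, ℝ) 𝓘(ℝ, G) f t) :
    HasDerivAt f (mvfderiv 𝓘(ℝ, ℝ) f t (1 : ℝ)) t := by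
  have h := (mdifferentiableAt_iff_differentiableAt.1 hf).hasDerivAt
  have : mvfderiv 𝓘(ℝ, ℝ) f t (1 : ℝ) = deriv f t := by
    change mfderiv 𝓘(ℝ, ℝ) 𝓘(ℝ, G) f t (1 : ℝ) = _
    rw [mfderiv_eq_fderiv]
    rfl
  rwa [this]

theorem mvfderiv_congr_of_eventuallyEq {EM : Type*} [NormedAddCommGroup EM] [NormedSpace ℝ EM]
    {HM : Type*} [TopologicalSpace HM] {IM : ModelWithCorners ℝ EM HM} {M : Type*}
    [TopologicalSpace M] [ChartedSpace HM M] {G : Type*} [NormedAddCommGroup G] [NormedSpace ℝ G]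
    {f g : M → G} {x : M} (h : f =ᶠ[𝓝 x] g) (v : TangentSpace IM x) :
    mvfderiv IM f x v = mvfderiv IM g x v := by
  unfold mvfderiv
  rw [h.mfderiv_eq, h.eq_of_nhds]

theorem mvfderiv_clm_comp {EM : Type*} [NormedAddCommGroup EM] [NormedSpace ℝ EM]
    {HM : Type*} [TopologicalSpace HM] {IM : ModelWithCorners ℝ EM HM} {M : Type*}
    [TopologicalSpace M] [ChartedSpace HM M] {G G' : Type*} [NormedAddCommGroup G]
    [NormedSpace ℝ G] [NormedAddCommGroup G'] [NormedSpace ℝ G'] (T : G →L[ℝ] G') {f : M → G}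
    {x : M} (hf : MDifferentiableAt IM 𝓘(ℝ, G) f x) (v : TangentSpace IM x) :
    mvfderiv IM (fun y ↦ T (f y)) x v = T (mvfderiv IM f x v) := by
  rw [mvfderiv_comp_eq (T.differentiableAt.mdifferentiableAt) hf v]
  change mfderiv 𝓘(ℝ, G) 𝓘(ℝ, G') T (f x) _ = _
  rw [mfderiv_eq_fderiv, T.fderiv]
  rfl

theorem mvfderiv_prodMk {EM : Type*} [NormedAddCommGroup EM] [NormedSpace ℝ EM]
    {HM : Type*} [TopologicalSpace HM] {IM : ModelWithCorners ℝ EM HM} {M : Type*}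
    [TopologicalSpace M] [ChartedSpace HM M] {G G' : Type*} [NormedAddCommGroup G]
    [NormedSpace ℝ G] [NormedAddCommGroup G'] [NormedSpace ℝ G'] {f : M → G} {g : M → G'}
    {x : M} (hf : MDifferentiableAt IM 𝓘(ℝ, G) f x) (hg : MDifferentiableAt IM 𝓘(ℝ, G') g x)
    (v : TangentSpace IM x) :
    mvfderiv IM (fun y ↦ (f y, g y)) x v = (mvfderiv IM f x v, mvfderiv IM g x v) := by
  have h := hf.prodMk_space hg
  exact Prod.ext (mvfderiv_clm_comp (ContinuousLinearMap.fst ℝ G G') h v).symm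
    (mvfderiv_clm_comp (ContinuousLinearMap.snd ℝ G G') h v).symm

/-! ### Tangent vectors of the total space and vertical lifts in coordinates -/

section Derivatives

variable [VectorBundle ℝ F V] [IsManifold 𝓘(ℝ, E) ∞ Q] [ContMDiffVectorBundle ∞ F V 𝓘(ℝ, E)]

theorem mdifferentiableAt_bundleCoord {x₀ : Q} {z : TotalSpace F V}
    (hz : z.proj ∈ coordSet E F V x₀) :
    MDifferentiableAt (𝓘(ℝ, E).prod 𝓘(ℝ, F)) 𝓘(ℝ, E × F) (bundleCoord E x₀) z := by
  have h := mdifferentiableAt_extChartAt (I := 𝓘(ℝ, E).prod 𝓘(ℝ, F))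
    (x := TotalSpace.mk' F x₀ (0 : V x₀)) (y := z)
    (by rw [← extChartAt_source (𝓘(ℝ, E).prod 𝓘(ℝ, F)), mem_extChartAt_zero_source]; exact hz)
  exact h.congr_of_eventuallyEq (extChartAt_zero_eventuallyEq hz)

/-- Near z the coordinates agree with an extended chart, whose derivative is invertible. Tangent
vectors of the total space are identified through this. -/
theorem coordDeriv_injective {x₀ : Q} {z : TotalSpace F V} (hz : z.proj ∈ coordSet E F V x₀) :
    Function.Injective (coordDeriv E x₀ z) := by
  have h := isInvertible_mfderiv_extChartAt (I := 𝓘(ℝ, E).prod 𝓘(ℝ, F))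
    (x := TotalSpace.mk' F x₀ (0 : V x₀)) (y := z) (mem_extChartAt_zero_source.2 hz)
  rw [← (extChartAt_zero_eventuallyEq hz).mfderiv_eq] at h
  exact h.injective

theorem coordDeriv_mfderiv {EM : Type*} [NormedAddCommGroup EM] [NormedSpace ℝ EM] {HM : Type*}
    [TopologicalSpace HM] {IM : ModelWithCorners ℝ EM HM} {M : Type*} [TopologicalSpace M]
    [ChartedSpace HM M] {x₀ : Q} {f : M → TotalSpace F V} {m : M}
    (hf : MDifferentiableAt IM (𝓘(ℝ, E).prod 𝓘(ℝ, F)) f m) (hm : (f m).proj ∈ coordSet E F V x₀)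
    (v : TangentSpace IM m) :
    coordDeriv E x₀ (f m) (mfderiv IM (𝓘(ℝ, E).prod 𝓘(ℝ, F)) f m v) =
      mvfderiv IM (fun y ↦ bundleCoord E x₀ (f y)) m v :=
  (mvfderiv_comp_eq (mdifferentiableAt_bundleCoord hm) hf v).symm

/-- In coordinates, the velocity of a curve is the derivative of its coordinate expression. -/
theorem hasDerivAt_bundleCoord {x₀ : Q} {c : ℝ → TotalSpace F V} {t : ℝ}
    (hc : MDifferentiableAt 𝓘(ℝ, ℝ) (𝓘(ℝ, E).prod 𝓘(ℝ, F)) c t)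
    (ht : (c t).proj ∈ coordSet E F V x₀) :
    HasDerivAt (fun s ↦ bundleCoord E x₀ (c s))
      (coordDeriv E x₀ (c t) (mfderiv 𝓘(ℝ, ℝ) (𝓘(ℝ, E).prod 𝓘(ℝ, F)) c t (1 : ℝ))) t := by
  have h := hasDerivAt_of_mdifferentiableAt ((mdifferentiableAt_bundleCoord ht).comp t hc)
  exact h.congr_deriv (coordDeriv_mfderiv hc ht (1 : ℝ)).symm

theorem fibCoord_add {x₀ x : Q} (hx : x ∈ coordSet E F V x₀) (u w : V x) :
    fibCoord F x₀ (u + w) = fibCoord F x₀ u + fibCoord F x₀ w :=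
  ((trivializationAt F V x₀).linear ℝ hx.2).1 u w

theorem fibCoord_smul {x₀ x : Q} (hx : x ∈ coordSet E F V x₀) (c : ℝ) (u : V x) :
    fibCoord F x₀ (c • u) = c • fibCoord F x₀ u :=
  ((trivializationAt F V x₀).linear ℝ hx.2).2 c u

theorem fibCoord_injective {x₀ x : Q} (hx : x ∈ coordSet E F V x₀) {u w : V x}
    (h : fibCoord F x₀ u = fibCoord F x₀ w) : u = w := by
  rw [← (trivializationAt F V x₀).symm_apply_apply_mk hx.2 u,
    ← (trivializationAt F V x₀).symm_apply_apply_mk hx.2 w]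
  exact congrArg _ h

theorem fibCoord_zero {x₀ x : Q} (hx : x ∈ coordSet E F V x₀) : fibCoord F x₀ (0 : V x) = 0 := by
  have := fibCoord_smul hx 0 (0 : V x)
  simpa using this

theorem contMDiffAt_fibCoord {k : WithTop ℕ∞} [ContMDiffVectorBundle k F V 𝓘(ℝ, E)] {x₀ x : Q}
    (hx : x ∈ coordSet E F V x₀) {σ : ∀ x, V x}
    (hσ : ContMDiffAt 𝓘(ℝ, E) (𝓘(ℝ, E).prod 𝓘(ℝ, F)) k (fun y ↦ TotalSpace.mk' F y (σ y)) x) :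
    ContMDiffAt 𝓘(ℝ, E) 𝓘(ℝ, F) k (fun y ↦ fibCoord F x₀ (σ y)) x :=
  ((trivializationAt F V x₀).contMDiffAt_section_iff hx.2).1 hσ

theorem mdifferentiableAt_fibCoord {x₀ x : Q} (hx : x ∈ coordSet E F V x₀) {σ : ∀ x, V x}
    (hσ : MDifferentiableAt 𝓘(ℝ, E) (𝓘(ℝ, E).prod 𝓘(ℝ, F)) (fun y ↦ TotalSpace.mk' F y (σ y)) x) :
    MDifferentiableAt 𝓘(ℝ, E) 𝓘(ℝ, F) (fun y ↦ fibCoord F x₀ (σ y)) x :=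
  ((trivializationAt F V x₀).mdifferentiableAt_section_iff 𝓘(ℝ, E) σ hx.2).1 hσ

theorem mdifferentiableAt_chart {x₀ x : Q} (hx : x ∈ (chartAt E x₀).source) :
    MDifferentiableAt 𝓘(ℝ, E) 𝓘(ℝ, E) (extChartAt 𝓘(ℝ, E) x₀) x :=
  mdifferentiableAt_extChartAt hx

theorem chartDeriv_injective {x₀ x : Q} (hx : x ∈ (chartAt E x₀).source) :
    Function.Injective (chartDeriv (E := E) x₀ x) :=
  (isInvertible_mfderiv_extChartAt (I := 𝓘(ℝ, E)) (x := x₀) (y := x)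
    (by rwa [extChartAt_source])).injective

theorem coordDeriv_section {x₀ x : Q} (hx : x ∈ coordSet E F V x₀) {σ : ∀ x, V x}
    (hσ : MDifferentiableAt 𝓘(ℝ, E) (𝓘(ℝ, E).prod 𝓘(ℝ, F)) (fun y ↦ TotalSpace.mk' F y (σ y)) x)
    (v : TangentSpace 𝓘(ℝ, E) x) :
    coordDeriv E x₀ (TotalSpace.mk' F x (σ x)) (mfderiv 𝓘(ℝ, E) (𝓘(ℝ, E).prod 𝓘(ℝ, F))
      (fun y ↦ TotalSpace.mk' F y (σ y)) x v) =
      (chartDeriv x₀ x v, mvfderiv 𝓘(ℝ, E) (fun y ↦ fibCoord F x₀ (σ y)) x v) := by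
  rw [coordDeriv_mfderiv (f := fun y ↦ TotalSpace.mk' F y (σ y)) hσ hx]
  exact mvfderiv_prodMk (mdifferentiableAt_chart hx.1) (mdifferentiableAt_fibCoord hx hσ) v

theorem mdifferentiableAt_vert [∀ x, IsTopologicalAddGroup (V x)] [∀ x, ContinuousSMul ℝ (V x)]
    {x : Q} (e u : V x) (t : ℝ) :
    MDifferentiableAt 𝓘(ℝ, ℝ) (𝓘(ℝ, E).prod 𝓘(ℝ, F))
      (fun ε : ℝ ↦ TotalSpace.mk' F x (e + ε • u)) t := by
  have hx := mem_coordSet_self (E := E) (F := F) (V := V) x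
  rw [(trivializationAt F V x).mdifferentiableAt_totalSpace_iff 𝓘(ℝ, E)]
  · refine ⟨mdifferentiableAt_const, ?_⟩
    have : (fun ε : ℝ ↦ (trivializationAt F V x (TotalSpace.mk' F x (e + ε • u))).2) =
        fun ε ↦ fibCoord F x e + ε • fibCoord F x u := by
      ext ε
      change fibCoord F x (e + ε • u) = _
      rw [fibCoord_add hx, fibCoord_smul hx]
    rw [this, mdifferentiableAt_iff_differentiableAt]
    fun_prop
  · exact (trivializationAt F V x).mem_source.2 hx.2

theorem coordDeriv_vertLift [∀ x, IsTopologicalAddGroup (V x)] [∀ x, ContinuousSMul ℝ (V x)]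
    {x₀ x : Q} (hx : x ∈ coordSet E F V x₀) (e u : V x) :
    coordDeriv E x₀ (TotalSpace.mk' F x e) (vertLift E F e u) = (0, fibCoord F x₀ u) := by
  have h1 := hasDerivAt_bundleCoord (x₀ := x₀)
    (c := fun ε : ℝ ↦ TotalSpace.mk' F x (e + ε • u)) (mdifferentiableAt_vert e u 0) hx
  have h2 : HasDerivAt (fun ε : ℝ ↦ bundleCoord E x₀ (TotalSpace.mk' F x (e + ε • u)))
      (0, fibCoord F x₀ u) 0 := by
    have : (fun ε : ℝ ↦ bundleCoord E x₀ (TotalSpace.mk' F x (e + ε • u))) =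
        fun ε ↦ (extChartAt 𝓘(ℝ, E) x₀ x, fibCoord F x₀ e + ε • fibCoord F x₀ u) := by
      ext1 ε
      change (_, fibCoord F x₀ (e + ε • u)) = _
      rw [fibCoord_add hx, fibCoord_smul hx]
    rw [this]
    have h3 := ((hasDerivAt_id (0 : ℝ)).smul_const (fibCoord F x₀ u)).const_add (fibCoord F x₀ e)
    rw [one_smul] at h3
    exact (hasDerivAt_const _ _).prodMk h3
  have h3 := h1.unique h2
  have h4 : e + (0 : ℝ) • u = e := by rw [zero_smul, add_zero]
  unfold vertLift
  -- The derivative of the curve lives in the tangent space at e + 0 • u, which equals e only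
  -- propositionally; the base point is generalized so that it can be substituted.
  generalize mfderiv 𝓘(ℝ, ℝ) (𝓘(ℝ, E).prod 𝓘(ℝ, F))
    (fun ε : ℝ ↦ TotalSpace.mk' F x (e + ε • u)) 0 = T at h3 ⊢
  revert h3
  generalize e + (0 : ℝ) • u = e' at h4 T
  subst h4
  exact id

end Derivatives

/-! ### Horizontal lifts in coordinates -/

section HorizontalLift

variable [∀ x, IsTopologicalAddGroup (V x)] [∀ x, ContinuousSMul ℝ (V x)] [VectorBundle ℝ F V]
  [FiniteDimensional ℝ F] [IsManifold 𝓘(ℝ, E) ∞ Q] [ContMDiffVectorBundle ∞ F V 𝓘(ℝ, E)]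

/-- The Leibniz terms of the coordinate derivative and of ∇ cancel. Hence the fibre coordinate of
the horizontal lift depends only on the value of the section at x, and any section through the given
vector may be used to compute it. -/
theorem tensorialAt_cov_sub (cov : CovariantDerivative 𝓘(ℝ, E) F V) {x₀ x : Q}
    (hx : x ∈ coordSet E F V x₀) (v : TangentSpace 𝓘(ℝ, E) x) :
    TensorialAt 𝓘(ℝ, E) F (fun σ ↦ mvfderiv 𝓘(ℝ, E) (fun y ↦ fibCoord F x₀ (σ y)) x v -
      fibCoord F x₀ (cov σ x v)) x where
  smul {f σ} hf hσ := by
    have h1 := cov.isCovariantDerivativeOnUniv.leibniz hσ hf (mem_univ x)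
    have h2 : (fun y ↦ fibCoord F x₀ ((f • σ) y)) =ᶠ[𝓝 x] f • fun y ↦ fibCoord F x₀ (σ y) := by
      filter_upwards [(isOpen_coordSet x₀).mem_nhds hx] with y hy
      exact fibCoord_smul hy (f y) (σ y)
    rw [mvfderiv_congr_of_eventuallyEq h2, mvfderiv_smul hf (mdifferentiableAt_fibCoord hx hσ), h1]
    simp only [add_apply, smul_apply, ContinuousLinearMap.smulRight_apply, fibCoord_add hx,
      fibCoord_smul hx, smul_sub]
    abel
  add {σ σ'} hσ hσ' := by
    have h1 := cov.isCovariantDerivativeOnUniv.add hσ hσ' (mem_univ x)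
    have h2 : (fun y ↦ fibCoord F x₀ ((σ + σ') y)) =ᶠ[𝓝 x]
        (fun y ↦ fibCoord F x₀ (σ y)) + fun y ↦ fibCoord F x₀ (σ' y) := by
      filter_upwards [(isOpen_coordSet x₀).mem_nhds hx] with y hy
      exact fibCoord_add hy (σ y) (σ' y)
    rw [mvfderiv_congr_of_eventuallyEq h2, mvfderiv_add (mdifferentiableAt_fibCoord hx hσ)
      (mdifferentiableAt_fibCoord hx hσ'), h1]
    simp only [add_apply, fibCoord_add hx]
    abel

/-- The horizontal lift in coordinates, in terms of any section through the given point. -/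
theorem coordDeriv_horLift (cov : CovariantDerivative 𝓘(ℝ, E) F V) {x₀ x : Q}
    (hx : x ∈ coordSet E F V x₀) {σ : ∀ x, V x}
    (hσ : MDifferentiableAt 𝓘(ℝ, E) (𝓘(ℝ, E).prod 𝓘(ℝ, F)) (fun y ↦ TotalSpace.mk' F y (σ y)) x)
    (v : TangentSpace 𝓘(ℝ, E) x) :
    coordDeriv E x₀ (TotalSpace.mk' F x (σ x)) (horLift cov (σ x) v) =
      (chartDeriv x₀ x v, mvfderiv 𝓘(ℝ, E) (fun y ↦ fibCoord F x₀ (σ y)) x v -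
        fibCoord F x₀ (cov σ x v)) := by
  have hs := FiberBundle.mdifferentiableAt_extend 𝓘(ℝ, E) F (σ x)
  have h1 := coordDeriv_section hx hs v
  rw [FiberBundle.extend_apply_self] at h1
  have h2 := (tensorialAt_cov_sub cov hx v).pointwise hσ hs
    (FiberBundle.extend_apply_self F (σ x)).symm
  refine ((coordDeriv E x₀ (TotalSpace.mk' F x (σ x))).map_sub _ _).trans ?_
  rw [coordDeriv_vertLift hx]
  refine (congrArg (fun z ↦ z - _) h1).trans ?_
  rw [Prod.mk_sub_mk, sub_zero, h2]

end HorizontalLift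

end Coordinates

/-! ### Global sections with prescribed local coordinates; tensoriality -/

section Frames

variable {E : Type*} [NormedAddCommGroup E] [NormedSpace ℝ E] [FiniteDimensional ℝ E]
  {Q : Type*} [TopologicalSpace Q] [T2Space Q] [ChartedSpace E Q] [IsManifold 𝓘(ℝ, E) ∞ Q]
  {F : Type*} [NormedAddCommGroup F] [NormedSpace ℝ F] [FiniteDimensional ℝ F]
  {V : Q → Type*} [TopologicalSpace (TotalSpace F V)]
  [∀ x, AddCommGroup (V x)] [∀ x, Module ℝ (V x)] [∀ x, TopologicalSpace (V x)]
  [∀ x, IsTopologicalAddGroup (V x)] [∀ x, ContinuousSMul ℝ (V x)]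
  [FiberBundle F V] [VectorBundle ℝ F V] [ContMDiffVectorBundle ∞ F V 𝓘(ℝ, E)]

/-- The element of the fibre over `x` with given fibre coordinate. -/
def fibSymm (F : Type*) [NormedAddCommGroup F] [NormedSpace ℝ F] {V : Q → Type*}
    [TopologicalSpace (TotalSpace F V)] [∀ x, AddCommGroup (V x)] [∀ x, Module ℝ (V x)]
    [∀ x, TopologicalSpace (V x)] [FiberBundle F V] [VectorBundle ℝ F V] (x₀ x : Q) : F →ₗ[ℝ] V x :=
  (trivializationAt F V x₀).symmₗ ℝ x

theorem fibCoord_fibSymm {x₀ x : Q} (hx : x ∈ coordSet E F V x₀) (w : F) :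
    fibCoord F x₀ (fibSymm F x₀ x w : V x) = w := by
  unfold fibCoord fibSymm
  rw [Trivialization.symmₗ_apply _ hx.2, Trivialization.apply_mk_symm _ hx.2]

theorem fibSymm_fibCoord {x₀ x : Q} (hx : x ∈ coordSet E F V x₀) (u : V x) :
    fibSymm F x₀ x (fibCoord F x₀ u) = u :=
  fibCoord_injective hx (fibCoord_fibSymm hx _)

variable (E) in
theorem exists_bump {x : Q} {U : Set Q} (hU : U ∈ 𝓝 x) :
    ∃ χ : ContMDiffMap 𝓘(ℝ, E) 𝓘(ℝ, ℝ) Q ℝ ∞, (∀ᶠ y in 𝓝 x, χ y = 1) ∧ tsupport χ ⊆ U := by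
  obtain ⟨ψ, -, hψ⟩ := (SmoothBumpFunction.nhds_basis_tsupport (I := 𝓘(ℝ, E)) x).mem_iff.1 hU
  exact ⟨⟨ψ, ψ.contMDiff⟩, ψ.eventuallyEq_one, hψ⟩

/-- The global section equal to `χ` times the section with constant coordinate `w`. -/
def cutoffSec (x₀ : Q) (χ : ContMDiffMap 𝓘(ℝ, E) 𝓘(ℝ, ℝ) Q ℝ ∞)
    (hχ : tsupport χ ⊆ coordSet E F V x₀) : F →ₗ[ℝ] Sec E F V where
  toFun w := ⟨(χ : Q → ℝ) • fun y ↦ (fibSymm F x₀ y w : V y), by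
    refine ContMDiffOn.smul_section_of_tsupport χ.contMDiff.contMDiffOn (isOpen_coordSet x₀) hχ ?_
    intro y hy
    refine ContMDiffAt.contMDiffWithinAt ?_
    rw [(trivializationAt F V x₀).contMDiffAt_section_iff hy.2]
    refine (contMDiffAt_const (c := w)).congr_of_eventuallyEq ?_
    filter_upwards [(isOpen_coordSet x₀).mem_nhds hy] with z hz
    exact fibCoord_fibSymm hz w⟩
  map_add' w w' := by
    ext y
    change χ y • (fibSymm F x₀ y (w + w') : V y) = χ y • fibSymm F x₀ y w + χ y • fibSymm F x₀ y w'
    rw [map_add, smul_add]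
  map_smul' c w := by
    ext y
    change χ y • (fibSymm F x₀ y (c • w) : V y) = c • χ y • fibSymm F x₀ y w
    rw [map_smul, smul_comm]

theorem cutoffSec_apply (x₀ : Q) (χ : ContMDiffMap 𝓘(ℝ, E) 𝓘(ℝ, ℝ) Q ℝ ∞)
    (hχ : tsupport χ ⊆ coordSet E F V x₀) (w : F) (y : Q) :
    cutoffSec x₀ χ hχ w y = χ y • fibSymm F x₀ y w := rfl

variable (E F V) in
/-- Near each point there is a linear space of smooth global sections with constant coordinates. -/
theorem exists_constSec (x₀ : Q) : ∃ (N : Set Q) (K : F →ₗ[ℝ] Sec E F V), IsOpen N ∧ x₀ ∈ N ∧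
    N ⊆ coordSet E F V x₀ ∧ ∀ w, ∀ y ∈ N, fibCoord F x₀ (K w y) = w := by
  obtain ⟨χ, h1, h2⟩ := exists_bump E ((isOpen_coordSet x₀).mem_nhds
    (mem_coordSet_self (E := E) (F := F) (V := V) x₀))
  obtain ⟨N, hN, hNo, hxN⟩ := eventually_nhds_iff.1
    (h1.and ((isOpen_coordSet x₀).mem_nhds (mem_coordSet_self (E := E) (F := F) (V := V) x₀)))
  refine ⟨N, cutoffSec x₀ χ h2, hNo, hxN, fun y hy ↦ (hN y hy).2, fun w y hy ↦ ?_⟩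
  rw [cutoffSec_apply, (hN y hy).1, one_smul, fibCoord_fibSymm (hN y hy).2]

/-- A section is, after multiplication by a bump function, a combination of constant sections whose
coefficients at the centre are the coordinates of its value there. -/
theorem exists_decomposition (x₀ : Q) :
    ∃ (χ : ContMDiffMap 𝓘(ℝ, E) 𝓘(ℝ, ℝ) Q ℝ ∞) (K : F →ₗ[ℝ] Sec E F V), χ x₀ = 1 ∧
      ∀ s : Sec E F V, ∃ f : Fin (Module.finrank ℝ F) → ContMDiffMap 𝓘(ℝ, E) 𝓘(ℝ, ℝ) Q ℝ ∞,
        (∀ i, f i x₀ = (Module.finBasis ℝ F).repr (fibCoord F x₀ (s x₀)) i) ∧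
        smulSec χ (smulSec χ s) = ∑ i, smulSec (f i) (K (Module.finBasis ℝ F i)) := by
  obtain ⟨χ, h1, h2⟩ := exists_bump E ((isOpen_coordSet x₀).mem_nhds
    (mem_coordSet_self (E := E) (F := F) (V := V) x₀))
  refine ⟨χ, cutoffSec x₀ χ h2, h1.self_of_nhds, fun s ↦ ?_⟩
  set B := Module.finBasis ℝ F
  -- Of the two factors χ, one makes the local coefficients global smooth functions and the other
  -- makes the local frame global.
  have hsm : ∀ i, ContMDiff 𝓘(ℝ, E) 𝓘(ℝ, ℝ) ∞
      (fun y ↦ χ y • B.repr (fibCoord F x₀ (s y)) i) := by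
    intro i
    refine contMDiff_of_tsupport fun x hx ↦ ?_
    have hx : x ∈ coordSet E F V x₀ := h2 (tsupport_smul_subset_left _ _ hx)
    refine χ.contMDiff.contMDiffAt.smul ?_
    exact (((LinearMap.toContinuousLinearMap (B.coord i)).contDiff.contMDiff).contMDiffAt.comp x
      (contMDiffAt_fibCoord hx s.contMDiff.contMDiffAt))
  refine ⟨fun i ↦ ⟨_, hsm i⟩, fun i ↦ ?_, ?_⟩
  · change χ x₀ • B.repr (fibCoord F x₀ (s x₀)) i = _
    rw [h1.self_of_nhds, one_smul]
  · ext y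
    change χ y • χ y • s y = ContMDiffSection.coeAddHom 𝓘(ℝ, E) F ∞ V (∑ i, _) y
    rw [map_sum, Finset.sum_apply]
    change χ y • χ y • s y =
      ∑ i, (χ y • B.repr (fibCoord F x₀ (s y)) i) • χ y • (fibSymm F x₀ y (B i) : V y)
    by_cases hy : y ∈ coordSet E F V x₀
    · have : s y = ∑ i, B.repr (fibCoord F x₀ (s y)) i • fibSymm F x₀ y (B i) := by
        conv_lhs => rw [← fibSymm_fibCoord hy (s y), ← B.sum_repr (fibCoord F x₀ (s y)), map_sum]
        simp_rw [map_smul]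
      conv_lhs => rw [this, Finset.smul_sum, Finset.smul_sum]
      refine Finset.sum_congr rfl fun i _ ↦ ?_
      rw [smul_smul, smul_smul, smul_smul, smul_eq_mul]
      congr 1; ring
    · have : χ y = 0 := image_eq_zero_of_notMem_tsupport fun h ↦ hy (h2 h)
      simp [this]

/-- A `C^∞`-linear map on sections depends only on the value of the section. -/
theorem eq_of_linear_over_functions {G : Type*} [AddCommGroup G] [Module ℝ G] (T : Sec E F V → G)
    {x : Q} (hadd : ∀ s s', T (s + s') = T s + T s')
    (hsmul : ∀ (f : ContMDiffMap 𝓘(ℝ, E) 𝓘(ℝ, ℝ) Q ℝ ∞) s, T (smulSec f s) = f x • T s)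
    {s s' : Sec E F V} (h : s x = s' x) : T s = T s' := by
  obtain ⟨χ, K, hχ, hK⟩ := exists_decomposition (E := E) (F := F) (V := V) x
  let T' : Sec E F V →+ G := AddMonoidHom.mk' T hadd
  have key : ∀ s : Sec E F V, T s = ∑ i, (Module.finBasis ℝ F).repr (fibCoord F x (s x)) i •
      T (K (Module.finBasis ℝ F i)) := by
    intro s
    obtain ⟨f, hf, hs⟩ := hK s
    have h1 : T (smulSec χ (smulSec χ s)) = T s := by rw [hsmul, hsmul, hχ, one_smul, one_smul]
    rw [← h1, hs]
    change T' _ = _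
    rw [map_sum]
    refine Finset.sum_congr rfl fun i _ ↦ ?_
    change T _ = _
    rw [hsmul, hf]
  rw [key s, key s', h]

theorem exists_sec {x : Q} (u : V x) : ∃ s : Sec E F V, s x = u := by
  obtain ⟨N, K, -, hx, hN, hK⟩ := exists_constSec E F V x
  exact ⟨K (fibCoord F x u), fibCoord_injective (hN hx) (hK _ x hx)⟩

end Frames

/-! ### Coordinates on the dual bundle -/

section DualCoordinates

variable {E : Type*} [NormedAddCommGroup E] [NormedSpace ℝ E]
  {Q : Type*} [TopologicalSpace Q] [ChartedSpace E Q]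
  {F : Type*} [NormedAddCommGroup F] [NormedSpace ℝ F]
  {A : Q → Type*} [TopologicalSpace (TotalSpace F A)]
  [∀ x, AddCommGroup (A x)] [∀ x, Module ℝ (A x)] [∀ x, TopologicalSpace (A x)]
  [FiberBundle F A] [VectorBundle ℝ F A]
  [∀ x, IsTopologicalAddGroup (A x)] [∀ x, ContinuousSMul ℝ (A x)]

theorem coordSet_dual (x₀ : Q) :
    coordSet E (F →L[ℝ] ℝ) (Dual A) x₀ = coordSet E F A x₀ := by
  unfold coordSet
  rw [hom_trivializationAt_baseSet]
  simp

/-- The dual trivialization precomposes with the inverse of the trivialization of A, so the pairing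
of coordinates is the pairing itself. -/
theorem fibCoord_dual_apply {x₀ x : Q} (hx : x ∈ coordSet E F A x₀) (p : Dual A x) (a : A x) :
    fibCoord (F →L[ℝ] ℝ) x₀ p (fibCoord F x₀ a) = p a := by
  unfold fibCoord
  rw [hom_trivializationAt_apply]
  change ContinuousLinearMap.inCoordinates F A ℝ (Bundle.Trivial Q ℝ) x₀ x x₀ x p _ = _
  rw [ContinuousLinearMap.inCoordinates_eq hx.2 (by simp)]
  change p (((trivializationAt F A x₀).continuousLinearEquivAt ℝ x hx.2).symm
    ((trivializationAt F A x₀).continuousLinearEquivAt ℝ x hx.2 a)) = _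
  rw [ContinuousLinearEquiv.symm_apply_apply]

end DualCoordinates

/-! ### The anchor as a morphism of brackets -/

section Algebroid

variable {E : Type*} [NormedAddCommGroup E] [NormedSpace ℝ E] [FiniteDimensional ℝ E]
  {Q : Type*} [TopologicalSpace Q] [T2Space Q] [ChartedSpace E Q] [IsManifold 𝓘(ℝ, E) ∞ Q]
  {F : Type*} [NormedAddCommGroup F] [NormedSpace ℝ F] [FiniteDimensional ℝ F]
  {A : Q → Type*} [TopologicalSpace (TotalSpace F A)]
  [∀ x, AddCommGroup (A x)] [∀ x, Module ℝ (A x)] [∀ x, TopologicalSpace (A x)]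
  [∀ x, IsTopologicalAddGroup (A x)] [∀ x, ContinuousSMul ℝ (A x)]
  [FiberBundle F A] [VectorBundle ℝ F A] [ContMDiffVectorBundle ∞ F A 𝓘(ℝ, E)]
  {G : Type*} [NormedAddCommGroup G] [NormedSpace ℝ G]

theorem sec_mdifferentiableAt {V : Q → Type*} [TopologicalSpace (TotalSpace F V)]
    [∀ x, TopologicalSpace (V x)] [FiberBundle F V] (X : Sec E F V) (x : Q) :
    MDifferentiableAt 𝓘(ℝ, E) (𝓘(ℝ, E).prod 𝓘(ℝ, F)) (fun y ↦ TotalSpace.mk' F y (X y)) x :=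
  X.contMDiff.mdifferentiableAt (by simp)

theorem map_mdifferentiableAt (f : ContMDiffMap 𝓘(ℝ, E) 𝓘(ℝ, G) Q G ∞) (x : Q) :
    MDifferentiableAt 𝓘(ℝ, E) 𝓘(ℝ, G) f x :=
  f.contMDiff.mdifferentiableAt (by simp)

/-- The derivative `ρ(X)[f]` of a smooth function along the anchor of a section. -/
def LieAlgebroid.act (L : LieAlgebroid E F A) (X : Sec E F A)
    (f : ContMDiffMap 𝓘(ℝ, E) 𝓘(ℝ, G) Q G ∞) : ContMDiffMap 𝓘(ℝ, E) 𝓘(ℝ, G) Q G ∞ :=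
  ⟨fun x ↦ mvfderiv 𝓘(ℝ, E) f x (L.anchor x (X x)), by
    have h1 : ContMDiff 𝓘(ℝ, E) 𝓘(ℝ, E).tangent ∞
        (fun x ↦ TotalSpace.mk' E (E := fun x : Q ↦ TangentSpace 𝓘(ℝ, E) x) x
          (L.anchor x (X x))) :=
      ContMDiff.clm_bundle_apply (F₁ := F) (F₂ := E) (b := fun y : Q ↦ y) L.contMDiff_anchor
        X.contMDiff
    have h2 := (f.contMDiff.contMDiff_tangentMap (m := ∞) (by exact le_rfl)).comp h1
    exact (contMDiff_snd_tangentBundle_modelSpace G 𝓘(ℝ, G)).comp h2⟩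

theorem LieAlgebroid.act_apply (L : LieAlgebroid E F A) (X : Sec E F A)
    (f : ContMDiffMap 𝓘(ℝ, E) 𝓘(ℝ, G) Q G ∞) (x : Q) :
    L.act X f x = mvfderiv 𝓘(ℝ, E) f x (L.anchor x (X x)) := rfl

theorem LieAlgebroid.bracket_antisymm (L : LieAlgebroid E F A) (X Y : Sec E F A) :
    L.bracket X Y = -L.bracket Y X := by
  have h := L.bracket_self (X + Y)
  rw [L.bracket_add_left, L.bracket_add_right, L.bracket_add_right, L.bracket_self,
    L.bracket_self, zero_add, add_zero] at h
  exact eq_neg_of_add_eq_zero_left h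

theorem LieAlgebroid.leibniz_left (L : LieAlgebroid E F A) (X Y : Sec E F A)
    (f : ContMDiffMap 𝓘(ℝ, E) 𝓘(ℝ, ℝ) Q ℝ ∞) (x : Q) :
    L.bracket (smulSec f X) Y x = f x • L.bracket X Y x -
      mvfderiv 𝓘(ℝ, E) f x (L.anchor x (Y x)) • X x := by
  rw [L.bracket_antisymm, L.bracket_antisymm X Y]
  change -(L.bracket Y (smulSec f X) x) = f x • -(L.bracket Y X x) - _
  rw [L.leibniz, smul_neg]
  abel

theorem LieAlgebroid.bracket_smulSec (L : LieAlgebroid E F A) (X Y : Sec E F A)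
    (f : ContMDiffMap 𝓘(ℝ, E) 𝓘(ℝ, ℝ) Q ℝ ∞) :
    L.bracket X (smulSec f Y) = smulSec (L.act X f) Y + smulSec f (L.bracket X Y) := by
  ext x
  exact L.leibniz X Y f x

/-- Jacobi's identity in derivation form. -/
theorem LieAlgebroid.jacobi' (L : LieAlgebroid E F A) (X Y Z : Sec E F A) :
    L.bracket X (L.bracket Y Z) = L.bracket (L.bracket X Y) Z + L.bracket Y (L.bracket X Z) := by
  have h := L.jacobi X Y Z
  have h1 : L.bracket Y (L.bracket Z X) = -L.bracket Y (L.bracket X Z) := by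
    rw [L.bracket_antisymm Z X, ← neg_one_smul ℝ (L.bracket X Z), L.bracket_smul_right,
      neg_one_smul]
  rw [h1, L.bracket_antisymm Z] at h
  rw [← sub_eq_zero, ← h]
  abel

/-- The anchor is compatible with brackets. -/
theorem LieAlgebroid.act_bracket_real (L : LieAlgebroid E F A) (X Y : Sec E F A)
    (f : ContMDiffMap 𝓘(ℝ, E) 𝓘(ℝ, ℝ) Q ℝ ∞) (x : Q) :
    L.act X (L.act Y f) x = L.act (L.bracket X Y) f x + L.act Y (L.act X f) x := by
  -- Expanding Jacobi's identity for X, Y, fZ by the Leibniz rule leaves the defect of the claim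
  -- multiplied by Z x, so some Z must be nonzero at x. If the fibre at x is zero, then so is the
  -- typical fibre; all sections vanish and both sides are 0.
  by_cases hu : ∃ u : A x, u ≠ 0
  · obtain ⟨u, hu⟩ := hu
    obtain ⟨Z, rfl⟩ := exists_sec (E := E) (F := F) u
    have h := L.jacobi' X Y (smulSec f Z)
    rw [L.bracket_smulSec, L.bracket_smulSec, L.bracket_smulSec, L.bracket_add_right,
      L.bracket_add_right, L.bracket_smulSec, L.bracket_smulSec, L.bracket_smulSec,
      L.bracket_smulSec, L.jacobi' X Y Z] at h
    have h1 := congrArg (fun s : Sec E F A ↦ s x) h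
    change (L.act X (L.act Y f) x • Z x + L.act Y f x • L.bracket X Z x) +
        (L.act X f x • L.bracket Y Z x +
          f x • (L.bracket (L.bracket X Y) Z x + L.bracket Y (L.bracket X Z) x)) =
      (L.act (L.bracket X Y) f x • Z x + f x • L.bracket (L.bracket X Y) Z x) +
        ((L.act Y (L.act X f) x • Z x + L.act X f x • L.bracket Y Z x) +
          (L.act Y f x • L.bracket X Z x + f x • L.bracket Y (L.bracket X Z) x)) at h1
    have h2 : (L.act X (L.act Y f) x - (L.act (L.bracket X Y) f x + L.act Y (L.act X f) x)) •
        Z x = 0 := by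
      rw [sub_smul, add_smul, sub_eq_zero]
      rw [smul_add] at h1
      have h3 := sub_eq_zero.2 h1
      rw [← sub_eq_zero, ← h3]
      abel
    exact sub_eq_zero.1 ((smul_eq_zero.1 h2).resolve_right hu)
  · push Not at hu
    have hF : ∀ w : F, w = 0 := fun w ↦ by
      have hx := mem_coordSet_self (E := E) (F := F) (V := A) x
      rw [← fibCoord_fibSymm (V := A) hx w, hu (fibSymm F x x w), fibCoord_zero hx]
    have hA : ∀ (s : Sec E F A) y, s y = 0 := fun s y ↦ by
      have hy := mem_coordSet_self (E := E) (F := F) (V := A) y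
      exact fibCoord_injective hy ((hF _).trans (hF _).symm)
    simp only [LieAlgebroid.act_apply, hA, map_zero, add_zero]

theorem LieAlgebroid.act_clm (L : LieAlgebroid E F A) (X : Sec E F A)
    (f : ContMDiffMap 𝓘(ℝ, E) 𝓘(ℝ, G) Q G ∞) (T : G →L[ℝ] ℝ) (x : Q) :
    L.act X ⟨fun y ↦ T (f y), T.contDiff.contMDiff.comp f.contMDiff⟩ x = T (L.act X f x) :=
  mvfderiv_clm_comp T (map_mdifferentiableAt f x) _

/-- The vector-valued case follows by testing against continuous functionals. It is applied with f
the globalized chart, where it expresses ρ([X, Y]) = [ρ(X), ρ(Y)] in coordinates. -/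
theorem LieAlgebroid.act_bracket (L : LieAlgebroid E F A) (X Y : Sec E F A)
    (f : ContMDiffMap 𝓘(ℝ, E) 𝓘(ℝ, G) Q G ∞) (x : Q) :
    L.act X (L.act Y f) x = L.act (L.bracket X Y) f x + L.act Y (L.act X f) x := by
  refine (SeparatingDual.eq_iff_forall_dual_eq (R := ℝ)).2 fun T ↦ ?_
  have h := L.act_bracket_real X Y ⟨fun y ↦ T (f y), T.contDiff.contMDiff.comp f.contMDiff⟩ x
  have h1 : ∀ Z : Sec E F A, L.act Z ⟨fun y ↦ T (f y), T.contDiff.contMDiff.comp f.contMDiff⟩ =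
      ⟨fun y ↦ T (L.act Z f y), T.contDiff.contMDiff.comp (L.act Z f).contMDiff⟩ := fun Z ↦ by
    ext y; exact L.act_clm Z f T y
  rw [h1, h1, h1, L.act_clm, L.act_clm] at h
  rw [map_add]
  exact h

/-! ### The induced `A`-connection -/

variable (L : LieAlgebroid E F A) (cov : CovariantDerivative 𝓘(ℝ, E) F A)

theorem cov_add (X X' : Sec E F A) (x : Q) : cov (fun y ↦ (X + X') y) x =
    cov (fun y ↦ X y) x + cov (fun y ↦ X' y) x :=
  cov.isCovariantDerivativeOnUniv.add (sec_mdifferentiableAt X x) (sec_mdifferentiableAt X' x)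
    (mem_univ x)

theorem cov_smulSec (f : ContMDiffMap 𝓘(ℝ, E) 𝓘(ℝ, ℝ) Q ℝ ∞) (X : Sec E F A) (x : Q)
    (v : TangentSpace 𝓘(ℝ, E) x) : cov (fun y ↦ (smulSec f X) y) x v =
    f x • cov (fun y ↦ X y) x v + mvfderiv 𝓘(ℝ, E) f x v • X x := by
  have h := cov.isCovariantDerivativeOnUniv.leibniz (sec_mdifferentiableAt X x)
    (map_mdifferentiableAt f x) (mem_univ x)
  exact congrArg (fun T ↦ T v) h

theorem barNabla_add_left (X X' Y : Sec E F A) (x : Q) :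
    barNabla L cov (X + X') Y x = barNabla L cov X Y x + barNabla L cov X' Y x := by
  unfold barNabla
  rw [cov_add, L.bracket_add_left]
  change _ + (L.bracket X Y x + L.bracket X' Y x) = _
  rw [add_apply]
  abel

/-- The derivative of f along ρ(Y) appears once from ∇ and once, with the opposite sign, from the
bracket. This cancellation is the reason for the form of ∇̄. -/
theorem barNabla_smulSec_left (f : ContMDiffMap 𝓘(ℝ, E) 𝓘(ℝ, ℝ) Q ℝ ∞) (X Y : Sec E F A)
    (x : Q) : barNabla L cov (smulSec f X) Y x = f x • barNabla L cov X Y x := by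
  unfold barNabla
  rw [cov_smulSec, L.leibniz_left, smul_add]
  abel

/-- Linearity over functions in X makes ∇̄_X Y at x depend only on X x. Extensions of a(t) may
therefore be chosen independently at each time, with no regularity in t. -/
theorem barNabla_congr_left {X X' : Sec E F A} (Y : Sec E F A) {x : Q} (h : X x = X' x) :
    barNabla L cov X Y x = barNabla L cov X' Y x :=
  eq_of_linear_over_functions (fun X ↦ barNabla L cov X Y x)
    (fun X X' ↦ barNabla_add_left L cov X X' Y x)
    (fun f X ↦ barNabla_smulSec_left L cov f X Y x) h

theorem barNabla_add_right (X Y Y' : Sec E F A) (x : Q) :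
    barNabla L cov X (Y + Y') x = barNabla L cov X Y x + barNabla L cov X Y' x := by
  unfold barNabla
  rw [L.bracket_add_right]
  change cov _ x (L.anchor x (Y x + Y' x)) + (L.bracket X Y x + L.bracket X Y' x) = _
  rw [map_add, map_add]
  abel

theorem barNabla_smulSec_right (f : ContMDiffMap 𝓘(ℝ, E) 𝓘(ℝ, ℝ) Q ℝ ∞) (X Y : Sec E F A)
    (x : Q) : barNabla L cov X (smulSec f Y) x =
      f x • barNabla L cov X Y x + mvfderiv 𝓘(ℝ, E) f x (L.anchor x (X x)) • Y x := by
  unfold barNabla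
  rw [L.leibniz]
  change cov _ x (L.anchor x (f x • Y x)) + _ = _
  rw [map_smul, map_smul, smul_add]
  abel

theorem barNabla_smul_right (c : ℝ) (X Y : Sec E F A) (x : Q) :
    barNabla L cov X (c • Y) x = c • barNabla L cov X Y x := by
  unfold barNabla
  rw [L.bracket_smul_right]
  change cov _ x (L.anchor x (c • Y x)) + c • L.bracket X Y x = _
  rw [map_smul, map_smul, smul_add]

/-- Two sections with the same value give the same `A`-derivative of the dual connection. -/
theorem exists_isBarNablaDual (X : Sec E F A) (σ : Sec E (F →L[ℝ] ℝ) (Dual A)) (x : Q) :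
    ∃ ν : Dual A x, IsBarNablaDual L cov X σ x ν := by
  let T : Sec E F A → ℝ := fun s ↦
    mvfderiv 𝓘(ℝ, E) (fun y ↦ σ y (s y)) x (L.anchor x (X x)) - σ x (barNabla L cov X s x)
  have hp : ∀ s : Sec E F A, MDifferentiableAt 𝓘(ℝ, E) 𝓘(ℝ, ℝ) (fun y ↦ σ y (s y)) x :=
    fun s ↦ mdifferentiableAt_pairing (sec_mdifferentiableAt σ x) (sec_mdifferentiableAt s x)
  have hadd : ∀ s s', T (s + s') = T s + T s' := fun s s' ↦ by
    have h1 : (fun y ↦ σ y ((s + s') y)) = (fun y ↦ σ y (s y)) + fun y ↦ σ y (s' y) := by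
      ext y; exact map_add (σ y) _ _
    simp only [T]
    rw [h1, mvfderiv_add (hp s) (hp s'), barNabla_add_right, map_add, add_apply]
    ring
  have hsmul : ∀ (f : ContMDiffMap 𝓘(ℝ, E) 𝓘(ℝ, ℝ) Q ℝ ∞) s, T (smulSec f s) = f x • T s :=
    fun f s ↦ by
      have h1 : (fun y ↦ σ y ((smulSec f s) y)) = (f : Q → ℝ) • fun y ↦ σ y (s y) := by
        ext y; exact map_smul (σ y) _ _
      simp only [T]
      rw [h1, mvfderiv_smul (map_mdifferentiableAt f x) (hp s), barNabla_smulSec_right, map_add,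
        map_smul, map_smul]
      simp only [add_apply, smul_apply, ContinuousLinearMap.smulRight_apply, smul_eq_mul]
      ring
  have hT : ∀ {s s' : Sec E F A}, s x = s' x → T s = T s' := fun h ↦
    eq_of_linear_over_functions T hadd hsmul h
  obtain ⟨N, K, -, hxN, hN, hK⟩ := exists_constSec E F A x
  have hTc : ∀ (c : ℝ) s, T (c • s) = c • T s := fun c s ↦
    hsmul ⟨fun _ ↦ c, contMDiff_const⟩ s
  have hx := hN hxN
  let e : A x ≃L[ℝ] F := (trivializationAt F A x).continuousLinearEquivAt ℝ x hx.2
  -- Since T s depends only on s x, its values on the sections with constant coordinates define a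
  -- functional on the fibre, and this is ν.
  let T' : F →ₗ[ℝ] ℝ :=
    { toFun := fun w ↦ T (K w)
      map_add' := fun w w' ↦ by rw [map_add, hadd]
      map_smul' := fun c w ↦ by rw [map_smul, hTc]; rfl }
  refine ⟨(LinearMap.toContinuousLinearMap T').comp (e : A x →L[ℝ] F), fun s ↦ ?_⟩
  change T (K (fibCoord F x (s x))) = T s
  exact hT (fibCoord_injective hx (hK _ x hxN))

variable {L cov}

/-- The section `∇_{ρ(Y)} X`. -/
def nablaSec (L : LieAlgebroid E F A) {cov : CovariantDerivative 𝓘(ℝ, E) F A}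
    (hcov : cov.ContMDiffCovariantDerivative ∞) (X Y : Sec E F A) : Sec E F A :=
  ⟨fun x ↦ cov (fun y ↦ X y) x (L.anchor x (Y x)), by
    have h1 : ContMDiff 𝓘(ℝ, E) 𝓘(ℝ, E).tangent ∞
        (fun x ↦ TotalSpace.mk' E (E := fun x : Q ↦ TangentSpace 𝓘(ℝ, E) x) x
          (L.anchor x (Y x))) :=
      ContMDiff.clm_bundle_apply (F₁ := F) (F₂ := E) (b := fun y : Q ↦ y) L.contMDiff_anchor
        Y.contMDiff
    have h2 := contMDiffOn_univ.1 (hcov.contMDiff.contMDiff (σ := fun y ↦ X y)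
      (contMDiffOn_univ.2 X.contMDiff))
    exact ContMDiff.clm_bundle_apply (F₁ := E) (F₂ := F) (b := fun y : Q ↦ y) h2 h1⟩

theorem nablaSec_add (hcov : cov.ContMDiffCovariantDerivative ∞) (X X' Y : Sec E F A) :
    nablaSec L hcov (X + X') Y = nablaSec L hcov X Y + nablaSec L hcov X' Y := by
  ext x
  change cov (fun y ↦ (X + X') y) x _ = cov (fun y ↦ X y) x _ + cov (fun y ↦ X' y) x _
  rw [cov_add, add_apply]

theorem nablaSec_smul (hcov : cov.ContMDiffCovariantDerivative ∞) (c : ℝ) (X Y : Sec E F A) :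
    nablaSec L hcov (c • X) Y = c • nablaSec L hcov X Y := by
  ext x
  have h := cov_smulSec cov ⟨fun _ ↦ c, contMDiff_const⟩ X x (L.anchor x (Y x))
  have h1 : mvfderiv 𝓘(ℝ, E) (fun _ : Q ↦ c) x = 0 := mvfderiv_const c
  change _ = _ + mvfderiv 𝓘(ℝ, E) (fun _ : Q ↦ c) x _ • X x at h
  rw [h1, zero_apply, zero_smul, add_zero] at h
  exact h

end Algebroid

/-! ### Anchor, bracket and connection in a local frame -/

section LocalCoordinates

variable {E : Type*} [NormedAddCommGroup E] [NormedSpace ℝ E] [FiniteDimensional ℝ E]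
  {Q : Type*} [TopologicalSpace Q] [T2Space Q] [ChartedSpace E Q] [IsManifold 𝓘(ℝ, E) ∞ Q]
  {F : Type*} [NormedAddCommGroup F] [NormedSpace ℝ F] [FiniteDimensional ℝ F]
  {A : Q → Type*} [TopologicalSpace (TotalSpace F A)]
  [∀ x, AddCommGroup (A x)] [∀ x, Module ℝ (A x)] [∀ x, TopologicalSpace (A x)]
  [∀ x, IsTopologicalAddGroup (A x)] [∀ x, ContinuousSMul ℝ (A x)]
  [FiberBundle F A] [VectorBundle ℝ F A] [ContMDiffVectorBundle ∞ F A 𝓘(ℝ, E)]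
  {G : Type*} [NormedAddCommGroup G] [NormedSpace ℝ G]

variable (E F A) in
/-- Global sections of `A` and `A*` with constant coordinates near `x₀`, and a global smooth map
which agrees with the preferred chart near `x₀`. -/
structure FrameAt (x₀ : Q) where
  /-- the neighbourhood of `x₀` -/
  dom : Set Q
  /-- the sections of `A` -/
  sec : F →ₗ[ℝ] Sec E F A
  /-- the sections of `A*` -/
  dualSec : (F →L[ℝ] ℝ) →ₗ[ℝ] Sec E (F →L[ℝ] ℝ) (Dual A)
  /-- the globalized chart -/
  chart : ContMDiffMap 𝓘(ℝ, E) 𝓘(ℝ, E) Q E ∞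
  isOpen_dom : IsOpen dom
  mem_dom : x₀ ∈ dom
  dom_subset : dom ⊆ coordSet E F A x₀
  fibCoord_sec : ∀ w, ∀ x ∈ dom, fibCoord F x₀ (sec w x) = w
  fibCoord_dualSec : ∀ m, ∀ x ∈ dom, fibCoord (F →L[ℝ] ℝ) x₀ (dualSec m x) = m
  chart_eq : ∀ x ∈ dom, chart x = extChartAt 𝓘(ℝ, E) x₀ x

variable (E F A) in
theorem nonempty_frameAt (x₀ : Q) : Nonempty (FrameAt E F A x₀) := by
  obtain ⟨N, K, hN, hxN, hNs, hK⟩ := exists_constSec E F A x₀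
  obtain ⟨N', K', hN', hxN', hNs', hK'⟩ := exists_constSec E (F →L[ℝ] ℝ) (Dual A) x₀
  obtain ⟨χ, h1, h2⟩ := exists_bump E ((chartAt E x₀).open_source.mem_nhds (mem_chart_source E x₀))
  obtain ⟨U, hU, hUo, hxU⟩ := eventually_nhds_iff.1 h1
  have hχ : ContMDiff 𝓘(ℝ, E) 𝓘(ℝ, E) ∞ fun x ↦ χ x • extChartAt 𝓘(ℝ, E) x₀ x := by
    refine contMDiff_of_tsupport fun x hx ↦ ?_
    exact χ.contMDiff.contMDiffAt.smul
      (contMDiffAt_extChartAt' (h2 (tsupport_smul_subset_left _ _ hx)))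
  exact ⟨{
    dom := N ∩ N' ∩ U
    sec := K
    dualSec := K'
    chart := ⟨_, hχ⟩
    isOpen_dom := (hN.inter hN').inter hUo
    mem_dom := ⟨⟨hxN, hxN'⟩, hxU⟩
    dom_subset := fun x hx ↦ hNs hx.1.1
    fibCoord_sec := fun w x hx ↦ hK w x hx.1.1
    fibCoord_dualSec := fun m x hx ↦ hK' m x hx.1.2
    chart_eq := fun x hx ↦ by
      change χ x • extChartAt 𝓘(ℝ, E) x₀ x = _
      rw [hU x hx.2, one_smul] }⟩

namespace FrameAt

variable {x₀ : Q} (Φ : FrameAt E F A x₀)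

theorem mem_source {x : Q} (hx : x ∈ Φ.dom) : x ∈ (extChartAt 𝓘(ℝ, E) x₀).source := by
  rw [extChartAt_source]; exact (Φ.dom_subset hx).1

theorem sec_fibCoord {x : Q} (hx : x ∈ Φ.dom) (a : A x) : Φ.sec (fibCoord F x₀ a) x = a :=
  fibCoord_injective (Φ.dom_subset hx) (Φ.fibCoord_sec _ x hx)

theorem dualSec_fibCoord {x : Q} (hx : x ∈ Φ.dom) (p : Dual A x) :
    Φ.dualSec (fibCoord (F →L[ℝ] ℝ) x₀ p) x = p :=
  fibCoord_injective (E := E) (by rw [coordSet_dual]; exact Φ.dom_subset hx)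
    (Φ.fibCoord_dualSec _ x hx)

theorem dualSec_apply {x : Q} (hx : x ∈ Φ.dom) (m : F →L[ℝ] ℝ) (a : A x) :
    Φ.dualSec m x a = m (fibCoord F x₀ a) := by
  rw [← fibCoord_dual_apply (Φ.dom_subset hx), Φ.fibCoord_dualSec m x hx]

theorem dualSec_apply_sec {x : Q} (hx : x ∈ Φ.dom) (m : F →L[ℝ] ℝ) (w : F) :
    Φ.dualSec m x (Φ.sec w x) = m w := by
  rw [Φ.dualSec_apply hx, Φ.fibCoord_sec w x hx]

theorem apply_sec {x : Q} (hx : x ∈ Φ.dom) (p : Dual A x) (w : F) :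
    p (Φ.sec w x) = fibCoord (F →L[ℝ] ℝ) x₀ p w := by
  rw [← fibCoord_dual_apply (Φ.dom_subset hx), Φ.fibCoord_sec w x hx]

theorem eventually_mem_dom {x : Q} (hx : x ∈ Φ.dom) : ∀ᶠ y in 𝓝 x, y ∈ Φ.dom :=
  Φ.isOpen_dom.mem_nhds hx

theorem chartDeriv_eq {x : Q} (hx : x ∈ Φ.dom) (v : TangentSpace 𝓘(ℝ, E) x) :
    chartDeriv x₀ x v = mvfderiv 𝓘(ℝ, E) Φ.chart x v := by
  refine mvfderiv_congr_of_eventuallyEq ?_ v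
  filter_upwards [Φ.eventually_mem_dom hx] with y hy using (Φ.chart_eq y hy).symm

/-- The image of the neighbourhood in the chart. -/
def coordDom : Set E := (extChartAt 𝓘(ℝ, E) x₀).target ∩ (extChartAt 𝓘(ℝ, E) x₀).symm ⁻¹' Φ.dom

theorem isOpen_coordDom : IsOpen Φ.coordDom :=
  (continuousOn_extChartAt_symm x₀).isOpen_inter_preimage (isOpen_extChartAt_target x₀) Φ.isOpen_dom

theorem chart_mem_coordDom {x : Q} (hx : x ∈ Φ.dom) :
    extChartAt 𝓘(ℝ, E) x₀ x ∈ Φ.coordDom := by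
  have h := Φ.mem_source hx
  refine ⟨(extChartAt 𝓘(ℝ, E) x₀).map_source h, ?_⟩
  rw [mem_preimage, (extChartAt 𝓘(ℝ, E) x₀).left_inv h]
  exact hx

theorem contDiffOn_comp_symm {h : Q → G} (hh : ContMDiffOn 𝓘(ℝ, E) 𝓘(ℝ, G) ∞ h Φ.dom) :
    ContDiffOn ℝ ∞ (fun z ↦ h ((extChartAt 𝓘(ℝ, E) x₀).symm z)) Φ.coordDom := by
  rw [← contMDiffOn_iff_contDiffOn]
  exact hh.comp ((contMDiffOn_extChartAt_symm x₀).mono inter_subset_left) fun z hz ↦ hz.2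

/-- The derivative of a function in the chart. -/
theorem fderiv_comp_symm {h : Q → G} {x : Q} (hx : x ∈ Φ.dom)
    (hh : ContMDiffOn 𝓘(ℝ, E) 𝓘(ℝ, G) ∞ h Φ.dom) (v : TangentSpace 𝓘(ℝ, E) x) :
    fderiv ℝ (fun z ↦ h ((extChartAt 𝓘(ℝ, E) x₀).symm z)) (extChartAt 𝓘(ℝ, E) x₀ x)
      (chartDeriv x₀ x v) = mvfderiv 𝓘(ℝ, E) h x v := by
  have h1 : DifferentiableAt ℝ (fun z ↦ h ((extChartAt 𝓘(ℝ, E) x₀).symm z))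
      (extChartAt 𝓘(ℝ, E) x₀ x) :=
    ((Φ.contDiffOn_comp_symm hh).contDiffAt
      (Φ.isOpen_coordDom.mem_nhds (Φ.chart_mem_coordDom hx))).differentiableAt (by simp)
  have h2 := mvfderiv_comp_eq h1.mdifferentiableAt
    (mdifferentiableAt_chart (E := E) (Φ.dom_subset hx).1) v
  have h3 : mvfderiv 𝓘(ℝ, E) h x v = mvfderiv 𝓘(ℝ, E) (fun y ↦
      h ((extChartAt 𝓘(ℝ, E) x₀).symm (extChartAt 𝓘(ℝ, E) x₀ y))) x v := by
    refine mvfderiv_congr_of_eventuallyEq ?_ v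
    filter_upwards [Φ.eventually_mem_dom hx] with y hy
    rw [(extChartAt 𝓘(ℝ, E) x₀).left_inv (Φ.mem_source hy)]
  rw [h3, h2]
  change _ = mfderiv 𝓘(ℝ, E) 𝓘(ℝ, G) _ _ _
  rw [mfderiv_eq_fderiv]
  rfl

/-- The anchor in coordinates. -/
def anchorCoord (L : LieAlgebroid E F A) (z : E) : F →L[ℝ] E :=
  LinearMap.toContinuousLinearMap
    { toFun := fun a ↦ L.act (Φ.sec a) Φ.chart ((extChartAt 𝓘(ℝ, E) x₀).symm z)
      map_add' := fun a b ↦ by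
        simp only [LieAlgebroid.act_apply, map_add]
        change mvfderiv _ _ _ (L.anchor _ (Φ.sec a _ + Φ.sec b _)) = _
        rw [map_add, map_add]
      map_smul' := fun c a ↦ by
        simp only [LieAlgebroid.act_apply, map_smul]
        change mvfderiv _ _ _ (L.anchor _ (c • Φ.sec a _)) = _
        rw [map_smul, map_smul]
        rfl }

/-- The matrix of a family of sections in coordinates. -/
def matrixCoord (T : F →ₗ[ℝ] Sec E F A) (z : E) : F →L[ℝ] F :=
  -- The value off the domain is arbitrary; the case distinction is there because linearity of the
  -- fibre coordinate is only known over `coordSet`.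
  open Classical in
  if hz : (extChartAt 𝓘(ℝ, E) x₀).symm z ∈ Φ.dom then LinearMap.toContinuousLinearMap
    { toFun := fun a ↦ fibCoord F x₀ (T a ((extChartAt 𝓘(ℝ, E) x₀).symm z))
      map_add' := fun a b ↦ by
        rw [map_add]
        exact fibCoord_add (Φ.dom_subset hz) _ _
      map_smul' := fun c a ↦ by
        rw [map_smul]
        exact fibCoord_smul (Φ.dom_subset hz) _ _ }
  else 0

theorem chartDeriv_anchor (L : LieAlgebroid E F A) {x : Q} (hx : x ∈ Φ.dom) (a : A x) :
    chartDeriv x₀ x (L.anchor x a) =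
      Φ.anchorCoord L (extChartAt 𝓘(ℝ, E) x₀ x) (fibCoord F x₀ a) := by
  change _ = L.act _ _ ((extChartAt 𝓘(ℝ, E) x₀).symm (extChartAt 𝓘(ℝ, E) x₀ x))
  rw [(extChartAt 𝓘(ℝ, E) x₀).left_inv (Φ.mem_source hx), LieAlgebroid.act_apply,
    Φ.sec_fibCoord hx, Φ.chartDeriv_eq hx]

theorem matrixCoord_apply (T : F →ₗ[ℝ] Sec E F A) {x : Q} (hx : x ∈ Φ.dom) (w : F) :
    Φ.matrixCoord T (extChartAt 𝓘(ℝ, E) x₀ x) w = fibCoord F x₀ (T w x) := by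
  have h := (extChartAt 𝓘(ℝ, E) x₀).left_inv (Φ.mem_source hx)
  unfold matrixCoord
  rw [dif_pos (by rw [h]; exact hx)]
  change fibCoord F x₀ (T w _) = _
  rw [h]

theorem contDiffOn_anchorCoord (L : LieAlgebroid E F A) :
    ContDiffOn ℝ ∞ (Φ.anchorCoord L) Φ.coordDom :=
  contDiffOn_clm_apply.2 fun a ↦
    Φ.contDiffOn_comp_symm (L.act (Φ.sec a) Φ.chart).contMDiff.contMDiffOn

theorem contMDiffOn_fibCoord_sec (s : Sec E F A) :
    ContMDiffOn 𝓘(ℝ, E) 𝓘(ℝ, F) ∞ (fun x ↦ fibCoord F x₀ (s x)) Φ.dom := fun _ hx ↦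
  (contMDiffAt_fibCoord (Φ.dom_subset hx) s.contMDiff.contMDiffAt).contMDiffWithinAt

theorem contDiffOn_matrixCoord (T : F →ₗ[ℝ] Sec E F A) :
    ContDiffOn ℝ ∞ (Φ.matrixCoord T) Φ.coordDom :=
  contDiffOn_clm_apply.2 fun a ↦
    (Φ.contDiffOn_comp_symm (Φ.contMDiffOn_fibCoord_sec (T a))).congr fun z hz ↦ by
      unfold matrixCoord
      rw [dif_pos (show _ ∈ Φ.dom from hz.2)]
      rfl

/-- The family of sections `a ↦ [ã, ũ]`. -/
def bracketFamily (L : LieAlgebroid E F A) (u : F) : F →ₗ[ℝ] Sec E F A where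
  toFun a := L.bracket (Φ.sec a) (Φ.sec u)
  map_add' a b := by rw [map_add, L.bracket_add_left]
  map_smul' c a := by rw [map_smul, L.bracket_smul_left]; rfl

/-- The family of sections `a ↦ ∇_{ρ(ũ)} ã`. -/
def nablaFamily (L : LieAlgebroid E F A) {cov : CovariantDerivative 𝓘(ℝ, E) F A}
    (hcov : cov.ContMDiffCovariantDerivative ∞) (u : F) : F →ₗ[ℝ] Sec E F A where
  toFun a := nablaSec L hcov (Φ.sec a) (Φ.sec u)
  map_add' a b := by rw [map_add, nablaSec_add]
  map_smul' c a := by rw [map_smul, nablaSec_smul]; rfl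

theorem exists_eq_chart {z : E} (hz : z ∈ Φ.coordDom) :
    ∃ x ∈ Φ.dom, extChartAt 𝓘(ℝ, E) x₀ x = z :=
  ⟨_, hz.2, (extChartAt 𝓘(ℝ, E) x₀).right_inv hz.1⟩

/-- The compatibility of anchor and bracket in coordinates. -/
theorem fderiv_anchorCoord (L : LieAlgebroid E F A) (u : F) {z : E} (hz : z ∈ Φ.coordDom) (a : F) :
    fderiv ℝ (Φ.anchorCoord L) z (Φ.anchorCoord L z u) a +
      Φ.anchorCoord L z (Φ.matrixCoord (Φ.bracketFamily L u) z a) =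
    fderiv ℝ (Φ.anchorCoord L) z (Φ.anchorCoord L z a) u := by
  obtain ⟨x, hx, rfl⟩ := Φ.exists_eq_chart hz
  have hd : DifferentiableAt ℝ (Φ.anchorCoord L) (extChartAt 𝓘(ℝ, E) x₀ x) :=
    ((Φ.contDiffOn_anchorCoord L).contDiffAt (Φ.isOpen_coordDom.mem_nhds hz)).differentiableAt
      (by simp)
  -- In coordinates ρ(x) a is the derivative of the chart along the section ã. A further derivative
  -- along ρ(b) is therefore an iterated action on the chart, to which `act_bracket` applies.
  have key : ∀ a b : F, fderiv ℝ (Φ.anchorCoord L) (extChartAt 𝓘(ℝ, E) x₀ x)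
      (Φ.anchorCoord L (extChartAt 𝓘(ℝ, E) x₀ x) b) a =
      L.act (Φ.sec b) (L.act (Φ.sec a) Φ.chart) x := by
    intro a b
    have h1 := Φ.chartDeriv_anchor L hx (Φ.sec b x)
    rw [Φ.fibCoord_sec b x hx] at h1
    rw [← h1, LieAlgebroid.act_apply,
      ← Φ.fderiv_comp_symm hx (L.act (Φ.sec a) Φ.chart).contMDiff.contMDiffOn]
    have h2 := (hd.hasFDerivAt.clm_apply
      (hasFDerivAt_const a (extChartAt 𝓘(ℝ, E) x₀ x))).fderiv
    have h3 : (fun z ↦ L.act (Φ.sec a) Φ.chart ((extChartAt 𝓘(ℝ, E) x₀).symm z)) =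
      fun z ↦ Φ.anchorCoord L z a := rfl
    rw [h3, h2]
    simp
  rw [key, key, Φ.matrixCoord_apply _ hx, ← Φ.chartDeriv_anchor L hx, Φ.chartDeriv_eq hx,
    L.act_bracket (Φ.sec a) (Φ.sec u), add_comm]
  rfl

end FrameAt

end LocalCoordinates

/-! ### The first variation of the action -/

section FirstVariation

variable {E : Type*} [NormedAddCommGroup E] [NormedSpace ℝ E] [FiniteDimensional ℝ E]
  {Q : Type*} [TopologicalSpace Q] [T2Space Q] [ChartedSpace E Q] [IsManifold 𝓘(ℝ, E) ∞ Q]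
  {F : Type*} [NormedAddCommGroup F] [NormedSpace ℝ F] [FiniteDimensional ℝ F]
  {A : Q → Type*} [TopologicalSpace (TotalSpace F A)]
  [∀ x, AddCommGroup (A x)] [∀ x, Module ℝ (A x)] [∀ x, TopologicalSpace (A x)]
  [∀ x, IsTopologicalAddGroup (A x)] [∀ x, ContinuousSMul ℝ (A x)]
  [FiberBundle F A] [VectorBundle ℝ F A] [ContMDiffVectorBundle ∞ F A 𝓘(ℝ, E)]

namespace FrameAt

variable {x₀ : Q} (Φ : FrameAt E F A x₀) (cov : CovariantDerivative 𝓘(ℝ, E) F A)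

/-- The lift is computed with the section of constant coordinate through e, whose coordinate
derivative vanishes, so only the Christoffel term remains. -/
theorem coordDeriv_horLift_sec {x : Q} (hx : x ∈ Φ.dom) (e : A x) (v : TangentSpace 𝓘(ℝ, E) x) :
    coordDeriv E x₀ (TotalSpace.mk' F x e) (horLift cov e v) =
      (chartDeriv x₀ x v, -fibCoord F x₀ (cov (fun y ↦ Φ.sec (fibCoord F x₀ e) y) x v)) := by
  have h := coordDeriv_horLift cov (Φ.dom_subset hx)
    (sec_mdifferentiableAt (Φ.sec (fibCoord F x₀ e)) x) v
  have h1 : mvfderiv 𝓘(ℝ, E) (fun y ↦ fibCoord F x₀ (Φ.sec (fibCoord F x₀ e) y)) x v = 0 := by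
    have h2 : (fun y ↦ fibCoord F x₀ (Φ.sec (fibCoord F x₀ e) y)) =ᶠ[𝓝 x]
        fun _ ↦ fibCoord F x₀ e := by
      filter_upwards [Φ.eventually_mem_dom hx] with y hy using Φ.fibCoord_sec _ y hy
    rw [mvfderiv_congr_of_eventuallyEq h2, mvfderiv_const]
    rfl
  rw [h1, zero_sub] at h
  generalize fibCoord F x₀ (cov (fun y ↦ Φ.sec (fibCoord F x₀ e) y) x v) = g at h
  rwa [Φ.sec_fibCoord hx] at h

/-- On sections with constant coordinates the pairing is constant, so the Christoffel term of ∇* is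
minus the transpose of that of ∇. This turns the minus sign of the horizontal lift into a plus. -/
theorem coordDeriv_horLift_dual {x : Q} (hx : x ∈ Φ.dom) (p : Dual A x)
    (v : TangentSpace 𝓘(ℝ, E) x) :
    (coordDeriv E x₀ (TotalSpace.mk' (F →L[ℝ] ℝ) x p) (horLift (dualCov cov) p v)).1 =
        chartDeriv x₀ x v ∧
    ∀ w, (coordDeriv E x₀ (TotalSpace.mk' (F →L[ℝ] ℝ) x p) (horLift (dualCov cov) p v)).2 w =
      p (cov (fun y ↦ Φ.sec w y) x v) := by
  have hx' : x ∈ coordSet E (F →L[ℝ] ℝ) (Dual A) x₀ := by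
    rw [coordSet_dual]; exact Φ.dom_subset hx
  set m := fibCoord (F →L[ℝ] ℝ) x₀ p with hm
  have hpm : Φ.dualSec m x = p := Φ.dualSec_fibCoord hx p
  have h := coordDeriv_horLift (dualCov cov) hx' (sec_mdifferentiableAt (Φ.dualSec m) x) v
  have h1 : mvfderiv 𝓘(ℝ, E) (fun y ↦ fibCoord (F →L[ℝ] ℝ) x₀ (Φ.dualSec m y)) x v = 0 := by
    have h2 : (fun y ↦ fibCoord (F →L[ℝ] ℝ) x₀ (Φ.dualSec m y)) =ᶠ[𝓝 x] fun _ ↦ m := by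
      filter_upwards [Φ.eventually_mem_dom hx] with y hy using Φ.fibCoord_dualSec _ y hy
    rw [mvfderiv_congr_of_eventuallyEq h2, mvfderiv_const]
    rfl
  rw [h1, zero_sub] at h
  have h3 : ∀ w, fibCoord (F →L[ℝ] ℝ) x₀ (dualCov cov (fun y ↦ Φ.dualSec m y) x v) w =
      -p (cov (fun y ↦ Φ.sec w y) x v) := by
    intro w
    rw [← Φ.apply_sec hx]
    refine (dualCovAux_apply cov (sec_mdifferentiableAt (Φ.dualSec m) x)
      (sec_mdifferentiableAt (Φ.sec w) x) v).trans ?_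
    have h4 : (fun y ↦ Φ.dualSec m y (Φ.sec w y)) =ᶠ[𝓝 x] fun _ ↦ m w := by
      filter_upwards [Φ.eventually_mem_dom hx] with y hy using Φ.dualSec_apply_sec hy m w
    rw [mvfderiv_congr_of_eventuallyEq h4, mvfderiv_const, hpm]
    exact zero_sub _
  generalize fibCoord (F →L[ℝ] ℝ) x₀ (dualCov cov (fun y ↦ Φ.dualSec m y) x v) = g at h h3
  rw [hpm] at h
  rw [h]
  refine ⟨rfl, fun w ↦ ?_⟩
  rw [neg_apply, h3, neg_neg]

theorem fibCoord_barNabla (L : LieAlgebroid E F A) {cov : CovariantDerivative 𝓘(ℝ, E) F A}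
    (hcov : cov.ContMDiffCovariantDerivative ∞) {x : Q} (hx : x ∈ Φ.dom) (a u : F) :
    fibCoord F x₀ (barNabla L cov (Φ.sec a) (Φ.sec u) x) =
      Φ.matrixCoord (Φ.nablaFamily L hcov u) (extChartAt 𝓘(ℝ, E) x₀ x) a +
        Φ.matrixCoord (Φ.bracketFamily L u) (extChartAt 𝓘(ℝ, E) x₀ x) a := by
  rw [Φ.matrixCoord_apply _ hx, Φ.matrixCoord_apply _ hx]
  exact fibCoord_add (Φ.dom_subset hx) _ _

end FrameAt

/-- The integrand of the action. -/
def lagrangian (s : ℝ) (H : TotalSpace (F →L[ℝ] ℝ) (Dual A) → ℝ) (γ : PairPath A) (t : ℝ) : ℝ :=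
  γ.p t (γ.a t) + s * H (TotalSpace.mk' (F →L[ℝ] ℝ) (γ.q t) (γ.p t))

theorem contDiffOn_lagrangian {L : LieAlgebroid E F A} {s : ℝ}
    {H : TotalSpace (F →L[ℝ] ℝ) (Dual A) → ℝ}
    (hH : ContMDiff (𝓘(ℝ, E).prod 𝓘(ℝ, F →L[ℝ] ℝ)) 𝓘(ℝ, ℝ) ∞ H) {t₀ t₁ : ℝ} {Γ : ℝ → PairPath A}
    (hΓ : IsHomotopy L t₀ t₁ Γ) : ∃ δ > (0 : ℝ), ContDiffOn ℝ 1
      (Function.uncurry fun ε t ↦ lagrangian s H (Γ ε) t) (Ioo (-δ) δ ×ˢ Icc t₀ t₁) := by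
  obtain ⟨δ, hδ, -, h1, h2⟩ := hΓ
  refine ⟨δ, hδ, ?_⟩
  rw [← contMDiffOn_iff_contDiffOn]
  have h3 : ContMDiffOn 𝓘(ℝ, ℝ × ℝ) 𝓘(ℝ, ℝ) 1 (fun z : ℝ × ℝ ↦ (Γ z.1).p z.2 ((Γ z.1).a z.2))
      (Ioo (-δ) δ ×ˢ Icc t₀ t₁) := by
    have h4 := ContMDiffOn.clm_bundle_apply (F₁ := F) (F₂ := ℝ) (E₂ := Bundle.Trivial Q ℝ)
      (b := fun z : ℝ × ℝ ↦ (Γ z.1).q z.2) h2 h1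
    intro z hz
    have := h4 z hz
    rw [contMDiffWithinAt_totalSpace] at this
    exact this.2
  have h4 : ContMDiffOn 𝓘(ℝ, ℝ × ℝ) 𝓘(ℝ, ℝ) 1 (fun z : ℝ × ℝ ↦
      H (TotalSpace.mk' (F →L[ℝ] ℝ) ((Γ z.1).q z.2) ((Γ z.1).p z.2)))
      (Ioo (-δ) δ ×ˢ Icc t₀ t₁) :=
    (hH.of_le (by simp)).comp_contMDiffOn h2
  exact h3.add (ContMDiff.comp_contMDiffOn (I' := 𝓘(ℝ, ℝ)) (g := fun y : ℝ ↦ s * y)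
    (contDiff_const.mul contDiff_id).contMDiff h4)

/-- The integrand is jointly C¹ for every homotopy, so the derivative of the action always exists
and criticality only concerns its value. -/
theorem hasDerivAt_action {L : LieAlgebroid E F A} {s : ℝ}
    {H : TotalSpace (F →L[ℝ] ℝ) (Dual A) → ℝ}
    (hH : ContMDiff (𝓘(ℝ, E).prod 𝓘(ℝ, F →L[ℝ] ℝ)) 𝓘(ℝ, ℝ) ∞ H) {t₀ t₁ : ℝ} (ht : t₀ < t₁)
    {Γ : ℝ → PairPath A} (hΓ : IsHomotopy L t₀ t₁ Γ) :
    HasDerivAt (fun ε ↦ action s H t₀ t₁ (Γ ε))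
      (∫ t in t₀..t₁, deriv (fun ε ↦ lagrangian s H (Γ ε) t) 0) 0 := by
  obtain ⟨δ, hδ, h⟩ := contDiffOn_lagrangian (s := s) hH hΓ
  exact hasDerivAt_integral_of_contDiffOn ht hδ h

theorem IsHomotopy.mdifferentiableAt_fst {L : LieAlgebroid E F A} {t₀ t₁ : ℝ} {Γ : ℝ → PairPath A}
    (hΓ : IsHomotopy L t₀ t₁ Γ) {t : ℝ} (ht : t ∈ Icc t₀ t₁) :
    MDifferentiableAt 𝓘(ℝ, ℝ) (𝓘(ℝ, E).prod 𝓘(ℝ, F))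
      (fun ε ↦ TotalSpace.mk' F ((Γ ε).q t) ((Γ ε).a t)) 0 := by
  obtain ⟨δ, hδ, -, h1, h2⟩ := hΓ
  have h3 : ContMDiffOn 𝓘(ℝ, ℝ) 𝓘(ℝ, ℝ × ℝ) 1 (fun ε : ℝ ↦ (ε, t)) (Ioo (-δ) δ) :=
    (contDiff_id.prodMk contDiff_const).contMDiff.contMDiffOn
  have h4 := (h1.comp h3 fun ε hε ↦ ⟨hε, ht⟩).contMDiffAt
    (isOpen_Ioo.mem_nhds (⟨neg_lt_zero.2 hδ, hδ⟩ : (0 : ℝ) ∈ Ioo (-δ) δ))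
  exact h4.mdifferentiableAt (by simp)

theorem IsHomotopy.mdifferentiableAt_snd {L : LieAlgebroid E F A} {t₀ t₁ : ℝ} {Γ : ℝ → PairPath A}
    (hΓ : IsHomotopy L t₀ t₁ Γ) {t : ℝ} (ht : t ∈ Icc t₀ t₁) :
    MDifferentiableAt 𝓘(ℝ, ℝ) (𝓘(ℝ, E).prod 𝓘(ℝ, F →L[ℝ] ℝ))
      (fun ε ↦ TotalSpace.mk' (F →L[ℝ] ℝ) ((Γ ε).q t) ((Γ ε).p t)) 0 := by
  obtain ⟨δ, hδ, -, h1, h2⟩ := hΓ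
  have h3 : ContMDiffOn 𝓘(ℝ, ℝ) 𝓘(ℝ, ℝ × ℝ) 1 (fun ε : ℝ ↦ (ε, t)) (Ioo (-δ) δ) :=
    (contDiff_id.prodMk contDiff_const).contMDiff.contMDiffOn
  have h4 := (h2.comp h3 fun ε hε ↦ ⟨hε, ht⟩).contMDiffAt
    (isOpen_Ioo.mem_nhds (⟨neg_lt_zero.2 hδ, hδ⟩ : (0 : ℝ) ∈ Ioo (-δ) δ))
  exact h4.mdifferentiableAt (by simp)

theorem diffH_add (H : TotalSpace (F →L[ℝ] ℝ) (Dual A) → ℝ) {x : Q} (p : Dual A x)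
    (v w : TotalTangent E (F →L[ℝ] ℝ) p) : diffH E H p (v + w) = diffH E H p v + diffH E H p w :=
  (mvfderiv (𝓘(ℝ, E).prod 𝓘(ℝ, F →L[ℝ] ℝ)) H (TotalSpace.mk' (F →L[ℝ] ℝ) x p)).map_add v w

/-- The derivative of the integrand along a variation with given horizontal and vertical parts. -/
theorem hasDerivAt_lagrangian {L : LieAlgebroid E F A} {cov : CovariantDerivative 𝓘(ℝ, E) F A}
    {s : ℝ} {H : TotalSpace (F →L[ℝ] ℝ) (Dual A) → ℝ}
    (hH : ContMDiff (𝓘(ℝ, E).prod 𝓘(ℝ, F →L[ℝ] ℝ)) 𝓘(ℝ, ℝ) ∞ H) {t₀ t₁ : ℝ} {Γ : ℝ → PairPath A}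
    (hΓ : IsHomotopy L t₀ t₁ Γ) {t : ℝ} (ht : t ∈ Icc t₀ t₁)
    {v : TangentSpace 𝓘(ℝ, E) ((Γ 0).q t)} {w : A ((Γ 0).q t)} {r : Dual A ((Γ 0).q t)}
    (ha : velFst Γ t = horLift cov ((Γ 0).a t) v + vertLift E F ((Γ 0).a t) w)
    (hp : velSnd Γ t = horLift (dualCov cov) ((Γ 0).p t) v +
      vertLift E (F →L[ℝ] ℝ) ((Γ 0).p t) r) :
    HasDerivAt (fun ε ↦ lagrangian s H (Γ ε) t)
      (r ((Γ 0).a t) + (Γ 0).p t w + s * (horizontalPart cov H ((Γ 0).p t) v +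
        diffH E H ((Γ 0).p t) (vertLift E (F →L[ℝ] ℝ) ((Γ 0).p t) r))) 0 := by
  obtain ⟨Φ⟩ := nonempty_frameAt E F A ((Γ 0).q t)
  have hx := Φ.mem_dom
  have hxc := Φ.dom_subset hx
  have hxc' : ((Γ 0).q t) ∈ coordSet E (F →L[ℝ] ℝ) (Dual A) ((Γ 0).q t) := by rw [coordSet_dual]; exact hxc
  have hd1 := hΓ.mdifferentiableAt_fst ht
  have hd2 := hΓ.mdifferentiableAt_snd ht
  have h1 := hasDerivAt_bundleCoord (x₀ := (Γ 0).q t) hd1 hxc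
  have h2 := hasDerivAt_bundleCoord (x₀ := (Γ 0).q t) hd2 hxc'
  have e1 : coordDeriv E ((Γ 0).q t) (TotalSpace.mk' F ((Γ 0).q t) ((Γ 0).a t)) (velFst Γ t) =
      (chartDeriv ((Γ 0).q t) ((Γ 0).q t) v, fibCoord F ((Γ 0).q t) w -
        fibCoord F ((Γ 0).q t) (cov (fun y ↦ Φ.sec (fibCoord F ((Γ 0).q t) ((Γ 0).a t)) y) ((Γ 0).q t) v)) := by
    rw [ha]
    refine ((coordDeriv E ((Γ 0).q t) (TotalSpace.mk' F ((Γ 0).q t) ((Γ 0).a t))).map_add _ _).trans ?_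
    rw [Φ.coordDeriv_horLift_sec cov hx, coordDeriv_vertLift hxc, Prod.mk_add_mk, add_zero,
      neg_add_eq_sub]
  have e2 : ∀ c, (coordDeriv E ((Γ 0).q t) (TotalSpace.mk' (F →L[ℝ] ℝ) ((Γ 0).q t) ((Γ 0).p t)) (velSnd Γ t)).2 c =
      (Γ 0).p t (cov (fun y ↦ Φ.sec c y) ((Γ 0).q t) v) + fibCoord (F →L[ℝ] ℝ) ((Γ 0).q t) r c := by
    intro c
    rw [hp]
    have h3 : coordDeriv E ((Γ 0).q t) (TotalSpace.mk' (F →L[ℝ] ℝ) ((Γ 0).q t) ((Γ 0).p t))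
        (horLift (dualCov cov) ((Γ 0).p t) v + vertLift E (F →L[ℝ] ℝ) ((Γ 0).p t) r) =
        coordDeriv E ((Γ 0).q t) (TotalSpace.mk' (F →L[ℝ] ℝ) ((Γ 0).q t) ((Γ 0).p t))
          (horLift (dualCov cov) ((Γ 0).p t) v) + (0, fibCoord (F →L[ℝ] ℝ) ((Γ 0).q t) r) := by
      refine ((coordDeriv E ((Γ 0).q t) (TotalSpace.mk' (F →L[ℝ] ℝ) ((Γ 0).q t)
        ((Γ 0).p t))).map_add _ _).trans ?_
      rw [coordDeriv_vertLift hxc']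
    rw [h3, Prod.snd_add, add_apply, (Φ.coordDeriv_horLift_dual cov hx _ v).2]
  have h3 : HasDerivAt (fun ε ↦ fibCoord (F →L[ℝ] ℝ) ((Γ 0).q t) ((Γ ε).p t) (fibCoord F ((Γ 0).q t) ((Γ ε).a t)))
      ((coordDeriv E ((Γ 0).q t) (TotalSpace.mk' (F →L[ℝ] ℝ) ((Γ 0).q t) ((Γ 0).p t)) (velSnd Γ t)).2
        (fibCoord F ((Γ 0).q t) ((Γ 0).a t)) + fibCoord (F →L[ℝ] ℝ) ((Γ 0).q t) ((Γ 0).p t)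
        (coordDeriv E ((Γ 0).q t) (TotalSpace.mk' F ((Γ 0).q t) ((Γ 0).a t)) (velFst Γ t)).2) 0 :=
    HasDerivAt.clm_apply h2.snd h1.snd
  have h4 : (fun ε ↦ (Γ ε).p t ((Γ ε).a t)) =ᶠ[𝓝 0]
      fun ε ↦ fibCoord (F →L[ℝ] ℝ) ((Γ 0).q t) ((Γ ε).p t) (fibCoord F ((Γ 0).q t) ((Γ ε).a t)) := by
    have hc : ContinuousAt (fun ε ↦ (Γ ε).q t) 0 :=
      (FiberBundle.continuous_proj F A).continuousAt.comp hd1.continuousAt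
    filter_upwards [hc ((isOpen_coordSet ((Γ 0).q t)).mem_nhds hxc)] with ε hε
    exact (fibCoord_dual_apply hε _ _).symm
  have h5 := h3.congr_of_eventuallyEq h4
  have h6 : HasDerivAt (fun ε ↦ H (TotalSpace.mk' (F →L[ℝ] ℝ) ((Γ ε).q t) ((Γ ε).p t)))
      (diffH E H ((Γ 0).p t) (velSnd Γ t)) 0 := by
    have hHd : MDifferentiableAt (𝓘(ℝ, E).prod 𝓘(ℝ, F →L[ℝ] ℝ)) 𝓘(ℝ, ℝ) H
      (TotalSpace.mk' (F →L[ℝ] ℝ) ((Γ 0).q t) ((Γ 0).p t)) := hH.mdifferentiableAt (by simp)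
    have h7 := hasDerivAt_of_mdifferentiableAt (hHd.comp (0 : ℝ) hd2)
    exact h7.congr_deriv (mvfderiv_comp_eq (g := H)
      (f := fun ε ↦ TotalSpace.mk' (F →L[ℝ] ℝ) ((Γ ε).q t) ((Γ ε).p t)) hHd hd2 (1 : ℝ))
  -- The Christoffel term in the coordinate of δa and the one in that of δp are opposite after
  -- pairing with p and a respectively, and cancel.
  refine (h5.add (h6.const_mul s)).congr_deriv ?_
  rw [e1, e2, hp, diffH_add, fibCoord_dual_apply hxc, map_sub,
    fibCoord_dual_apply hxc, fibCoord_dual_apply hxc]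
  unfold horizontalPart
  ring

end FirstVariation

/-- The target is a fibre, which carries a vector space topology but no norm. The derivative there
is a little-o condition in topological vector spaces, and continuous linear maps preserve it. -/
theorem hasDerivWithinAt_clm_comp {W W' : Type*} [NormedAddCommGroup W] [NormedSpace ℝ W]
    [AddCommGroup W'] [Module ℝ W'] [TopologicalSpace W'] [ContinuousSMul ℝ W'] (T : W →L[ℝ] W')
    {f : ℝ → W} {f' : W} {S : Set ℝ} {t : ℝ} (h : HasDerivWithinAt f f' S t) :
    HasDerivWithinAt (fun s ↦ T (f s)) (T f') S t := by
  have h1 := (HasFDerivAtFilter.isLittleOTVS h)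
  refine HasFDerivAtFilter.of_isLittleOTVS ?_
  refine ((T.isBigOTVS_comp (f := _) (l := _)).trans_isLittleOTVS h1).congr_left fun p ↦ ?_
  simp

/-! ### The product rule along paths, and sufficiency of the equations -/

section ProductRule

variable {E : Type*} [NormedAddCommGroup E] [NormedSpace ℝ E] [FiniteDimensional ℝ E]
  {Q : Type*} [TopologicalSpace Q] [T2Space Q] [ChartedSpace E Q] [IsManifold 𝓘(ℝ, E) ∞ Q]
  {F : Type*} [NormedAddCommGroup F] [NormedSpace ℝ F] [FiniteDimensional ℝ F]

section General

variable {V : Q → Type*} [TopologicalSpace (TotalSpace F V)]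
  [∀ x, AddCommGroup (V x)] [∀ x, Module ℝ (V x)] [∀ x, TopologicalSpace (V x)]
  [∀ x, IsTopologicalAddGroup (V x)] [∀ x, ContinuousSMul ℝ (V x)]
  [FiberBundle F V] [VectorBundle ℝ F V] [ContMDiffVectorBundle ∞ F V 𝓘(ℝ, E)]

/-- The trivialization is a linear homeomorphism of the fibre with F. It transports derivatives, and
it transports the Hausdorff property that makes them unique. -/
theorem fibCoord_derivWithin {x₀ x : Q} (hx : x ∈ coordSet E F V x₀) {u : ℝ → V x} {w : F}
    {S : Set ℝ} {t : ℝ} (ht : UniqueDiffWithinAt ℝ S t)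
    (h : HasDerivWithinAt (fun s ↦ fibCoord F x₀ (u s)) w S t) :
    fibCoord F x₀ (derivWithin u S t) = w := by
  let e : V x ≃L[ℝ] F := (trivializationAt F V x₀).continuousLinearEquivAt ℝ x hx.2
  have : T2Space (V x) := e.symm.toHomeomorph.t2Space
  have h1 : HasDerivWithinAt (fun s ↦ e.symm (fibCoord F x₀ (u s))) (e.symm w) S t :=
    hasDerivWithinAt_clm_comp (e.symm : F →L[ℝ] V x) h
  have h2 : (fun s ↦ e.symm (fibCoord F x₀ (u s))) = u := by
    ext s; exact e.symm_apply_apply (u s)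
  rw [h2] at h1
  have h3 : derivWithin u S t = e.symm w := by
    have h4 := HasFDerivWithinAt.fderivWithin h1 ht
    unfold derivWithin
    rw [h4]
    simp
  rw [h3]
  exact e.apply_symm_apply w

theorem ExtendsNear.differentiableWithinAt_fibCoord {t₀ t₁ : ℝ} {q : ℝ → Q} {u : ∀ t, V (q t)}
    {t : ℝ} {η : ℝ → Sec E F V} (h : ExtendsNear t₀ t₁ q u t η) {x₀ : Q}
    (hx : q t ∈ coordSet E F V x₀) :
    DifferentiableWithinAt ℝ (fun s ↦ fibCoord F x₀ (η s (q t))) (Icc t₀ t₁) t := by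
  have h1 := (((trivializationAt F V x₀).contMDiffWithinAt_iff
    ((trivializationAt F V x₀).mem_source.2 hx.2)).1 h.1).2
  have h2 : ContMDiffWithinAt 𝓘(ℝ, ℝ) (𝓘(ℝ, ℝ).prod 𝓘(ℝ, E)) 1 (fun s : ℝ ↦ (s, q t))
      (Icc t₀ t₁) t := contMDiffWithinAt_id.prodMk contMDiffWithinAt_const
  have h3 : ContMDiffWithinAt 𝓘(ℝ, ℝ) 𝓘(ℝ, F) 1 (fun s ↦ fibCoord F x₀ (η s (q t)))
      (Icc t₀ t₁) t :=
    ContMDiffWithinAt.comp (t := Icc t₀ t₁ ×ˢ univ) t h1 h2 fun s hs ↦ ⟨hs, mem_univ _⟩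
  exact h3.contDiffWithinAt.differentiableWithinAt (by simp)

end General

variable {A : Q → Type*} [TopologicalSpace (TotalSpace F A)]
  [∀ x, AddCommGroup (A x)] [∀ x, Module ℝ (A x)] [∀ x, TopologicalSpace (A x)]
  [∀ x, IsTopologicalAddGroup (A x)] [∀ x, ContinuousSMul ℝ (A x)]
  [FiberBundle F A] [VectorBundle ℝ F A] [ContMDiffVectorBundle ∞ F A 𝓘(ℝ, E)]

/-- With f(s, y) = ⟨μ_s(y), η_s(y)⟩ and D its derivative at (t, q t), the chain rule along s ↦ (s, q
s) gives D(1, q') = D(1, 0) + D(0, q'). The first term is computed in the fixed fibre by the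
ordinary product rule, the second at fixed time. -/
theorem hasDerivWithinAt_pairing {t₀ t₁ : ℝ} (htt : t₀ < t₁) {q : ℝ → Q} {b : ∀ t, A (q t)}
    {p : ∀ t, Dual A (q t)} {t : ℝ} (ht : t ∈ Icc t₀ t₁)
    (hq : MDifferentiableWithinAt 𝓘(ℝ, ℝ) 𝓘(ℝ, E) q (Icc t₀ t₁) t)
    {η : ℝ → Sec E F A} {μ : ℝ → Sec E (F →L[ℝ] ℝ) (Dual A)}
    (hη : ExtendsNear t₀ t₁ q b t η) (hμ : ExtendsNear t₀ t₁ q p t μ) :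
    HasDerivWithinAt (fun s ↦ p s (b s))
      (derivWithin (fun s ↦ μ s (q t)) (Icc t₀ t₁) t (η t (q t)) +
        μ t (q t) (derivWithin (fun s ↦ η s (q t)) (Icc t₀ t₁) t) +
        mvfderiv 𝓘(ℝ, E) (fun y ↦ μ t y (η t y)) (q t)
          (mfderivWithin 𝓘(ℝ, ℝ) 𝓘(ℝ, E) q (Icc t₀ t₁) t (1 : ℝ))) (Icc t₀ t₁) t := by
  have hu : UniqueDiffWithinAt ℝ (Icc t₀ t₁) t := uniqueDiffOn_Icc htt t ht
  let f : ℝ × Q → ℝ := fun z ↦ μ z.1 z.2 (η z.1 z.2)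
  have hf : MDifferentiableWithinAt (𝓘(ℝ, ℝ).prod 𝓘(ℝ, E)) 𝓘(ℝ, ℝ) f (Icc t₀ t₁ ×ˢ univ)
      (t, q t) := by
    have h := ContMDiffWithinAt.clm_bundle_apply (F₁ := F) (F₂ := ℝ) (E₂ := Bundle.Trivial Q ℝ)
      (b := fun z : ℝ × Q ↦ z.2) hμ.1 hη.1
    rw [contMDiffWithinAt_totalSpace] at h
    exact h.2.mdifferentiableWithinAt (by simp)
  let D : ℝ × E →L[ℝ] ℝ :=
    mfderivWithin (𝓘(ℝ, ℝ).prod 𝓘(ℝ, E)) 𝓘(ℝ, ℝ) f (Icc t₀ t₁ ×ˢ univ) (t, q t)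
  have hD := hf.hasMFDerivWithinAt
  let q' : E := mfderivWithin 𝓘(ℝ, ℝ) 𝓘(ℝ, E) q (Icc t₀ t₁) t (1 : ℝ)
  have hc : HasDerivWithinAt (fun s ↦ f (s, q s)) (D (1, q')) (Icc t₀ t₁) t := by
    have h1 := (hasMFDerivWithinAt_id (I := 𝓘(ℝ, ℝ)) (Icc t₀ t₁) t).prodMk hq.hasMFDerivWithinAt
    have h2 := HasMFDerivWithinAt.comp (u := Icc t₀ t₁ ×ˢ univ) (g := f) t hD h1
      fun s hs ↦ ⟨hs, mem_univ _⟩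
    have h3 : HasFDerivWithinAt (fun s ↦ f (s, q s)) (D.comp ((ContinuousLinearMap.id ℝ ℝ).prod
        (mfderivWithin 𝓘(ℝ, ℝ) 𝓘(ℝ, E) q (Icc t₀ t₁) t : ℝ →L[ℝ] E))) (Icc t₀ t₁) t :=
      hasMFDerivWithinAt_iff_hasFDerivWithinAt.1 h2
    exact h3.hasDerivWithinAt
  have hi : HasDerivWithinAt (fun s ↦ f (s, q t)) (D (1, 0)) (Icc t₀ t₁) t := by
    have h1 := (hasMFDerivWithinAt_id (I := 𝓘(ℝ, ℝ)) (Icc t₀ t₁) t).prodMk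
      (hasMFDerivWithinAt_const (I := 𝓘(ℝ, ℝ)) (I' := 𝓘(ℝ, E)) (q t) (Icc t₀ t₁) t)
    have h2 := HasMFDerivWithinAt.comp (u := Icc t₀ t₁ ×ˢ univ) (g := f) t hD h1
      fun s hs ↦ ⟨hs, mem_univ _⟩
    have h3 : HasFDerivWithinAt (fun s ↦ f (s, q t)) (D.comp ((ContinuousLinearMap.id ℝ ℝ).prod
        (0 : ℝ →L[ℝ] E))) (Icc t₀ t₁) t := hasMFDerivWithinAt_iff_hasFDerivWithinAt.1 h2
    exact h3.hasDerivWithinAt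
  have hj : mvfderiv 𝓘(ℝ, E) (fun y ↦ μ t y (η t y)) (q t) q' = D (0, q') := by
    have h1 := (hasMFDerivWithinAt_const (I := 𝓘(ℝ, E)) (I' := 𝓘(ℝ, ℝ)) t univ (q t)).prodMk
      (hasMFDerivWithinAt_id (I := 𝓘(ℝ, E)) univ (q t))
    have h2 := HasMFDerivWithinAt.comp (u := Icc t₀ t₁ ×ˢ univ) (g := f) (q t) hD h1
      fun s hs ↦ ⟨ht, mem_univ _⟩
    have h3 := (hasMFDerivWithinAt_univ.1 h2).mfderiv
    exact congrArg (fun T ↦ T q') h3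
  have hx := mem_coordSet_self (E := E) (F := F) (V := A) (q t)
  have hx' : q t ∈ coordSet E (F →L[ℝ] ℝ) (Dual A) (q t) := by rw [coordSet_dual]; exact hx
  have h1 := (hη.differentiableWithinAt_fibCoord hx).hasDerivWithinAt
  have h2 := (hμ.differentiableWithinAt_fibCoord hx').hasDerivWithinAt
  have h3 := HasDerivWithinAt.clm_apply h2 h1
  have h4 : (fun s ↦ fibCoord (F →L[ℝ] ℝ) (q t) (μ s (q t)) (fibCoord F (q t) (η s (q t)))) =
      fun s ↦ f (s, q t) := by
    ext s; exact fibCoord_dual_apply hx _ _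
  have h5 := hu.eq_deriv _ (h4 ▸ h3) hi
  rw [← fibCoord_derivWithin hx' hu h2, ← fibCoord_derivWithin hx hu h1,
    fibCoord_dual_apply hx, fibCoord_dual_apply hx] at h5
  have h6 : D (1, q') = D (1, 0) + D (0, q') := by rw [← map_add]; simp
  have h7 := hc.congr_of_eventuallyEq_of_mem (f₁ := fun s ↦ p s (b s)) (by
    filter_upwards [hη.2, hμ.2] with s hs hs'
    simp only [f, hs, hs']) ht
  refine h7.congr_deriv ?_
  rw [h6, ← h5, ← hj]

/-- Along a solution of the vertical equation, `⟨p, b⟩' = ⟨p, ∇̄_a b⟩ + ⟨∇̄*_a p, b⟩`. -/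
theorem hasDerivWithinAt_pairing_barNabla {L : LieAlgebroid E F A}
    {cov : CovariantDerivative 𝓘(ℝ, E) F A} {t₀ t₁ : ℝ} (htt : t₀ < t₁) {γ : PairPath A}
    (hγ : IsPairPath L t₀ t₁ γ) {b : ∀ t, A (γ.q t)} {t : ℝ} (ht : t ∈ Icc t₀ t₁)
    {w : A (γ.q t)} {ν : Dual A (γ.q t)} (hw : IsBarNablaAlong L cov t₀ t₁ γ.q γ.a b t w)
    (hν : IsBarNablaDualAlong L cov t₀ t₁ γ.q γ.a γ.p t ν) :
    HasDerivWithinAt (fun s ↦ γ.p s (b s)) (γ.p t w + ν (b t)) (Icc t₀ t₁) t := by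
  obtain ⟨X, η, hX, hη, rfl⟩ := hw
  obtain ⟨X', μ, ν', hX', hμ, hν', rfl⟩ := hν
  have h := hasDerivWithinAt_pairing htt ht
    ((hγ.base t ht).mdifferentiableWithinAt (by simp)) hη hμ
  refine h.congr_deriv ?_
  have hb : η t (γ.q t) = b t := hη.2.self_of_nhdsWithin ht
  have hp : μ t (γ.q t) = γ.p t := hμ.2.self_of_nhdsWithin ht
  -- Because q' = ρ(a), the spatial derivative is the term ρ(X')[⟨μ, η⟩] in the definition of ∇̄*.
  -- The extensions X and X' of a(t) may differ, but agree at q t, which suffices for ∇̄.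
  rw [hγ.anchor t ht, ← hb, add_apply, hν' (η t), ← hp, map_add, hX',
    barNabla_congr_left L cov (η t) (hX.trans hX'.symm)]
  ring

/-- Solutions of the generalized Lie-Poisson equations are critical. -/
theorem LiePoissonEquations.isCritical {L : LieAlgebroid E F A}
    {cov : CovariantDerivative 𝓘(ℝ, E) F A} {s : ℝ}
    {H : TotalSpace (F →L[ℝ] ℝ) (Dual A) → ℝ}
    (hH : ContMDiff (𝓘(ℝ, E).prod 𝓘(ℝ, F →L[ℝ] ℝ)) 𝓘(ℝ, ℝ) ∞ H) {t₀ t₁ : ℝ} (htt : t₀ < t₁)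
    {γ : PairPath A} (hγ : IsPairPath L t₀ t₁ γ) (h : LiePoissonEquations L cov s H t₀ t₁ γ) :
    IsCritical L cov t₀ t₁ (action s H t₀ t₁) γ := by
  rintro Γ rfl hΓ ⟨b, r, hb, hr, hb0, hb1, hvar⟩
  have hS := hasDerivAt_action (s := s) hH htt hΓ
  have hP : ContDiffOn ℝ 1 (fun t ↦ (Γ 0).p t (b t)) (Icc t₀ t₁) := by
    rw [← contMDiffOn_iff_contDiffOn]
    have h4 := ContMDiffOn.clm_bundle_apply (F₁ := F) (F₂ := ℝ) (E₂ := Bundle.Trivial Q ℝ)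
      (b := fun t : ℝ ↦ (Γ 0).q t) hγ.snd hb
    intro z hz
    have := h4 z hz
    rw [contMDiffWithinAt_totalSpace] at this
    exact this.2
  -- On a solution the integrand of the first variation is the derivative of ⟨p, b⟩: the Legendre
  -- relation removes r, and the vertical equation replaces s dH^hor(p)(ρ(b)) by ⟨∇̄*_a p, b⟩.
  have key : ∀ t ∈ Icc t₀ t₁, HasDerivWithinAt (fun t ↦ (Γ 0).p t (b t))
      (deriv (fun ε ↦ lagrangian s H (Γ ε) t) 0) (Icc t₀ t₁) t := by
    intro t ht
    obtain ⟨w, hw, ha, hp⟩ := hvar t ht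
    obtain ⟨u, hu, hau⟩ := h.legendre t ht
    obtain ⟨ν, hν, hνu⟩ := h.vertical t ht
    rw [(hasDerivAt_lagrangian (s := s) hH hΓ ht ha hp).deriv]
    refine (hasDerivWithinAt_pairing_barNabla htt hγ ht hw hν).congr_deriv ?_
    rw [hνu, ← hu, hau, map_neg, map_smul, smul_eq_mul]
    ring
  have hd : ∀ t ∈ Icc t₀ t₁, derivWithin (fun t ↦ (Γ 0).p t (b t)) (Icc t₀ t₁) t =
      deriv (fun ε ↦ lagrangian s H (Γ ε) t) 0 := fun t ht ↦
    (key t ht).derivWithin (uniqueDiffOn_Icc htt t ht)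
  have hc : ContinuousOn (fun t ↦ deriv (fun ε ↦ lagrangian s H (Γ ε) t) 0) (Icc t₀ t₁) :=
    (hP.continuousOn_derivWithin (uniqueDiffOn_Icc htt) le_rfl).congr fun t ht ↦ (hd t ht).symm
  have hI := intervalIntegral.integral_eq_sub_of_hasDerivAt_of_le htt.le hP.continuousOn
    (fun t ht ↦ (key t (Ioo_subset_Icc_self ht)).hasDerivAt (Icc_mem_nhds ht.1 ht.2))
    (hc.intervalIntegrable_of_Icc htt.le)
  rw [hI, hb0, hb1, map_zero, map_zero, sub_zero] at hS
  exact hS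

end ProductRule

theorem two_le_infty : (2 : WithTop ℕ∞) ≤ ∞ :=
  show ((2 : ℕ∞) : WithTop ℕ∞) ≤ ((⊤ : ℕ∞) : WithTop ℕ∞) from WithTop.coe_le_coe.2 le_top

/-! ### Linearity of lifts, and C¹ regularity tested in coordinates -/

section Lifts

variable {E : Type*} [NormedAddCommGroup E] [NormedSpace ℝ E] [FiniteDimensional ℝ E]
  {Q : Type*} [TopologicalSpace Q] [T2Space Q] [ChartedSpace E Q] [IsManifold 𝓘(ℝ, E) ∞ Q]
  {F : Type*} [NormedAddCommGroup F] [NormedSpace ℝ F] [FiniteDimensional ℝ F]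
  {V : Q → Type*} [TopologicalSpace (TotalSpace F V)]
  [∀ x, AddCommGroup (V x)] [∀ x, Module ℝ (V x)] [∀ x, TopologicalSpace (V x)]
  [∀ x, IsTopologicalAddGroup (V x)] [∀ x, ContinuousSMul ℝ (V x)]
  [FiberBundle F V] [VectorBundle ℝ F V] [ContMDiffVectorBundle ∞ F V 𝓘(ℝ, E)]

theorem vertLift_smul {x : Q} (e u : V x) (c : ℝ) :
    vertLift E F e (c • u) = c • vertLift E F e u := by
  have hx := mem_coordSet_self (E := E) (F := F) (V := V) x
  refine coordDeriv_injective (E := E) (z := TotalSpace.mk' F x e) hx ?_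
  refine (coordDeriv_vertLift hx e (c • u)).trans ?_
  refine Eq.trans ?_ ((coordDeriv E x (TotalSpace.mk' F x e)).map_smul c _).symm
  rw [coordDeriv_vertLift hx, fibCoord_smul hx, Prod.smul_mk, smul_zero]

theorem vertLift_zero {x : Q} (e : V x) : vertLift E F e (0 : V x) = 0 := by
  have h := vertLift_smul (E := E) (F := F) e 0 0
  rwa [zero_smul, zero_smul] at h

theorem horLift_smul (cov : CovariantDerivative 𝓘(ℝ, E) F V) {x : Q} (e : V x)
    (v : TangentSpace 𝓘(ℝ, E) x) (c : ℝ) : horLift cov e (c • v) = c • horLift cov e v := by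
  unfold horLift
  simp only [map_smul, vertLift_smul]
  exact (smul_sub c _ _).symm

variable {EM : Type*} [NormedAddCommGroup EM] [NormedSpace ℝ EM] {HM : Type*} [TopologicalSpace HM]
  {IM : ModelWithCorners ℝ EM HM} {M : Type*} [TopologicalSpace M] [ChartedSpace HM M]

theorem contMDiffWithinAt_of_bundleCoord {f : M → TotalSpace F V} {S : Set M} {z : M} {x₀ : Q}
    (hz : z ∈ S) (hS : ∀ᶠ y in 𝓝[S] z, (f y).proj ∈ coordSet E F V x₀)
    (h : ContMDiffWithinAt IM 𝓘(ℝ, E × F) 1 (fun y ↦ bundleCoord E x₀ (f y)) S z) :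
    ContMDiffWithinAt IM (𝓘(ℝ, E).prod 𝓘(ℝ, F)) 1 f S z := by
  have h0 : (f z).proj ∈ coordSet E F V x₀ := hS.self_of_nhdsWithin hz
  rw [(trivializationAt F V x₀).contMDiffWithinAt_iff
    ((trivializationAt F V x₀).mem_source.2 h0.2)]
  have h1 : ContMDiffWithinAt IM 𝓘(ℝ, E) 1 (fun y ↦ (bundleCoord E x₀ (f y)).1) S z :=
    (contDiff_fst (𝕜 := ℝ) (n := 1)).contMDiff.contMDiffAt.comp_contMDiffWithinAt z h
  have h2 : ContMDiffWithinAt IM 𝓘(ℝ, F) 1 (fun y ↦ (bundleCoord E x₀ (f y)).2) S z :=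
    (contDiff_snd (𝕜 := ℝ) (n := 1)).contMDiff.contMDiffAt.comp_contMDiffWithinAt z h
  refine ⟨?_, h2⟩
  have h3 : ContMDiffAt 𝓘(ℝ, E) 𝓘(ℝ, E) 1 (extChartAt 𝓘(ℝ, E) x₀).symm
      (extChartAt 𝓘(ℝ, E) x₀ (f z).proj) :=
    (contMDiffOn_extChartAt_symm x₀).contMDiffAt ((isOpen_extChartAt_target x₀).mem_nhds
      ((extChartAt 𝓘(ℝ, E) x₀).map_source (by rw [extChartAt_source]; exact h0.1)))
  have h4 := ContMDiffAt.comp_contMDiffWithinAt z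
    (f := fun y ↦ (bundleCoord E x₀ (f y)).1) h3 h1
  refine h4.congr_of_eventuallyEq_of_mem ?_ hz
  filter_upwards [hS] with y hy
  exact ((extChartAt 𝓘(ℝ, E) x₀).left_inv (by rw [extChartAt_source]; exact hy.1)).symm

theorem contMDiffWithinAt_bundleCoord {f : M → TotalSpace F V} {S : Set M} {z : M} {x₀ : Q}
    (hz : (f z).proj ∈ coordSet E F V x₀)
    (h : ContMDiffWithinAt IM (𝓘(ℝ, E).prod 𝓘(ℝ, F)) 1 f S z) :
    ContMDiffWithinAt IM 𝓘(ℝ, E × F) 1 (fun y ↦ bundleCoord E x₀ (f y)) S z := by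
  obtain ⟨h1, h2⟩ := ((trivializationAt F V x₀).contMDiffWithinAt_iff
    ((trivializationAt F V x₀).mem_source.2 hz.2)).1 h
  have h3 : ContMDiffAt 𝓘(ℝ, E) 𝓘(ℝ, E) 1 (extChartAt 𝓘(ℝ, E) x₀) (f z).proj :=
    contMDiffAt_extChartAt' hz.1
  exact (ContMDiffAt.comp_contMDiffWithinAt z (f := fun y ↦ (f y).proj) h3 h1).prodMk_space h2

/-- A multiple of a section along a map. -/
theorem contMDiffWithinAt_smul_sec_comp (σ : Sec E F V) {f : M → ℝ} {g : M → Q} {S : Set M} {z : M}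
    (hz : z ∈ S) (hf : ContMDiffWithinAt IM 𝓘(ℝ, ℝ) 1 f S z)
    (hg : ContMDiffWithinAt IM 𝓘(ℝ, E) 1 g S z) :
    ContMDiffWithinAt IM (𝓘(ℝ, E).prod 𝓘(ℝ, F)) 1
      (fun y ↦ TotalSpace.mk' F (g y) (f y • σ (g y))) S z := by
  have hx := mem_coordSet_self (E := E) (F := F) (V := V) (g z)
  have hS : ∀ᶠ y in 𝓝[S] z, g y ∈ coordSet E F V (g z) :=
    hg.continuousWithinAt ((isOpen_coordSet (g z)).mem_nhds hx)
  refine contMDiffWithinAt_of_bundleCoord (x₀ := g z) hz hS ?_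
  have h1 : ContMDiffWithinAt IM 𝓘(ℝ, E) 1 (fun y ↦ extChartAt 𝓘(ℝ, E) (g z) (g y)) S z :=
    contMDiffAt_extChartAt.comp_contMDiffWithinAt z hg
  have h2 : ContMDiffWithinAt IM 𝓘(ℝ, F) 1 (fun y ↦ fibCoord F (g z) (σ (g y))) S z :=
    ((contMDiffAt_fibCoord hx σ.contMDiff.contMDiffAt).of_le (by simp)).comp_contMDiffWithinAt
      (g := fun x ↦ fibCoord F (g z) (σ x)) z hg
  refine (h1.prodMk_space (hf.smul h2)).congr_of_eventuallyEq_of_mem ?_ hz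
  filter_upwards [hS] with y hy
  exact Prod.ext rfl (fibCoord_smul hy _ _)

theorem derivWithin_smul_fibre {x₀ x : Q} (hx : x ∈ coordSet E F V x₀) (v : V x) {f : ℝ → ℝ} {f' : ℝ} {S : Set ℝ} {t : ℝ}
    (ht : UniqueDiffWithinAt ℝ S t) (h : HasDerivWithinAt f f' S t) :
    derivWithin (fun s ↦ f s • v) S t = f' • v := by
  refine fibCoord_injective hx ?_
  refine fibCoord_derivWithin hx ht ?_
  rw [fibCoord_smul hx]
  have : (fun s ↦ fibCoord F x₀ (f s • v)) = fun s ↦ f s • fibCoord F x₀ v := by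
    ext s; rw [fibCoord_smul hx]
  rw [this]
  exact h.smul_const _

end Lifts

/-! ### Flows of constant sections near a given time -/

section Flow

variable {E : Type*} [NormedAddCommGroup E] [NormedSpace ℝ E] [FiniteDimensional ℝ E]
  {Q : Type*} [TopologicalSpace Q] [T2Space Q] [ChartedSpace E Q] [IsManifold 𝓘(ℝ, E) ∞ Q]
  {F : Type*} [NormedAddCommGroup F] [NormedSpace ℝ F] [FiniteDimensional ℝ F]
  {A : Q → Type*} [TopologicalSpace (TotalSpace F A)]
  [∀ x, AddCommGroup (A x)] [∀ x, Module ℝ (A x)] [∀ x, TopologicalSpace (A x)]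
  [∀ x, IsTopologicalAddGroup (A x)] [∀ x, ContinuousSMul ℝ (A x)]
  [FiberBundle F A] [VectorBundle ℝ F A] [ContMDiffVectorBundle ∞ F A 𝓘(ℝ, E)]

variable (E) in
/-- The base path in the preferred chart at `x₀`. -/
def baseCoord (x₀ : Q) (γ : PairPath A) (t : ℝ) : E := extChartAt 𝓘(ℝ, E) x₀ (γ.q t)

variable (F) in
/-- The `A`-component in the preferred trivialization at `x₀`. -/
def fstCoord (x₀ : Q) (γ : PairPath A) (t : ℝ) : F := fibCoord F x₀ (γ.a t)

variable (F) in
/-- The `A*`-component in the preferred trivialization at `x₀`. -/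
def sndCoord (x₀ : Q) (γ : PairPath A) (t : ℝ) : F →L[ℝ] ℝ := fibCoord (F →L[ℝ] ℝ) x₀ (γ.p t)

/-- A family of local diffeomorphisms of the coordinate space of `A` preserving the relation
`q' = ρ(a)` up to a translation, generated by the section with constant coordinate `u`, and a set of
times at which a given path is in its domain. -/
structure PathFlow (L : LieAlgebroid E F A) (t₀ t₁ : ℝ) (γ : PairPath A) {x₀ : Q}
    (Φ : FrameAt E F A x₀) (u : F) where
  /-- the domain -/
  dom : Set (ℝ × (E × F))
  /-- the family of maps -/
  map : ℝ × (E × F) → E × F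
  /-- the set of times -/
  times : Set ℝ
  isOpen_dom : IsOpen dom
  contDiffOn_map : ContDiffOn ℝ 1 map dom
  map_mem : ∀ x ∈ dom, (map x).1 ∈ Φ.coordDom
  map_zero : ∀ z, (0, z) ∈ dom → map (0, z) = z
  fderiv_map_zero : ∀ z, (0, z) ∈ dom → fderiv ℝ map (0, z) (1, 0) =
    (Φ.anchorCoord L z.1 u, Φ.matrixCoord (Φ.bracketFamily L u) z.1 z.2)
  -- Here r is the velocity of the flow parameter and b that of the fibre coordinate, while the base
  -- velocity is ρ(a). The image curve satisfies the anchor relation after its fibre coordinate is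
  -- translated by r u.
  fderiv_map_anchor : ∀ x ∈ dom, ∀ (r : ℝ) (b : F),
    (fderiv ℝ map x (r, (Φ.anchorCoord L x.2.1 x.2.2, b))).1 =
      Φ.anchorCoord L (map x).1 ((map x).2 + r • u)
  isOpen_times : IsOpen times
  mem_of_times : ∀ t ∈ Icc t₀ t₁ ∩ times, γ.q t ∈ Φ.dom
  times_mem : ∀ t ∈ Icc t₀ t₁ ∩ times, (0, (baseCoord E x₀ γ t, fstCoord F x₀ γ t)) ∈ dom

/-- The flow exists near the coordinates of a(t). By continuity of the path these stay in its
domain, at parameter 0, for all times of the interval near t. -/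
theorem exists_pathFlow {L : LieAlgebroid E F A} {t₀ t₁ : ℝ} {γ : PairPath A}
    (hγ : IsPairPath L t₀ t₁ γ) {t : ℝ} (ht : t ∈ Icc t₀ t₁) (Φ : FrameAt E F A (γ.q t)) (u : F) :
    ∃ Λ : PathFlow L t₀ t₁ γ Φ u, t ∈ Λ.times := by
  obtain ⟨U, y, h1, h2, h3, h4, h5, h6, h7⟩ := exists_anchored_flow (u := u) Φ.isOpen_coordDom
    ((Φ.contDiffOn_anchorCoord L).of_le two_le_infty)
    ((Φ.contDiffOn_matrixCoord (Φ.bracketFamily L u)).of_le two_le_infty)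
    (fun z hz a ↦ Φ.fderiv_anchorCoord L u hz a)
    (z₀ := (baseCoord E (γ.q t) γ t, fstCoord F (γ.q t) γ t)) (Φ.chart_mem_coordDom Φ.mem_dom)
  have hc : ContinuousWithinAt (fun s ↦ (0, (baseCoord E (γ.q t) γ s, fstCoord F (γ.q t) γ s)) :
      ℝ → ℝ × (E × F)) (Icc t₀ t₁) t := by
    refine continuousWithinAt_const.prodMk ?_
    exact (contMDiffWithinAt_bundleCoord (x₀ := γ.q t) (Φ.dom_subset Φ.mem_dom)
      (hγ.fst t ht)).continuousWithinAt
  have hq : ∀ᶠ s in 𝓝[Icc t₀ t₁] t, γ.q s ∈ Φ.dom :=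
    (hγ.base t ht).continuousWithinAt (Φ.isOpen_dom.mem_nhds Φ.mem_dom)
  obtain ⟨K, hKo, htK, hK⟩ := mem_nhdsWithin.1 (hq.and (hc (h1.mem_nhds h2)))
  exact ⟨{ dom := U, map := y, times := K, isOpen_dom := h1, contDiffOn_map := h3, map_mem := h4,
           map_zero := h5, fderiv_map_zero := h6, fderiv_map_anchor := h7, isOpen_times := hKo,
           mem_of_times := fun s hs ↦ (hK ⟨hs.2, hs.1⟩).1
           times_mem := fun s hs ↦ (hK ⟨hs.2, hs.1⟩).2 }, htK⟩

end Flow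

/-- A smooth function with compact support in a given set. -/
structure IsCutoff (φ : ℝ → ℝ) (S : Set ℝ) : Prop where
  contDiff : ContDiff ℝ ∞ φ
  hasCompactSupport : HasCompactSupport φ
  tsupport_subset : tsupport φ ⊆ S

theorem eventuallyEq_zero_of_notMem_tsupport {φ : ℝ → ℝ} {t : ℝ} (ht : t ∉ tsupport φ) :
    ∀ᶠ s in 𝓝 t, s ∉ tsupport φ :=
  (isClosed_tsupport φ).isOpen_compl.mem_nhds ht

theorem deriv_eq_zero_of_notMem_tsupport {φ : ℝ → ℝ} {t : ℝ} (ht : t ∉ tsupport φ) :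
    deriv φ t = 0 :=
  image_eq_zero_of_notMem_tsupport fun h ↦ ht (tsupport_deriv_subset (𝕜 := ℝ) h)

theorem IsCutoff.contDiff_deriv {φ : ℝ → ℝ} {S : Set ℝ} (hφ : IsCutoff φ S) :
    ContDiff ℝ 1 (deriv φ) :=
  ContDiff.iterate_deriv' 1 1 (hφ.contDiff.of_le two_le_infty)

/-! ### The varied paths in coordinates -/

section Flow

variable {E : Type*} [NormedAddCommGroup E] [NormedSpace ℝ E] [FiniteDimensional ℝ E]
  {Q : Type*} [TopologicalSpace Q] [T2Space Q] [ChartedSpace E Q] [IsManifold 𝓘(ℝ, E) ∞ Q]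
  {F : Type*} [NormedAddCommGroup F] [NormedSpace ℝ F] [FiniteDimensional ℝ F]
  {A : Q → Type*} [TopologicalSpace (TotalSpace F A)]
  [∀ x, AddCommGroup (A x)] [∀ x, Module ℝ (A x)] [∀ x, TopologicalSpace (A x)]
  [∀ x, IsTopologicalAddGroup (A x)] [∀ x, ContinuousSMul ℝ (A x)]
  [FiberBundle F A] [VectorBundle ℝ F A] [ContMDiffVectorBundle ∞ F A 𝓘(ℝ, E)]

theorem hasDerivWithinAt_chart {q : ℝ → Q} {S : Set ℝ} {t : ℝ} {x₀ : Q}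
    (hq : MDifferentiableWithinAt 𝓘(ℝ, ℝ) 𝓘(ℝ, E) q S t) (hx : q t ∈ (chartAt E x₀).source) :
    HasDerivWithinAt (fun s ↦ extChartAt 𝓘(ℝ, E) x₀ (q s))
      (chartDeriv x₀ (q t) (mfderivWithin 𝓘(ℝ, ℝ) 𝓘(ℝ, E) q S t (1 : ℝ))) S t := by
  have h1 := (mdifferentiableAt_chart (E := E) hx).hasMFDerivAt.comp_hasMFDerivWithinAt t
    hq.hasMFDerivWithinAt
  have h2 : HasFDerivWithinAt (fun s ↦ extChartAt 𝓘(ℝ, E) x₀ (q s))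
      ((chartDeriv x₀ (q t) : E →L[ℝ] E).comp
        (mfderivWithin 𝓘(ℝ, ℝ) 𝓘(ℝ, E) q S t : ℝ →L[ℝ] E)) S t :=
    hasMFDerivWithinAt_iff_hasFDerivWithinAt.1 h1
  exact h2.hasDerivWithinAt

namespace PathFlow

variable {L : LieAlgebroid E F A} {cov : CovariantDerivative 𝓘(ℝ, E) F A} {t₀ t₁ : ℝ}
  {γ : PairPath A} {x₀ : Q} {Φ : FrameAt E F A x₀} {u : F} (Λ : PathFlow L t₀ t₁ γ Φ u)

theorem uniqueDiffOn (htt : t₀ < t₁) : UniqueDiffOn ℝ (Icc t₀ t₁ ∩ Λ.times) :=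
  (uniqueDiffOn_Icc htt).inter Λ.isOpen_times

theorem nhdsWithin_eq {t : ℝ} (ht : t ∈ Icc t₀ t₁ ∩ Λ.times) :
    𝓝[Icc t₀ t₁ ∩ Λ.times] t = 𝓝[Icc t₀ t₁] t :=
  nhdsWithin_inter_of_mem' (mem_nhdsWithin_of_mem_nhds (Λ.isOpen_times.mem_nhds ht.2))

theorem contDiffOn_coord_fst (hγ : IsPairPath L t₀ t₁ γ) :
    ContDiffOn ℝ 1 (fun t ↦ (baseCoord E x₀ γ t, fstCoord F x₀ γ t)) (Icc t₀ t₁ ∩ Λ.times) := by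
  intro t ht
  exact ((contMDiffWithinAt_bundleCoord (Φ.dom_subset (Λ.mem_of_times t ht))
    (hγ.fst t ht.1)).mono inter_subset_left).contDiffWithinAt

theorem contDiffOn_sndCoord (hγ : IsPairPath L t₀ t₁ γ) :
    ContDiffOn ℝ 1 (sndCoord F x₀ γ) (Icc t₀ t₁ ∩ Λ.times) := by
  intro t ht
  have h : γ.q t ∈ coordSet E (F →L[ℝ] ℝ) (Dual A) x₀ := by
    rw [coordSet_dual]; exact Φ.dom_subset (Λ.mem_of_times t ht)
  exact ((contMDiffWithinAt_bundleCoord h (hγ.snd t ht.1)).mono inter_subset_left).contDiffWithinAt.snd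

theorem hasDerivWithinAt_baseCoord (hγ : IsPairPath L t₀ t₁ γ) {t : ℝ}
    (ht : t ∈ Icc t₀ t₁ ∩ Λ.times) : HasDerivWithinAt (baseCoord E x₀ γ)
      (Φ.anchorCoord L (baseCoord E x₀ γ t) (fstCoord F x₀ γ t)) (Icc t₀ t₁ ∩ Λ.times) t := by
  have hx := Λ.mem_of_times t ht
  have h := hasDerivWithinAt_chart ((hγ.base t ht.1).mdifferentiableWithinAt (by simp))
    (Φ.dom_subset hx).1
  rw [hγ.anchor t ht.1, Φ.chartDeriv_anchor L hx] at h
  exact h.mono inter_subset_left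

/-- The transformed coordinates of the `A`-component before the translation. -/
def point (φ : ℝ → ℝ) (ε t : ℝ) : E × F :=
  Λ.map (ε * φ t, (baseCoord E x₀ γ t, fstCoord F x₀ γ t))

/-- The coordinates of the `A`-component of the varied path. -/
def newFst (φ : ℝ → ℝ) (ε t : ℝ) : F := (Λ.point φ ε t).2 + (ε * deriv φ t) • u

/-- The coordinates of the `A*`-component of the varied path. -/
def newSnd (_ : PathFlow L t₀ t₁ γ Φ u) (hcov : cov.ContMDiffCovariantDerivative ∞)
    (m : F →L[ℝ] ℝ) (φ : ℝ → ℝ) (ε t : ℝ) : F →L[ℝ] ℝ :=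
  -- The derivative in ε consists of φ m, the intended vertical part, and φ times p composed with ã
  -- ↦ ∇_{ρ(u)} ã, the Christoffel term of the horizontal lift for ∇*.
  sndCoord F x₀ γ t + (ε * φ t) • (m + (sndCoord F x₀ γ t).comp
    (Φ.matrixCoord (Φ.nablaFamily L hcov u) (baseCoord E x₀ γ t)))

open Classical in
/-- The points of the varied path. -/
def variation (hcov : cov.ContMDiffCovariantDerivative ∞) (m : F →L[ℝ] ℝ) (φ : ℝ → ℝ) (ε t : ℝ) :
    Σ x : Q, A x × Dual A x :=
  -- Outside the support the original point is kept literally, since it may lie outside the frame.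
  -- Base point and fibre elements are bundled so that the three switch together.
  if ε = 0 ∨ t ∉ tsupport φ then ⟨γ.q t, γ.a t, γ.p t⟩
  else ⟨(extChartAt 𝓘(ℝ, E) x₀).symm (Λ.point φ ε t).1, fibSymm F x₀ _ (Λ.newFst φ ε t),
    fibSymm (F →L[ℝ] ℝ) x₀ _ (Λ.newSnd hcov m φ ε t)⟩

/-- The family of varied paths. -/
def family (hcov : cov.ContMDiffCovariantDerivative ∞) (m : F →L[ℝ] ℝ) (φ : ℝ → ℝ) (ε : ℝ) :
    PairPath A where
  q t := (Λ.variation hcov m φ ε t).1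
  a t := (Λ.variation hcov m φ ε t).2.1
  p t := (Λ.variation hcov m φ ε t).2.2

variable (hcov : cov.ContMDiffCovariantDerivative ∞) (m : F →L[ℝ] ℝ) {φ : ℝ → ℝ}

theorem variation_eq {ε t : ℝ} (h : ε = 0 ∨ t ∉ tsupport φ) :
    Λ.variation hcov m φ ε t = ⟨γ.q t, γ.a t, γ.p t⟩ := if_pos h

theorem family_zero : Λ.family hcov m φ 0 = γ := by
  have h : Λ.variation hcov m φ 0 = fun t ↦ ⟨γ.q t, γ.a t, γ.p t⟩ :=
    funext fun t ↦ Λ.variation_eq hcov m (Or.inl rfl)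
  unfold family
  rw [h]

/-- At ε = 0 the points lie in the open domain, so compactness of the support of φ gives a common
width. Off the support φ vanishes and ε plays no role. -/
theorem exists_width (hγ : IsPairPath L t₀ t₁ γ) (hφ : IsCutoff φ (Λ.times ∩ Ioo t₀ t₁)) :
    ∃ δ > (0 : ℝ), ∀ ε ∈ Ioo (-δ) δ, ∀ t ∈ Icc t₀ t₁ ∩ Λ.times,
      (ε * φ t, (baseCoord E x₀ γ t, fstCoord F x₀ γ t)) ∈ Λ.dom := by
  have h1 : ∀ᶠ ε in 𝓝 (0 : ℝ), ∀ t ∈ tsupport φ,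
      (ε * φ t, (baseCoord E x₀ γ t, fstCoord F x₀ γ t)) ∈ Λ.dom := by
    refine IsCompact.eventually_forall_of_forall_eventually hφ.hasCompactSupport fun t ht ↦ ?_
    have htT : t ∈ Icc t₀ t₁ ∩ Λ.times :=
      ⟨Ioo_subset_Icc_self (hφ.tsupport_subset ht).2, (hφ.tsupport_subset ht).1⟩
    have hn : Icc t₀ t₁ ∩ Λ.times ∈ 𝓝 t :=
      inter_mem (Icc_mem_nhds (hφ.tsupport_subset ht).2.1 (hφ.tsupport_subset ht).2.2)
        (Λ.isOpen_times.mem_nhds htT.2)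
    have hc : ContinuousAt (fun z : ℝ × ℝ ↦
        (z.1 * φ z.2, (baseCoord E x₀ γ z.2, fstCoord F x₀ γ z.2))) (0, t) := by
      refine ContinuousAt.prodMk ?_ ?_
      · exact (continuous_fst.mul (hφ.contDiff.continuous.comp continuous_snd)).continuousAt
      · exact ContinuousAt.comp (x := ((0 : ℝ), t)) (f := Prod.snd)
          ((Λ.contDiffOn_coord_fst hγ).continuousOn.continuousAt hn) continuousAt_snd
    refine hc (Λ.isOpen_dom.mem_nhds ?_)
    change (0 * φ t, _) ∈ _
    rw [zero_mul]
    exact Λ.times_mem t htT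
  obtain ⟨δ, hδ, h⟩ := Metric.eventually_nhds_iff.1 h1
  refine ⟨δ, hδ, fun ε hε t ht ↦ ?_⟩
  by_cases hts : t ∈ tsupport φ
  · exact h (by rw [Real.dist_eq, sub_zero, abs_lt]; exact hε) t hts
  · rw [image_eq_zero_of_notMem_tsupport hts, mul_zero]
    exact Λ.times_mem t ht

/-- At times of Λ the two branches of the definition have the same coordinate formula, because the
flow at parameter 0 is the identity and φ, φ' vanish off the support. Regularity can therefore be
read off this formula alone. -/
theorem coord_family {ε t : ℝ} (ht : t ∈ Icc t₀ t₁ ∩ Λ.times)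
    (hd : (ε * φ t, (baseCoord E x₀ γ t, fstCoord F x₀ γ t)) ∈ Λ.dom) :
    (Λ.family hcov m φ ε).q t ∈ Φ.dom ∧
    baseCoord E x₀ (Λ.family hcov m φ ε) t = (Λ.point φ ε t).1 ∧
    fstCoord F x₀ (Λ.family hcov m φ ε) t = Λ.newFst φ ε t ∧
    sndCoord F x₀ (Λ.family hcov m φ ε) t = Λ.newSnd hcov m φ ε t := by
  change (Λ.variation hcov m φ ε t).1 ∈ Φ.dom ∧
    extChartAt 𝓘(ℝ, E) x₀ (Λ.variation hcov m φ ε t).1 = _ ∧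
    fibCoord F x₀ (Λ.variation hcov m φ ε t).2.1 = _ ∧
    fibCoord (F →L[ℝ] ℝ) x₀ (Λ.variation hcov m φ ε t).2.2 = _
  by_cases h : ε = 0 ∨ t ∉ tsupport φ
  · rw [Λ.variation_eq hcov m h]
    have h1 : ε * φ t = 0 := by
      rcases h with h | h
      · rw [h, zero_mul]
      · rw [image_eq_zero_of_notMem_tsupport h, mul_zero]
    have h2 : ε * deriv φ t = 0 := by
      rcases h with h | h
      · rw [h, zero_mul]
      · rw [deriv_eq_zero_of_notMem_tsupport h, mul_zero]
    have h3 : Λ.point φ ε t = (baseCoord E x₀ γ t, fstCoord F x₀ γ t) := by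
      unfold point
      rw [h1, Λ.map_zero _ (Λ.times_mem t ht)]
    refine ⟨Λ.mem_of_times t ht, ?_, ?_, ?_⟩
    · rw [h3]; rfl
    · unfold newFst
      rw [h3, h2, zero_smul, add_zero]; rfl
    · unfold newSnd
      rw [h1, zero_smul, add_zero]; rfl
  · have h1 : Λ.variation hcov m φ ε t = ⟨(extChartAt 𝓘(ℝ, E) x₀).symm (Λ.point φ ε t).1,
      fibSymm F x₀ _ (Λ.newFst φ ε t), fibSymm (F →L[ℝ] ℝ) x₀ _ (Λ.newSnd hcov m φ ε t)⟩ :=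
      if_neg h
    rw [h1]
    have h2 : (Λ.point φ ε t).1 ∈ Φ.coordDom := Λ.map_mem _ hd
    have h3 : (extChartAt 𝓘(ℝ, E) x₀).symm (Λ.point φ ε t).1 ∈ Φ.dom := h2.2
    refine ⟨h3, (extChartAt 𝓘(ℝ, E) x₀).right_inv h2.1, ?_, ?_⟩
    · exact fibCoord_fibSymm (Φ.dom_subset h3) _
    · exact fibCoord_fibSymm (E := E) (by rw [coordSet_dual]; exact Φ.dom_subset h3) _

section Regularity

variable {δ : ℝ}

theorem contDiffOn_point (hγ : IsPairPath L t₀ t₁ γ) (hφ : IsCutoff φ (Λ.times ∩ Ioo t₀ t₁))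
    (hδ : ∀ ε ∈ Ioo (-δ) δ, ∀ t ∈ Icc t₀ t₁ ∩ Λ.times,
      (ε * φ t, (baseCoord E x₀ γ t, fstCoord F x₀ γ t)) ∈ Λ.dom) :
    ContDiffOn ℝ 1 (fun z : ℝ × ℝ ↦ Λ.point φ z.1 z.2)
      (Ioo (-δ) δ ×ˢ (Icc t₀ t₁ ∩ Λ.times)) := by
  refine Λ.contDiffOn_map.comp (ContDiffOn.prodMk ?_ ?_) fun z hz ↦ hδ z.1 hz.1 z.2 hz.2
  · exact (contDiff_fst.mul ((hφ.contDiff.of_le (by simp)).comp contDiff_snd)).contDiffOn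
  · exact (Λ.contDiffOn_coord_fst hγ).comp contDiffOn_snd fun z hz ↦ hz.2

theorem contDiffOn_newFst (hγ : IsPairPath L t₀ t₁ γ) (hφ : IsCutoff φ (Λ.times ∩ Ioo t₀ t₁))
    (hδ : ∀ ε ∈ Ioo (-δ) δ, ∀ t ∈ Icc t₀ t₁ ∩ Λ.times,
      (ε * φ t, (baseCoord E x₀ γ t, fstCoord F x₀ γ t)) ∈ Λ.dom) :
    ContDiffOn ℝ 1 (fun z : ℝ × ℝ ↦ Λ.newFst φ z.1 z.2)
      (Ioo (-δ) δ ×ˢ (Icc t₀ t₁ ∩ Λ.times)) :=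
  (Λ.contDiffOn_point hγ hφ hδ).snd.add
    ((contDiff_fst.mul (hφ.contDiff_deriv.comp contDiff_snd)).smul contDiff_const).contDiffOn

theorem contDiffOn_newSnd (hγ : IsPairPath L t₀ t₁ γ) (hφ : IsCutoff φ (Λ.times ∩ Ioo t₀ t₁)) :
    ContDiffOn ℝ 1 (fun z : ℝ × ℝ ↦ Λ.newSnd hcov m φ z.1 z.2)
      (Ioo (-δ) δ ×ˢ (Icc t₀ t₁ ∩ Λ.times)) := by
  have h1 : ContDiffOn ℝ 1 (fun z : ℝ × ℝ ↦ sndCoord F x₀ γ z.2)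
      (Ioo (-δ) δ ×ˢ (Icc t₀ t₁ ∩ Λ.times)) :=
    (Λ.contDiffOn_sndCoord hγ).comp contDiffOn_snd fun z hz ↦ hz.2
  have h2 : ContDiffOn ℝ 1 (fun z : ℝ × ℝ ↦ z.1 * φ z.2)
      (Ioo (-δ) δ ×ˢ (Icc t₀ t₁ ∩ Λ.times)) :=
    (contDiff_fst.mul ((hφ.contDiff.of_le (by simp)).comp contDiff_snd)).contDiffOn
  have h3 : ContDiffOn ℝ 1 (fun z : ℝ × ℝ ↦
      Φ.matrixCoord (Φ.nablaFamily L hcov u) (baseCoord E x₀ γ z.2))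
      (Ioo (-δ) δ ×ˢ (Icc t₀ t₁ ∩ Λ.times)) := by
    refine ((Φ.contDiffOn_matrixCoord (Φ.nablaFamily L hcov u)).of_le (by simp)).comp
      ((Λ.contDiffOn_coord_fst hγ).fst.comp contDiffOn_snd fun z hz ↦ hz.2) fun z hz ↦ ?_
    exact Φ.chart_mem_coordDom (Λ.mem_of_times z.2 hz.2)
  exact h1.add (h2.smul (contDiffOn_const.add (h1.clm_comp h3)))

end Regularity

end PathFlow

end Flow

/-! ### The varied paths form a homotopy -/

section Flow

variable {E : Type*} [NormedAddCommGroup E] [NormedSpace ℝ E] [FiniteDimensional ℝ E]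
  {Q : Type*} [TopologicalSpace Q] [T2Space Q] [ChartedSpace E Q] [IsManifold 𝓘(ℝ, E) ∞ Q]
  {F : Type*} [NormedAddCommGroup F] [NormedSpace ℝ F] [FiniteDimensional ℝ F]
  {A : Q → Type*} [TopologicalSpace (TotalSpace F A)]
  [∀ x, AddCommGroup (A x)] [∀ x, Module ℝ (A x)] [∀ x, TopologicalSpace (A x)]
  [∀ x, IsTopologicalAddGroup (A x)] [∀ x, ContinuousSMul ℝ (A x)]
  [FiberBundle F A] [VectorBundle ℝ F A] [ContMDiffVectorBundle ∞ F A 𝓘(ℝ, E)]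

namespace PathFlow

variable {L : LieAlgebroid E F A} {cov : CovariantDerivative 𝓘(ℝ, E) F A} {t₀ t₁ : ℝ}
  {γ : PairPath A} {x₀ : Q} {Φ : FrameAt E F A x₀} {u : F} (Λ : PathFlow L t₀ t₁ γ Φ u)
  (hcov : cov.ContMDiffCovariantDerivative ∞) (m : F →L[ℝ] ℝ) {φ : ℝ → ℝ} {δ : ℝ}

theorem eventually_variation_eq {ε t : ℝ} (ht : t ∉ tsupport φ) :
    ∀ᶠ z : ℝ × ℝ in 𝓝 (ε, t), Λ.variation hcov m φ z.1 z.2 = ⟨γ.q z.2, γ.a z.2, γ.p z.2⟩ := by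
  filter_upwards [continuousAt_snd.eventually
    (eventuallyEq_zero_of_notMem_tsupport (φ := φ) (t := (ε, t).2) ht)] with z hz
  exact Λ.variation_eq hcov m (Or.inr hz)

theorem prod_mem_nhdsWithin {ε t : ℝ} (ht : t ∈ Icc t₀ t₁ ∩ Λ.times) :
    Ioo (-δ) δ ×ˢ (Icc t₀ t₁ ∩ Λ.times) ∈ 𝓝[Ioo (-δ) δ ×ˢ Icc t₀ t₁] (ε, t) := by
  have h : univ ×ˢ Λ.times ∈ 𝓝 (ε, t) := (isOpen_univ.prod Λ.isOpen_times).mem_nhds ⟨trivial, ht.2⟩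
  filter_upwards [self_mem_nhdsWithin, mem_nhdsWithin_of_mem_nhds h] with z hz hz'
  exact ⟨hz.1, hz.2, hz'.2⟩

/-- At a time of Λ the coordinate formula applies. Any other time has a neighbourhood disjoint from
the closed support of φ, and there the family is the original path for every ε. -/
theorem contMDiffOn_family_fst (hγ : IsPairPath L t₀ t₁ γ)
    (hφ : IsCutoff φ (Λ.times ∩ Ioo t₀ t₁))
    (hδ : ∀ ε ∈ Ioo (-δ) δ, ∀ t ∈ Icc t₀ t₁ ∩ Λ.times,
      (ε * φ t, (baseCoord E x₀ γ t, fstCoord F x₀ γ t)) ∈ Λ.dom) :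
    ContMDiffOn 𝓘(ℝ, ℝ × ℝ) (𝓘(ℝ, E).prod 𝓘(ℝ, F)) 1
      (fun z : ℝ × ℝ ↦ TotalSpace.mk' F ((Λ.family hcov m φ z.1).q z.2)
        ((Λ.family hcov m φ z.1).a z.2)) (Ioo (-δ) δ ×ˢ Icc t₀ t₁) := by
  rintro ⟨ε, t⟩ ⟨hε, ht⟩
  by_cases htK : t ∈ Λ.times
  · refine ContMDiffWithinAt.mono_of_mem_nhdsWithin ?_ (Λ.prod_mem_nhdsWithin ⟨ht, htK⟩)
    refine contMDiffWithinAt_of_bundleCoord (x₀ := x₀) ⟨hε, ht, htK⟩ ?_ ?_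
    · filter_upwards [self_mem_nhdsWithin] with z hz
      exact Φ.dom_subset (Λ.coord_family hcov m hz.2 (hδ _ hz.1 _ hz.2)).1
    · have h := ((Λ.contDiffOn_point hγ hφ hδ).fst.prodMk (Λ.contDiffOn_newFst hγ hφ hδ))
        (ε, t) ⟨hε, ht, htK⟩
      refine h.contMDiffWithinAt.congr_of_mem (fun z hz ↦ ?_) ⟨hε, ht, htK⟩
      obtain ⟨-, h1, h2, -⟩ := Λ.coord_family hcov m hz.2 (hδ _ hz.1 _ hz.2)
      exact Prod.ext h1 h2
  · have hts : t ∉ tsupport φ := fun h ↦ htK (hφ.tsupport_subset h).1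
    have h1 : ContMDiffWithinAt 𝓘(ℝ, ℝ × ℝ) (𝓘(ℝ, E).prod 𝓘(ℝ, F)) 1
        (fun z : ℝ × ℝ ↦ TotalSpace.mk' F (γ.q z.2) (γ.a z.2)) (Ioo (-δ) δ ×ˢ Icc t₀ t₁) (ε, t) :=
      ContMDiffWithinAt.comp (t := Icc t₀ t₁) (f := Prod.snd) (I' := 𝓘(ℝ, ℝ)) (ε, t)
        (hγ.fst t ht) (contDiff_snd (𝕜 := ℝ) (n := 1)).contMDiff.contMDiffAt.contMDiffWithinAt fun z hz ↦ hz.2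
    refine h1.congr_of_eventuallyEq_of_mem ?_ ⟨hε, ht⟩
    filter_upwards [mem_nhdsWithin_of_mem_nhds
      (Λ.eventually_variation_eq hcov m (ε := ε) hts)] with z hz
    exact congrArg (fun c : Σ x : Q, A x × Dual A x ↦ TotalSpace.mk' F c.1 c.2.1) hz

theorem contMDiffOn_family_snd (hγ : IsPairPath L t₀ t₁ γ)
    (hφ : IsCutoff φ (Λ.times ∩ Ioo t₀ t₁))
    (hδ : ∀ ε ∈ Ioo (-δ) δ, ∀ t ∈ Icc t₀ t₁ ∩ Λ.times,
      (ε * φ t, (baseCoord E x₀ γ t, fstCoord F x₀ γ t)) ∈ Λ.dom) :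
    ContMDiffOn 𝓘(ℝ, ℝ × ℝ) (𝓘(ℝ, E).prod 𝓘(ℝ, F →L[ℝ] ℝ)) 1
      (fun z : ℝ × ℝ ↦ TotalSpace.mk' (F →L[ℝ] ℝ) ((Λ.family hcov m φ z.1).q z.2)
        ((Λ.family hcov m φ z.1).p z.2)) (Ioo (-δ) δ ×ˢ Icc t₀ t₁) := by
  rintro ⟨ε, t⟩ ⟨hε, ht⟩
  by_cases htK : t ∈ Λ.times
  · refine ContMDiffWithinAt.mono_of_mem_nhdsWithin ?_ (Λ.prod_mem_nhdsWithin ⟨ht, htK⟩)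
    refine contMDiffWithinAt_of_bundleCoord (x₀ := x₀) ⟨hε, ht, htK⟩ ?_ ?_
    · filter_upwards [self_mem_nhdsWithin] with z hz
      rw [coordSet_dual]
      exact Φ.dom_subset (Λ.coord_family hcov m hz.2 (hδ _ hz.1 _ hz.2)).1
    · have h := ((Λ.contDiffOn_point hγ hφ hδ).fst.prodMk (Λ.contDiffOn_newSnd hcov m hγ hφ))
        (ε, t) ⟨hε, ht, htK⟩
      refine h.contMDiffWithinAt.congr_of_mem (fun z hz ↦ ?_) ⟨hε, ht, htK⟩
      obtain ⟨-, h1, -, h2⟩ := Λ.coord_family hcov m hz.2 (hδ _ hz.1 _ hz.2)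
      exact Prod.ext h1 h2
  · have hts : t ∉ tsupport φ := fun h ↦ htK (hφ.tsupport_subset h).1
    have h1 : ContMDiffWithinAt 𝓘(ℝ, ℝ × ℝ) (𝓘(ℝ, E).prod 𝓘(ℝ, F →L[ℝ] ℝ)) 1
        (fun z : ℝ × ℝ ↦ TotalSpace.mk' (F →L[ℝ] ℝ) (γ.q z.2) (γ.p z.2))
        (Ioo (-δ) δ ×ˢ Icc t₀ t₁) (ε, t) :=
      ContMDiffWithinAt.comp (t := Icc t₀ t₁) (f := Prod.snd) (I' := 𝓘(ℝ, ℝ)) (ε, t)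
        (hγ.snd t ht) (contDiff_snd (𝕜 := ℝ) (n := 1)).contMDiff.contMDiffAt.contMDiffWithinAt fun z hz ↦ hz.2
    refine h1.congr_of_eventuallyEq_of_mem ?_ ⟨hε, ht⟩
    filter_upwards [mem_nhdsWithin_of_mem_nhds
      (Λ.eventually_variation_eq hcov m (ε := ε) hts)] with z hz
    exact congrArg (fun c : Σ x : Q, A x × Dual A x ↦ TotalSpace.mk' (F →L[ℝ] ℝ) c.1 c.2.2) hz

/-- This is the chain rule with flow parameter ε φ(t): its velocity r = ε φ'(t) produces exactly the
translation built into `newFst`. -/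
theorem hasDerivWithinAt_point (hγ : IsPairPath L t₀ t₁ γ)
    (hφ : IsCutoff φ (Λ.times ∩ Ioo t₀ t₁)) {ε t : ℝ} (ht : t ∈ Icc t₀ t₁ ∩ Λ.times)
    (hd : (ε * φ t, (baseCoord E x₀ γ t, fstCoord F x₀ γ t)) ∈ Λ.dom) :
    HasDerivWithinAt (fun s ↦ (Λ.point φ ε s).1)
      (Φ.anchorCoord L (Λ.point φ ε t).1 (Λ.newFst φ ε t)) (Icc t₀ t₁ ∩ Λ.times) t := by
  have h1 := ((Λ.contDiffOn_map.contDiffAt (Λ.isOpen_dom.mem_nhds hd)).differentiableAt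
    (by simp)).hasFDerivAt
  have h2 := (((Λ.contDiffOn_coord_fst hγ).snd t ht).differentiableWithinAt
    (by simp)).hasDerivWithinAt
  have h3 : HasDerivWithinAt (fun s ↦ ε * φ s) (ε * deriv φ t) (Icc t₀ t₁ ∩ Λ.times) t :=
    (((hφ.contDiff.differentiable (by simp)) t).hasDerivAt.const_mul ε).hasDerivWithinAt
  have h4 := h1.comp_hasDerivWithinAt t (h3.prodMk ((Λ.hasDerivWithinAt_baseCoord hγ ht).prodMk h2))
  exact ((ContinuousLinearMap.fst ℝ E F).hasFDerivAt.comp_hasDerivWithinAt t h4).congr_deriv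
    (Λ.fderiv_map_anchor _ hd _ _)

/-- The flow map is only known to be C¹, but the base path has derivative ρ(a) with a of class C¹.
The anchor relation thus supplies the second derivative. -/
theorem contDiffOn_point_base (htt : t₀ < t₁) (hγ : IsPairPath L t₀ t₁ γ)
    (hφ : IsCutoff φ (Λ.times ∩ Ioo t₀ t₁))
    (hδ : ∀ ε ∈ Ioo (-δ) δ, ∀ t ∈ Icc t₀ t₁ ∩ Λ.times,
      (ε * φ t, (baseCoord E x₀ γ t, fstCoord F x₀ γ t)) ∈ Λ.dom) {ε : ℝ} (hε : ε ∈ Ioo (-δ) δ) :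
    ContDiffOn ℝ 2 (fun s ↦ (Λ.point φ ε s).1) (Icc t₀ t₁ ∩ Λ.times) := by
  have hsl : ContDiffOn ℝ 1 (fun s : ℝ ↦ (ε, s)) (Icc t₀ t₁ ∩ Λ.times) :=
    (contDiff_const.prodMk contDiff_id).contDiffOn
  have hm : MapsTo (fun s : ℝ ↦ (ε, s)) (Icc t₀ t₁ ∩ Λ.times)
      (Ioo (-δ) δ ×ˢ (Icc t₀ t₁ ∩ Λ.times)) := fun s hs ↦ ⟨hε, hs⟩
  have h1 := ((Λ.contDiffOn_point hγ hφ hδ).comp hsl hm).fst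
  have h2 := (Λ.contDiffOn_newFst hγ hφ hδ).comp hsl hm
  have h3 : ContDiffOn ℝ 1 (fun s ↦ Φ.anchorCoord L (Λ.point φ ε s).1 (Λ.newFst φ ε s))
      (Icc t₀ t₁ ∩ Λ.times) :=
    (((Φ.contDiffOn_anchorCoord L).of_le (by simp)).comp h1
      fun s hs ↦ Λ.map_mem _ (hδ ε hε s hs)).clm_apply h2
  have h4 : ∀ s ∈ Icc t₀ t₁ ∩ Λ.times, _ := fun s hs ↦
    Λ.hasDerivWithinAt_point hγ hφ hs (hδ ε hε s hs)
  rw [show (2 : WithTop ℕ∞) = 1 + 1 by norm_num,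
    contDiffOn_succ_iff_derivWithin (Λ.uniqueDiffOn htt)]
  refine ⟨fun s hs ↦ (h4 s hs).differentiableWithinAt, by simp, h3.congr fun s hs ↦ ?_⟩
  exact (h4 s hs).derivWithin (Λ.uniqueDiffOn htt s hs)

theorem contMDiffOn_family_base (htt : t₀ < t₁) (hγ : IsPairPath L t₀ t₁ γ)
    (hφ : IsCutoff φ (Λ.times ∩ Ioo t₀ t₁))
    (hδ : ∀ ε ∈ Ioo (-δ) δ, ∀ t ∈ Icc t₀ t₁ ∩ Λ.times,
      (ε * φ t, (baseCoord E x₀ γ t, fstCoord F x₀ γ t)) ∈ Λ.dom) {ε : ℝ} (hε : ε ∈ Ioo (-δ) δ) :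
    ContMDiffOn 𝓘(ℝ, ℝ) 𝓘(ℝ, E) 2 (Λ.family hcov m φ ε).q (Icc t₀ t₁) := by
  intro t ht
  by_cases htK : t ∈ Λ.times
  · have hT : t ∈ Icc t₀ t₁ ∩ Λ.times := ⟨ht, htK⟩
    have h1 : ContMDiffWithinAt 𝓘(ℝ, ℝ) 𝓘(ℝ, E) 2 (fun s ↦ (Λ.point φ ε s).1)
        (Icc t₀ t₁ ∩ Λ.times) t :=
      (Λ.contDiffOn_point_base htt hγ hφ hδ hε t hT).contMDiffWithinAt
    have h2 : ContMDiffAt 𝓘(ℝ, E) 𝓘(ℝ, E) 2 (extChartAt 𝓘(ℝ, E) x₀).symm (Λ.point φ ε t).1 := by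
      have h3 : ContMDiffAt 𝓘(ℝ, E) 𝓘(ℝ, E) ∞ (extChartAt 𝓘(ℝ, E) x₀).symm (Λ.point φ ε t).1 :=
        (contMDiffOn_extChartAt_symm x₀).contMDiffAt ((isOpen_extChartAt_target x₀).mem_nhds
          (Λ.map_mem _ (hδ ε hε t hT)).1)
      exact h3.of_le two_le_infty
    have h3 := ContMDiffAt.comp_contMDiffWithinAt t (f := fun s ↦ (Λ.point φ ε s).1) h2 h1
    refine ContMDiffWithinAt.mono_of_mem_nhdsWithin ?_
      (show Icc t₀ t₁ ∩ Λ.times ∈ 𝓝[Icc t₀ t₁] t by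
        rw [← Λ.nhdsWithin_eq hT]; exact self_mem_nhdsWithin)
    refine h3.congr_of_mem (fun s hs ↦ ?_) hT
    obtain ⟨h4, h5, -, -⟩ := Λ.coord_family hcov m hs (hδ ε hε s hs)
    change _ = (extChartAt 𝓘(ℝ, E) x₀).symm (Λ.point φ ε s).1
    rw [← h5]
    exact ((extChartAt 𝓘(ℝ, E) x₀).left_inv (Φ.mem_source h4)).symm
  · have hts : t ∉ tsupport φ := fun h ↦ htK (hφ.tsupport_subset h).1
    refine (hγ.base t ht).congr_of_eventuallyEq_of_mem ?_ ht
    filter_upwards [mem_nhdsWithin_of_mem_nhds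
      (eventuallyEq_zero_of_notMem_tsupport hts)] with s hs
    exact congrArg Sigma.fst (Λ.variation_eq hcov m (ε := ε) (Or.inr hs))

/-- Both sides are compared through the injective derivative of the chart at times of Λ. Elsewhere
the path coincides locally with γ. -/
theorem anchor_family (htt : t₀ < t₁) (hγ : IsPairPath L t₀ t₁ γ)
    (hφ : IsCutoff φ (Λ.times ∩ Ioo t₀ t₁))
    (hδ : ∀ ε ∈ Ioo (-δ) δ, ∀ t ∈ Icc t₀ t₁ ∩ Λ.times,
      (ε * φ t, (baseCoord E x₀ γ t, fstCoord F x₀ γ t)) ∈ Λ.dom) {ε : ℝ} (hε : ε ∈ Ioo (-δ) δ)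
    {t : ℝ} (ht : t ∈ Icc t₀ t₁) :
    mfderivWithin 𝓘(ℝ, ℝ) 𝓘(ℝ, E) (Λ.family hcov m φ ε).q (Icc t₀ t₁) t (1 : ℝ) =
      L.anchor ((Λ.family hcov m φ ε).q t) ((Λ.family hcov m φ ε).a t) := by
  by_cases htK : t ∈ Λ.times
  · have hT : t ∈ Icc t₀ t₁ ∩ Λ.times := ⟨ht, htK⟩
    obtain ⟨h1, h2, h3, -⟩ := Λ.coord_family hcov m hT (hδ ε hε t hT)
    have h4 := (hasDerivWithinAt_chart (x₀ := x₀)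
      ((Λ.contMDiffOn_family_base hcov m htt hγ hφ hδ hε t ht).mdifferentiableWithinAt (by simp))
      (Φ.dom_subset h1).1).mono (inter_subset_left (t := Λ.times))
    have h5 := (Λ.hasDerivWithinAt_point hγ hφ hT (hδ ε hε t hT)).congr_of_mem
      (f₁ := baseCoord E x₀ (Λ.family hcov m φ ε))
      (fun s hs ↦ (Λ.coord_family hcov m hs (hδ ε hε s hs)).2.1) hT
    have h6 := (Λ.uniqueDiffOn htt t hT).eq_deriv _ h4 h5
    refine chartDeriv_injective (E := E) (Φ.dom_subset h1).1 ?_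
    rw [Φ.chartDeriv_anchor L h1]
    refine h6.trans ?_
    rw [← h2, ← h3]
    rfl
  · have hts : t ∉ tsupport φ := fun h ↦ htK (hφ.tsupport_subset h).1
    have h1 : (Λ.family hcov m φ ε).q =ᶠ[𝓝[Icc t₀ t₁] t] γ.q := by
      filter_upwards [mem_nhdsWithin_of_mem_nhds
        (eventuallyEq_zero_of_notMem_tsupport hts)] with s hs
      exact congrArg Sigma.fst (Λ.variation_eq hcov m (ε := ε) (Or.inr hs))
    have h2 : (mfderivWithin 𝓘(ℝ, ℝ) 𝓘(ℝ, E) (Λ.family hcov m φ ε).q (Icc t₀ t₁) t :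
        ℝ →L[ℝ] E) = mfderivWithin 𝓘(ℝ, ℝ) 𝓘(ℝ, E) γ.q (Icc t₀ t₁) t :=
      h1.mfderivWithin_eq (h1.self_of_nhdsWithin ht)
    refine (congrArg (fun T : ℝ →L[ℝ] E ↦ T 1) h2).trans ?_
    refine (hγ.anchor t ht).trans ?_
    exact (congrArg (fun c : Σ x : Q, A x × Dual A x ↦ (L.anchor c.1 c.2.1 : E))
      (Λ.variation_eq hcov m (ε := ε) (Or.inr hts))).symm

theorem isHomotopy_family (htt : t₀ < t₁) (hγ : IsPairPath L t₀ t₁ γ)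
    (hφ : IsCutoff φ (Λ.times ∩ Ioo t₀ t₁)) :
    IsHomotopy L t₀ t₁ (Λ.family hcov m φ) := by
  obtain ⟨δ, hδ0, hδ⟩ := Λ.exists_width hγ hφ
  have h1 := Λ.contMDiffOn_family_fst hcov m hγ hφ hδ
  have h2 := Λ.contMDiffOn_family_snd hcov m hγ hφ hδ
  refine ⟨δ, hδ0, fun ε hε ↦ ?_, h1, h2⟩
  have hsl : ContMDiffOn 𝓘(ℝ, ℝ) 𝓘(ℝ, ℝ × ℝ) 1 (fun s : ℝ ↦ (ε, s)) (Icc t₀ t₁) :=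
    (contDiff_const.prodMk contDiff_id).contMDiff.contMDiffOn
  have hm : MapsTo (fun s : ℝ ↦ (ε, s)) (Icc t₀ t₁) (Ioo (-δ) δ ×ˢ Icc t₀ t₁) :=
    fun s hs ↦ ⟨hε, hs⟩
  exact ⟨Λ.contMDiffOn_family_base hcov m htt hγ hφ hδ hε, h1.comp hsl hm, h2.comp hsl hm,
    fun t ht ↦ Λ.anchor_family hcov m htt hγ hφ hδ hε ht⟩

end PathFlow

end Flow

/-! ### Velocities of the varied paths -/

section Critical

variable {E : Type*} [NormedAddCommGroup E] [NormedSpace ℝ E] [FiniteDimensional ℝ E]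
  {Q : Type*} [TopologicalSpace Q] [T2Space Q] [ChartedSpace E Q] [IsManifold 𝓘(ℝ, E) ∞ Q]
  {F : Type*} [NormedAddCommGroup F] [NormedSpace ℝ F] [FiniteDimensional ℝ F]

section General

variable {V : Q → Type*} [TopologicalSpace (TotalSpace F V)]
  [∀ x, AddCommGroup (V x)] [∀ x, Module ℝ (V x)] [∀ x, TopologicalSpace (V x)]
  [∀ x, IsTopologicalAddGroup (V x)] [∀ x, ContinuousSMul ℝ (V x)]
  [FiberBundle F V] [VectorBundle ℝ F V] [ContMDiffVectorBundle ∞ F V 𝓘(ℝ, E)]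

/-- The coordinate expression of a smooth function on the total space. -/
theorem exists_coord_function {H : TotalSpace F V → ℝ}
    (hH : ContMDiff (𝓘(ℝ, E).prod 𝓘(ℝ, F)) 𝓘(ℝ, ℝ) ∞ H) (x₀ : Q) :
    ∃ (U : Set (E × F)) (h : E × F → ℝ), IsOpen U ∧ ContDiffOn ℝ ∞ h U ∧
      ∀ z : TotalSpace F V, z.proj ∈ coordSet E F V x₀ → bundleCoord E x₀ z ∈ U ∧
        ∀ v : TangentSpace (𝓘(ℝ, E).prod 𝓘(ℝ, F)) z, mvfderiv (𝓘(ℝ, E).prod 𝓘(ℝ, F)) H z v =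
          fderiv ℝ h (bundleCoord E x₀ z) (coordDeriv E x₀ z v) := by
  let e := extChartAt (𝓘(ℝ, E).prod 𝓘(ℝ, F)) (TotalSpace.mk' F x₀ (0 : V x₀))
  have hU : IsOpen e.target := isOpen_extChartAt_target _
  have hh : ContDiffOn ℝ ∞ (fun y ↦ H (e.symm y)) e.target := by
    rw [← contMDiffOn_iff_contDiffOn]
    exact hH.comp_contMDiffOn (contMDiffOn_extChartAt_symm (n := ∞) (TotalSpace.mk' F x₀ (0 : V x₀)))
  refine ⟨e.target, fun y ↦ H (e.symm y), hU, hh, fun z hz ↦ ?_⟩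
  have hzs : z ∈ e.source := mem_extChartAt_zero_source.2 hz
  have hz1 : e z = bundleCoord E x₀ z := extChartAt_zero_eq hz
  have hzU : bundleCoord E x₀ z ∈ e.target := hz1 ▸ e.map_source hzs
  refine ⟨hzU, fun v ↦ ?_⟩
  have h1 : DifferentiableAt ℝ (fun y ↦ H (e.symm y)) (bundleCoord E x₀ z) :=
    (hh.contDiffAt (hU.mem_nhds hzU)).differentiableAt (by simp)
  have h2 := mvfderiv_comp_eq (g := fun y ↦ H (e.symm y)) h1.mdifferentiableAt
    (mdifferentiableAt_bundleCoord hz) v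
  have h3 : mvfderiv (𝓘(ℝ, E).prod 𝓘(ℝ, F)) H z v =
      mvfderiv (𝓘(ℝ, E).prod 𝓘(ℝ, F)) (fun y ↦ H (e.symm (bundleCoord E x₀ y))) z v := by
    refine mvfderiv_congr_of_eventuallyEq ?_ v
    filter_upwards [extChartAt_zero_eventuallyEq hz,
      (isOpen_extChartAt_source (I := 𝓘(ℝ, E).prod 𝓘(ℝ, F))
        (TotalSpace.mk' F x₀ (0 : V x₀))).mem_nhds hzs] with y hy hy'
    rw [hy]
    exact congrArg H (e.left_inv hy').symm
  rw [h3, h2]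
  change mfderiv 𝓘(ℝ, E × F) 𝓘(ℝ, ℝ) _ _ _ = _
  rw [mfderiv_eq_fderiv]
  rfl

theorem extendsNear_smul {t₀ t₁ : ℝ} {q : ℝ → Q} (σ : Sec E F V) {f : ℝ → ℝ} {t : ℝ}
    (ht : t ∈ Icc t₀ t₁) (hf : ContDiff ℝ 1 f) :
    ExtendsNear t₀ t₁ q (fun s ↦ f s • σ (q s)) t (fun s ↦ f s • σ) := by
  refine ⟨contMDiffWithinAt_smul_sec_comp σ (f := fun z : ℝ × Q ↦ f z.1) (g := Prod.snd)
    ⟨ht, trivial⟩ ?_ contMDiffWithinAt_snd, Eventually.of_forall fun s ↦ rfl⟩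
  exact (hf.contMDiff.comp contMDiff_fst).contMDiffAt.contMDiffWithinAt

theorem isC1Along_smul {t₀ t₁ : ℝ} {q : ℝ → Q} (σ : Sec E F V) {f : ℝ → ℝ}
    (hf : ContDiff ℝ 1 f) (hq : ContMDiffOn 𝓘(ℝ, ℝ) 𝓘(ℝ, E) 1 q (Icc t₀ t₁)) :
    IsC1Along E F t₀ t₁ q (fun s ↦ f s • σ (q s)) := fun t ht ↦
  contMDiffWithinAt_smul_sec_comp σ ht hf.contMDiff.contMDiffAt.contMDiffWithinAt (hq t ht)

end General

variable {A : Q → Type*} [TopologicalSpace (TotalSpace F A)]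
  [∀ x, AddCommGroup (A x)] [∀ x, Module ℝ (A x)] [∀ x, TopologicalSpace (A x)]
  [∀ x, IsTopologicalAddGroup (A x)] [∀ x, ContinuousSMul ℝ (A x)]
  [FiberBundle F A] [VectorBundle ℝ F A] [ContMDiffVectorBundle ∞ F A 𝓘(ℝ, E)]
  {L : LieAlgebroid E F A} {cov : CovariantDerivative 𝓘(ℝ, E) F A} {t₀ t₁ : ℝ}

/-- The path is extended by the time-dependent section f(s) σ, so f' comes from the time derivative
and f(t) is a constant factor in ∇̄. -/
theorem isBarNablaAlong_smul (htt : t₀ < t₁) {q : ℝ → Q} {a : ∀ t, A (q t)} {t : ℝ}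
    (ht : t ∈ Icc t₀ t₁) {X : Sec E F A} (hX : X (q t) = a t) (σ : Sec E F A) {f : ℝ → ℝ}
    (hf : ContDiff ℝ 1 f) : IsBarNablaAlong L cov t₀ t₁ q a (fun s ↦ f s • σ (q s)) t
      (deriv f t • σ (q t) + f t • barNabla L cov X σ (q t)) := by
  refine ⟨X, fun s ↦ f s • σ, hX, extendsNear_smul σ ht hf, ?_⟩
  have h1 : derivWithin (fun s ↦ (f s • σ) (q t)) (Icc t₀ t₁) t = deriv f t • σ (q t) :=
    derivWithin_smul_fibre (mem_coordSet_self (E := E) (F := F) (V := A) (q t)) _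
      (uniqueDiffOn_Icc htt t ht)
      ((hf.differentiable (by simp)) t).hasDerivAt.hasDerivWithinAt
  rw [h1, barNabla_smul_right]

/-- Recognizes the horizontal and vertical parts of a velocity from ε-derivatives of coordinates, by
injectivity of `coordDeriv`. -/
theorem velFst_eq {Γ : ℝ → PairPath A} (hΓ : IsHomotopy L t₀ t₁ Γ) {t : ℝ} (ht : t ∈ Icc t₀ t₁)
    {x₀ : Q} (Φ : FrameAt E F A x₀) (hx : (Γ 0).q t ∈ Φ.dom)
    {v : TangentSpace 𝓘(ℝ, E) ((Γ 0).q t)} {w : A ((Γ 0).q t)}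
    (h1 : HasDerivAt (fun ε ↦ baseCoord E x₀ (Γ ε) t) (chartDeriv x₀ _ v) 0)
    (h2 : HasDerivAt (fun ε ↦ fstCoord F x₀ (Γ ε) t) (fibCoord F x₀ w -
      fibCoord F x₀ (cov (fun y ↦ Φ.sec (fstCoord F x₀ (Γ 0) t) y) _ v)) 0) :
    velFst Γ t = horLift cov ((Γ 0).a t) v + vertLift E F ((Γ 0).a t) w := by
  have hxc := Φ.dom_subset hx
  refine coordDeriv_injective (E := E) (z := TotalSpace.mk' F ((Γ 0).q t) ((Γ 0).a t)) hxc ?_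
  have h3 := hasDerivAt_bundleCoord (x₀ := x₀) (hΓ.mdifferentiableAt_fst ht) hxc
  refine (h3.unique (h1.prodMk h2)).trans ?_
  refine Eq.trans ?_ ((coordDeriv E x₀ (TotalSpace.mk' F _ ((Γ 0).a t))).map_add _ _).symm
  rw [Φ.coordDeriv_horLift_sec cov hx, coordDeriv_vertLift hxc, Prod.mk_add_mk, add_zero,
    neg_add_eq_sub]
  rfl

theorem velSnd_eq {Γ : ℝ → PairPath A} (hΓ : IsHomotopy L t₀ t₁ Γ) {t : ℝ} (ht : t ∈ Icc t₀ t₁)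
    {x₀ : Q} (Φ : FrameAt E F A x₀) (hx : (Γ 0).q t ∈ Φ.dom)
    {v : TangentSpace 𝓘(ℝ, E) ((Γ 0).q t)} {r : Dual A ((Γ 0).q t)} {D : F →L[ℝ] ℝ}
    (h1 : HasDerivAt (fun ε ↦ baseCoord E x₀ (Γ ε) t) (chartDeriv x₀ _ v) 0)
    (h2 : HasDerivAt (fun ε ↦ sndCoord F x₀ (Γ ε) t) D 0)
    (hD : ∀ c, D c = (Γ 0).p t (cov (fun y ↦ Φ.sec c y) _ v) + fibCoord (F →L[ℝ] ℝ) x₀ r c) :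
    velSnd Γ t = horLift (dualCov cov) ((Γ 0).p t) v +
      vertLift E (F →L[ℝ] ℝ) ((Γ 0).p t) r := by
  have hxc : (Γ 0).q t ∈ coordSet E (F →L[ℝ] ℝ) (Dual A) x₀ := by
    rw [coordSet_dual]; exact Φ.dom_subset hx
  refine coordDeriv_injective (E := E)
    (z := TotalSpace.mk' (F →L[ℝ] ℝ) ((Γ 0).q t) ((Γ 0).p t)) hxc ?_
  have h3 := hasDerivAt_bundleCoord (x₀ := x₀) (hΓ.mdifferentiableAt_snd ht) hxc
  refine (h3.unique (h1.prodMk h2)).trans ?_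
  refine Eq.trans ?_ ((coordDeriv E x₀
    (TotalSpace.mk' (F →L[ℝ] ℝ) _ ((Γ 0).p t))).map_add _ _).symm
  rw [coordDeriv_vertLift hxc]
  obtain ⟨h4, h5⟩ := Φ.coordDeriv_horLift_dual cov hx ((Γ 0).p t) v
  refine Prod.ext ?_ (ContinuousLinearMap.ext fun c ↦ ?_)
  · rw [Prod.fst_add, h4, add_zero]
  · rw [Prod.snd_add, add_apply, h5]
    exact hD c

namespace PathFlow

variable {γ : PairPath A} {x₀ : Q} {Φ : FrameAt E F A x₀} {u : F} (Λ : PathFlow L t₀ t₁ γ Φ u)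

theorem hasDerivAt_point {φ : ℝ → ℝ} {t : ℝ} (ht : t ∈ Icc t₀ t₁ ∩ Λ.times) :
    HasDerivAt (fun ε ↦ Λ.point φ ε t) (φ t • (Φ.anchorCoord L (baseCoord E x₀ γ t) u,
      Φ.matrixCoord (Φ.bracketFamily L u) (baseCoord E x₀ γ t) (fstCoord F x₀ γ t))) 0 := by
  set z := (baseCoord E x₀ γ t, fstCoord F x₀ γ t) with hz
  have h0 : (0, z) ∈ Λ.dom := Λ.times_mem t ht
  have h1 : HasFDerivAt Λ.map (fderiv ℝ Λ.map (0, z)) (0 * φ t, z) := by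
    rw [zero_mul]
    exact ((Λ.contDiffOn_map.contDiffAt (Λ.isOpen_dom.mem_nhds h0)).differentiableAt
      (by simp)).hasFDerivAt
  have h2 : HasDerivAt (fun ε : ℝ ↦ (ε * φ t, z)) (1 * φ t, 0) 0 :=
    ((hasDerivAt_id (0 : ℝ)).mul_const (φ t)).prodMk (hasDerivAt_const 0 z)
  refine (h1.comp_hasDerivAt (0 : ℝ) h2).congr_deriv ?_
  rw [← Λ.fderiv_map_zero z h0, ← map_smul]
  simp

/-- The varied paths, with the derivatives of their coordinates. -/
theorem exists_homotopy (hcov : cov.ContMDiffCovariantDerivative ∞) (m : F →L[ℝ] ℝ) {φ : ℝ → ℝ}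
    (htt : t₀ < t₁) (hγ : IsPairPath L t₀ t₁ γ) (hφ : IsCutoff φ (Λ.times ∩ Ioo t₀ t₁)) :
    ∃ Γ : ℝ → PairPath A, Γ 0 = γ ∧ IsHomotopy L t₀ t₁ Γ ∧
      (∀ t ∉ tsupport φ, ∀ ε, (⟨(Γ ε).q t, (Γ ε).a t, (Γ ε).p t⟩ : Σ x : Q, A x × Dual A x) =
        ⟨γ.q t, γ.a t, γ.p t⟩) ∧
      ∀ t ∈ Icc t₀ t₁ ∩ Λ.times,
        HasDerivAt (fun ε ↦ baseCoord E x₀ (Γ ε) t)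
          (φ t • Φ.anchorCoord L (baseCoord E x₀ γ t) u) 0 ∧
        HasDerivAt (fun ε ↦ fstCoord F x₀ (Γ ε) t) (φ t • Φ.matrixCoord (Φ.bracketFamily L u)
          (baseCoord E x₀ γ t) (fstCoord F x₀ γ t) + deriv φ t • u) 0 ∧
        HasDerivAt (fun ε ↦ sndCoord F x₀ (Γ ε) t) (φ t • (m + (sndCoord F x₀ γ t).comp
          (Φ.matrixCoord (Φ.nablaFamily L hcov u) (baseCoord E x₀ γ t)))) 0 := by
  refine ⟨Λ.family hcov m φ, Λ.family_zero hcov m, Λ.isHomotopy_family hcov m htt hγ hφ,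
    fun t ht ε ↦ Λ.variation_eq hcov m (Or.inr ht), fun t ht ↦ ?_⟩
  obtain ⟨δ, hδ0, hδ⟩ := Λ.exists_width hγ hφ
  have hev : ∀ᶠ ε in 𝓝 (0 : ℝ), ε ∈ Ioo (-δ) δ := Ioo_mem_nhds (neg_lt_zero.2 hδ0) hδ0
  have hp := Λ.hasDerivAt_point (φ := φ) ht
  have hid := hasDerivAt_id (0 : ℝ)
  have hp1 : HasDerivAt (fun ε ↦ (Λ.point φ ε t).1)
      (φ t • Φ.anchorCoord L (baseCoord E x₀ γ t) u) 0 :=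
    (ContinuousLinearMap.fst ℝ E F).hasFDerivAt.comp_hasDerivAt (0 : ℝ) hp
  have hp2 : HasDerivAt (fun ε ↦ (Λ.point φ ε t).2) (φ t • Φ.matrixCoord (Φ.bracketFamily L u)
      (baseCoord E x₀ γ t) (fstCoord F x₀ γ t)) 0 :=
    (ContinuousLinearMap.snd ℝ E F).hasFDerivAt.comp_hasDerivAt (0 : ℝ) hp
  have h1 : HasDerivAt (fun ε ↦ Λ.newFst φ ε t) (φ t • Φ.matrixCoord (Φ.bracketFamily L u)
      (baseCoord E x₀ γ t) (fstCoord F x₀ γ t) + (1 * deriv φ t) • u) 0 :=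
    hp2.add ((hid.mul_const (deriv φ t)).smul_const u)
  have h2 : HasDerivAt (fun ε ↦ Λ.newSnd hcov m φ ε t) ((1 * φ t) • (m + (sndCoord F x₀ γ t).comp
      (Φ.matrixCoord (Φ.nablaFamily L hcov u) (baseCoord E x₀ γ t)))) 0 :=
    ((hid.mul_const (φ t)).smul_const _).const_add _
  rw [one_mul] at h1 h2
  refine ⟨hp1.congr_of_eventuallyEq ?_, h1.congr_of_eventuallyEq ?_, h2.congr_of_eventuallyEq ?_⟩
  · filter_upwards [hev] with ε hε using (Λ.coord_family hcov m ht (hδ ε hε t ht)).2.1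
  · filter_upwards [hev] with ε hε using (Λ.coord_family hcov m ht (hδ ε hε t ht)).2.2.1
  · filter_upwards [hev] with ε hε using (Λ.coord_family hcov m ht (hδ ε hε t ht)).2.2.2

end PathFlow

end Critical

/-! ### Realized admissible variations and the integrated Euler-Lagrange equation -/

section Critical

variable {E : Type*} [NormedAddCommGroup E] [NormedSpace ℝ E] [FiniteDimensional ℝ E]
  {Q : Type*} [TopologicalSpace Q] [T2Space Q] [ChartedSpace E Q] [IsManifold 𝓘(ℝ, E) ∞ Q]
  {F : Type*} [NormedAddCommGroup F] [NormedSpace ℝ F] [FiniteDimensional ℝ F]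
  {A : Q → Type*} [TopologicalSpace (TotalSpace F A)]
  [∀ x, AddCommGroup (A x)] [∀ x, Module ℝ (A x)] [∀ x, TopologicalSpace (A x)]
  [∀ x, IsTopologicalAddGroup (A x)] [∀ x, ContinuousSMul ℝ (A x)]
  [FiberBundle F A] [VectorBundle ℝ F A] [ContMDiffVectorBundle ∞ F A 𝓘(ℝ, E)]
  {L : LieAlgebroid E F A} {cov : CovariantDerivative 𝓘(ℝ, E) F A} {t₀ t₁ : ℝ}
  {γ : PairPath A} {x₀ : Q} {Φ : FrameAt E F A x₀} {u : F}

namespace PathFlow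

/-- Every choice of u, m and φ gives an admissible variation that is the velocity of a homotopy: b
is φ times the section with coordinate u, and r is φ times the dual section with coordinate m. -/
theorem exists_admissible (Λ : PathFlow L t₀ t₁ γ Φ u)
    (hcov : cov.ContMDiffCovariantDerivative ∞) (m : F →L[ℝ] ℝ) {φ : ℝ → ℝ}
    (htt : t₀ < t₁) (hγ : IsPairPath L t₀ t₁ γ) (hφ : IsCutoff φ (Λ.times ∩ Ioo t₀ t₁))
    {X : ∀ _ : ℝ, Sec E F A} (hX : ∀ t, X t (γ.q t) = γ.a t) :
    ∃ Γ : ℝ → PairPath A, Γ 0 = γ ∧ IsHomotopy L t₀ t₁ Γ ∧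
      IsAdmissible L cov t₀ t₁ (Γ 0) (velFst Γ) (velSnd Γ) ∧
      ∀ t ∈ Icc t₀ t₁,
        velFst Γ t = horLift cov ((Γ 0).a t) (φ t • L.anchor _ (Φ.sec u ((Γ 0).q t))) +
          vertLift E F ((Γ 0).a t) (deriv φ t • Φ.sec u ((Γ 0).q t) +
            φ t • barNabla L cov (X t) (Φ.sec u) ((Γ 0).q t)) ∧
        velSnd Γ t = horLift (dualCov cov) ((Γ 0).p t)
            (φ t • L.anchor _ (Φ.sec u ((Γ 0).q t))) +
          vertLift E (F →L[ℝ] ℝ) ((Γ 0).p t) (φ t • Φ.dualSec m ((Γ 0).q t)) := by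
  obtain ⟨Γ, rfl, hΓ, hc, hd⟩ := Λ.exists_homotopy hcov m htt hγ hφ
  refine ⟨Γ, rfl, hΓ, ?_⟩
  have key : ∀ t ∈ Icc t₀ t₁,
      velFst Γ t = horLift cov ((Γ 0).a t) (φ t • L.anchor _ (Φ.sec u ((Γ 0).q t))) +
        vertLift E F ((Γ 0).a t) (deriv φ t • Φ.sec u ((Γ 0).q t) +
          φ t • barNabla L cov (X t) (Φ.sec u) ((Γ 0).q t)) ∧
      velSnd Γ t = horLift (dualCov cov) ((Γ 0).p t)
          (φ t • L.anchor _ (Φ.sec u ((Γ 0).q t))) +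
        vertLift E (F →L[ℝ] ℝ) ((Γ 0).p t) (φ t • Φ.dualSec m ((Γ 0).q t)) := by
    intro t ht
    by_cases htK : t ∈ Λ.times
    · have hx := Λ.mem_of_times t ⟨ht, htK⟩
      have hxc := Φ.dom_subset hx
      obtain ⟨h1, h2, h3⟩ := hd t ⟨ht, htK⟩
      have hv : chartDeriv x₀ _ (φ t • L.anchor _ (Φ.sec u ((Γ 0).q t))) =
          φ t • Φ.anchorCoord L (baseCoord E x₀ (Γ 0) t) u := by
        rw [map_smul, Φ.chartDeriv_anchor L hx, Φ.fibCoord_sec u _ hx]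
        rfl
      have hn : ∀ c, fibCoord F x₀ (cov (fun y ↦ Φ.sec c y) ((Γ 0).q t)
          (L.anchor _ (Φ.sec u ((Γ 0).q t)))) =
          Φ.matrixCoord (Φ.nablaFamily L hcov u) (baseCoord E x₀ (Γ 0) t) c := fun c ↦
        (Φ.matrixCoord_apply (Φ.nablaFamily L hcov u) hx c).symm
      rw [← hv] at h1
      constructor
      -- The term ∇_{ρ(u)} ã inside ∇̄_a cancels the Christoffel term of the horizontal lift, which
      -- leaves φ' u + φ [ã, ũ], the derivative computed from the flow.
      · refine velFst_eq hΓ ht Φ hx h1 (h2.congr_deriv ?_)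
        have hXX : X t ((Γ 0).q t) = Φ.sec (fstCoord F x₀ (Γ 0) t) ((Γ 0).q t) :=
          (hX t).trans (Φ.sec_fibCoord hx _).symm
        rw [barNabla_congr_left L cov (Φ.sec u) hXX, fibCoord_add hxc, fibCoord_smul hxc,
          fibCoord_smul hxc, Φ.fibCoord_sec u _ hx, Φ.fibCoord_barNabla L hcov hx, map_smul,
          fibCoord_smul hxc, hn]
        change _ = deriv φ t • u + φ t • (Φ.matrixCoord (Φ.nablaFamily L hcov u)
          (baseCoord E x₀ (Γ 0) t) _ + Φ.matrixCoord (Φ.bracketFamily L u)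
          (baseCoord E x₀ (Γ 0) t) _) - _
        rw [smul_add]
        abel
      · refine velSnd_eq hΓ ht Φ hx h1 h3 fun c ↦ ?_
        have hxc' : (Γ 0).q t ∈ coordSet E (F →L[ℝ] ℝ) (Dual A) x₀ := by
          rw [coordSet_dual]; exact hxc
        rw [fibCoord_smul hxc', Φ.fibCoord_dualSec m _ hx, map_smul, map_smul,
          ← fibCoord_dual_apply hxc, hn]
        change φ t * (m c + _) = φ t * _ + φ t * m c
        rw [mul_add, add_comm]
        rfl
    -- At the remaining times the frame need not contain q t. The family is constant in ε there, and
    -- its vanishing velocity is verified in another frame, centred at q t.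
    · have hts : t ∉ tsupport φ := fun h ↦ htK (hφ.tsupport_subset h).1
      have hφ0 : φ t = 0 := image_eq_zero_of_notMem_tsupport hts
      have hφ1 : deriv φ t = 0 := deriv_eq_zero_of_notMem_tsupport hts
      obtain ⟨Ψ⟩ := nonempty_frameAt E F A ((Γ 0).q t)
      have hx := Ψ.mem_dom
      have hxc := Ψ.dom_subset hx
      have hxc' : (Γ 0).q t ∈ coordSet E (F →L[ℝ] ℝ) (Dual A) ((Γ 0).q t) := by
        rw [coordSet_dual]; exact hxc
      have h1 : HasDerivAt (fun ε ↦ baseCoord E ((Γ 0).q t) (Γ ε) t)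
          (chartDeriv ((Γ 0).q t) ((Γ 0).q t) 0) 0 := by
        rw [_root_.map_zero, show (fun ε ↦ baseCoord E ((Γ 0).q t) (Γ ε) t) =
          fun _ ↦ baseCoord E ((Γ 0).q t) (Γ 0) t from funext fun ε ↦ congrArg
            (fun c : Σ x : Q, A x × Dual A x ↦ extChartAt 𝓘(ℝ, E) ((Γ 0).q t) c.1) (hc t hts ε)]
        exact hasDerivAt_const _ _
      have h2 : HasDerivAt (fun ε ↦ fstCoord F ((Γ 0).q t) (Γ ε) t) 0 0 := by
        rw [show (fun ε ↦ fstCoord F ((Γ 0).q t) (Γ ε) t) =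
          fun _ ↦ fstCoord F ((Γ 0).q t) (Γ 0) t from funext fun ε ↦ congrArg
            (fun c : Σ x : Q, A x × Dual A x ↦ fibCoord F ((Γ 0).q t) c.2.1) (hc t hts ε)]
        exact hasDerivAt_const _ _
      have h3 : HasDerivAt (fun ε ↦ sndCoord F ((Γ 0).q t) (Γ ε) t) 0 0 := by
        rw [show (fun ε ↦ sndCoord F ((Γ 0).q t) (Γ ε) t) =
          fun _ ↦ sndCoord F ((Γ 0).q t) (Γ 0) t from funext fun ε ↦ congrArg
            (fun c : Σ x : Q, A x × Dual A x ↦ fibCoord (F →L[ℝ] ℝ) ((Γ 0).q t) c.2.2)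
            (hc t hts ε)]
        exact hasDerivAt_const _ _
      rw [hφ0, hφ1, zero_smul, zero_smul, zero_smul, zero_smul, add_zero]
      refine ⟨velFst_eq hΓ ht Ψ hx h1 (h2.congr_deriv ?_), velSnd_eq hΓ ht Ψ hx h1 h3 fun c ↦ ?_⟩
      · rw [_root_.map_zero, fibCoord_zero hxc, sub_self]
      · rw [_root_.map_zero, _root_.map_zero, fibCoord_zero hxc']
        exact (add_zero 0).symm
  refine ⟨⟨fun t ↦ φ t • Φ.sec u ((Γ 0).q t), fun t ↦ φ t • Φ.dualSec m ((Γ 0).q t),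
    isC1Along_smul _ (hφ.contDiff.of_le (by simp)) (hγ.base.of_le (by norm_num)),
    isC1Along_smul _ (hφ.contDiff.of_le (by simp)) (hγ.base.of_le (by norm_num)), ?_, ?_,
    fun t ht ↦ ⟨_, isBarNablaAlong_smul htt ht (hX t) (Φ.sec u)
      (hφ.contDiff.of_le (by simp)), ?_, ?_⟩⟩, key⟩
  · have h : φ t₀ = 0 := image_eq_zero_of_notMem_tsupport fun h ↦
      lt_irrefl _ (hφ.tsupport_subset h).2.1
    simp only [h, zero_smul]
  · have h : φ t₁ = 0 := image_eq_zero_of_notMem_tsupport fun h ↦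
      lt_irrefl _ (hφ.tsupport_subset h).2.2
    simp only [h, zero_smul]
  · rw [map_smul]; exact (key t ht).1
  · rw [map_smul]; exact (key t ht).2

end PathFlow

/-- The first variation density paired with the section `σ` of `A` and the section `μ` of `A*`. -/
def variationDensity (L : LieAlgebroid E F A) (cov : CovariantDerivative 𝓘(ℝ, E) F A) (s : ℝ)
    (H : TotalSpace (F →L[ℝ] ℝ) (Dual A) → ℝ) (γ : PairPath A) (X : ℝ → Sec E F A)
    (σ : Sec E F A) (μ : Sec E (F →L[ℝ] ℝ) (Dual A)) (t : ℝ) : ℝ :=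
  μ (γ.q t) (γ.a t) + γ.p t (barNabla L cov (X t) σ (γ.q t)) +
    s * (diffH E H (γ.p t) (horLift (dualCov cov) (γ.p t) (L.anchor _ (σ (γ.q t))) +
      vertLift E (F →L[ℝ] ℝ) (γ.p t) (μ (γ.q t))))

theorem diffH_smul (H : TotalSpace (F →L[ℝ] ℝ) (Dual A) → ℝ) {x : Q} (p : Dual A x) (c : ℝ)
    (v : TotalTangent E (F →L[ℝ] ℝ) p) : diffH E H p (c • v) = c * diffH E H p v :=
  (mvfderiv (𝓘(ℝ, E).prod 𝓘(ℝ, F →L[ℝ] ℝ)) H (TotalSpace.mk' (F →L[ℝ] ℝ) x p)).map_smul c v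

/-- The derivative of the action along the realized variation is computed under the integral sign
and equals 0 by criticality. Homogeneity of the lifts and of dH extracts the factor φ. -/
theorem IsCritical.integral_eq_zero {s : ℝ} {H : TotalSpace (F →L[ℝ] ℝ) (Dual A) → ℝ}
    (hH : ContMDiff (𝓘(ℝ, E).prod 𝓘(ℝ, F →L[ℝ] ℝ)) 𝓘(ℝ, ℝ) ∞ H)
    (h : IsCritical L cov t₀ t₁ (action s H t₀ t₁) γ) (Λ : PathFlow L t₀ t₁ γ Φ u)
    (hcov : cov.ContMDiffCovariantDerivative ∞) (m : F →L[ℝ] ℝ) {φ : ℝ → ℝ}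
    (htt : t₀ < t₁) (hγ : IsPairPath L t₀ t₁ γ) (hφ : IsCutoff φ (Λ.times ∩ Ioo t₀ t₁))
    {X : ℝ → Sec E F A} (hX : ∀ t, X t (γ.q t) = γ.a t) :
    ∫ t in t₀..t₁, (deriv φ t * γ.p t (Φ.sec u (γ.q t)) +
      φ t * variationDensity L cov s H γ X (Φ.sec u) (Φ.dualSec m) t) = 0 := by
  obtain ⟨Γ, rfl, hΓ, hadm, hvel⟩ := Λ.exists_admissible hcov m htt hγ hφ hX
  refine Eq.trans ?_ ((hasDerivAt_action (s := s) hH htt hΓ).unique (h Γ rfl hΓ hadm))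
  refine intervalIntegral.integral_congr fun t ht ↦ ?_
  rw [uIcc_of_le htt.le] at ht
  obtain ⟨h1, h2⟩ := hvel t ht
  refine Eq.trans ?_ (hasDerivAt_lagrangian (s := s) hH hΓ ht h1 h2).deriv.symm
  unfold variationDensity horizontalPart
  simp only [horLift_smul, vertLift_smul, diffH_smul, diffH_add, map_add, map_smul, smul_apply,
    smul_eq_mul]
  ring

end Critical

/-! ### Critical points satisfy the equations -/

section Necessity

variable {E : Type*} [NormedAddCommGroup E] [NormedSpace ℝ E] [FiniteDimensional ℝ E]
  {Q : Type*} [TopologicalSpace Q] [T2Space Q] [ChartedSpace E Q] [IsManifold 𝓘(ℝ, E) ∞ Q]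
  {F : Type*} [NormedAddCommGroup F] [NormedSpace ℝ F] [FiniteDimensional ℝ F]
  {A : Q → Type*} [TopologicalSpace (TotalSpace F A)]
  [∀ x, AddCommGroup (A x)] [∀ x, Module ℝ (A x)] [∀ x, TopologicalSpace (A x)]
  [∀ x, IsTopologicalAddGroup (A x)] [∀ x, ContinuousSMul ℝ (A x)]
  [FiberBundle F A] [VectorBundle ℝ F A] [ContMDiffVectorBundle ∞ F A 𝓘(ℝ, E)]
  {L : LieAlgebroid E F A} {cov : CovariantDerivative 𝓘(ℝ, E) F A} {t₀ t₁ : ℝ}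
  {γ : PairPath A} {x₀ : Q} {Φ : FrameAt E F A x₀} {u : F}

/-- The sections X t need not depend continuously on t. Only the value a(t) matters, so the density
is rewritten in coordinates, where every ingredient is a continuous function along the path. -/
theorem PathFlow.continuousOn_variationDensity (Λ : PathFlow L t₀ t₁ γ Φ u) {s : ℝ}
    {H : TotalSpace (F →L[ℝ] ℝ) (Dual A) → ℝ}
    (hH : ContMDiff (𝓘(ℝ, E).prod 𝓘(ℝ, F →L[ℝ] ℝ)) 𝓘(ℝ, ℝ) ∞ H)
    (hcov : cov.ContMDiffCovariantDerivative ∞) (m : F →L[ℝ] ℝ) (hγ : IsPairPath L t₀ t₁ γ)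
    {X : ℝ → Sec E F A} (hX : ∀ t, X t (γ.q t) = γ.a t) :
    ContinuousOn (variationDensity L cov s H γ X (Φ.sec u) (Φ.dualSec m))
      (Icc t₀ t₁ ∩ Λ.times) := by
  obtain ⟨U, h, hU, hh, hHh⟩ := exists_coord_function (E := E) hH x₀
  have hb : ContinuousOn (baseCoord E x₀ γ) (Icc t₀ t₁ ∩ Λ.times) :=
    (Λ.contDiffOn_coord_fst hγ).fst.continuousOn
  have ha : ContinuousOn (fstCoord F x₀ γ) (Icc t₀ t₁ ∩ Λ.times) :=
    (Λ.contDiffOn_coord_fst hγ).snd.continuousOn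
  have hp : ContinuousOn (sndCoord F x₀ γ) (Icc t₀ t₁ ∩ Λ.times) :=
    (Λ.contDiffOn_sndCoord hγ).continuousOn
  have hbm : MapsTo (baseCoord E x₀ γ) (Icc t₀ t₁ ∩ Λ.times) Φ.coordDom := fun t ht ↦
    Φ.chart_mem_coordDom (Λ.mem_of_times t ht)
  have hN : ContinuousOn (fun t ↦ Φ.matrixCoord (Φ.nablaFamily L hcov u) (baseCoord E x₀ γ t))
      (Icc t₀ t₁ ∩ Λ.times) := (Φ.contDiffOn_matrixCoord _).continuousOn.comp hb hbm
  have hB : ContinuousOn (fun t ↦ Φ.matrixCoord (Φ.bracketFamily L u) (baseCoord E x₀ γ t))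
      (Icc t₀ t₁ ∩ Λ.times) := (Φ.contDiffOn_matrixCoord _).continuousOn.comp hb hbm
  have hA : ContinuousOn (fun t ↦ Φ.anchorCoord L (baseCoord E x₀ γ t) u)
      (Icc t₀ t₁ ∩ Λ.times) :=
    ((Φ.contDiffOn_anchorCoord L).continuousOn.comp hb hbm).clm_apply continuousOn_const
  have hzU : ∀ t ∈ Icc t₀ t₁ ∩ Λ.times, γ.q t ∈ coordSet E (F →L[ℝ] ℝ) (Dual A) x₀ :=
    fun t ht ↦ by rw [coordSet_dual]; exact Φ.dom_subset (Λ.mem_of_times t ht)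
  have hD : ContinuousOn (fun t ↦ fderiv ℝ h (baseCoord E x₀ γ t, sndCoord F x₀ γ t)
      (Φ.anchorCoord L (baseCoord E x₀ γ t) u, m + (sndCoord F x₀ γ t).comp
        (Φ.matrixCoord (Φ.nablaFamily L hcov u) (baseCoord E x₀ γ t)))) (Icc t₀ t₁ ∩ Λ.times) := by
    refine ContinuousOn.clm_apply ?_ (hA.prodMk (continuousOn_const.add (hp.clm_comp hN)))
    exact (hh.continuousOn_fderiv_of_isOpen hU (by simp)).comp (hb.prodMk hp)
      fun t ht ↦ (hHh (TotalSpace.mk' (F →L[ℝ] ℝ) (γ.q t) (γ.p t)) (hzU t ht)).1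
  have hall : ContinuousOn (fun t ↦ m (fstCoord F x₀ γ t) + sndCoord F x₀ γ t
      (Φ.matrixCoord (Φ.nablaFamily L hcov u) (baseCoord E x₀ γ t) (fstCoord F x₀ γ t) +
        Φ.matrixCoord (Φ.bracketFamily L u) (baseCoord E x₀ γ t) (fstCoord F x₀ γ t)) +
      s * fderiv ℝ h (baseCoord E x₀ γ t, sndCoord F x₀ γ t)
      (Φ.anchorCoord L (baseCoord E x₀ γ t) u, m + (sndCoord F x₀ γ t).comp
        (Φ.matrixCoord (Φ.nablaFamily L hcov u) (baseCoord E x₀ γ t)))) (Icc t₀ t₁ ∩ Λ.times) :=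
    ((m.continuous.comp_continuousOn ha).add
      (hp.clm_apply ((hN.clm_apply ha).add (hB.clm_apply ha)))).add (continuousOn_const.mul hD)
  refine hall.congr fun t ht ↦ ?_
  have hx := Λ.mem_of_times t ht
  have hxc := Φ.dom_subset hx
  have hXX : X t (γ.q t) = Φ.sec (fstCoord F x₀ γ t) (γ.q t) :=
    (hX t).trans (Φ.sec_fibCoord hx _).symm
  unfold variationDensity
  rw [Φ.dualSec_apply hx, barNabla_congr_left L cov (Φ.sec u) hXX, ← fibCoord_dual_apply hxc,
    Φ.fibCoord_barNabla L hcov hx]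
  refine congrArg₂ _ rfl (congrArg _ ?_)
  unfold diffH
  rw [(hHh (TotalSpace.mk' (F →L[ℝ] ℝ) (γ.q t) (γ.p t)) (hzU t ht)).2]
  refine congrArg (fderiv ℝ h (baseCoord E x₀ γ t, sndCoord F x₀ γ t)) ?_
  refine ((coordDeriv E x₀ (TotalSpace.mk' (F →L[ℝ] ℝ) _ (γ.p t))).map_add _ _).trans ?_
  rw [coordDeriv_vertLift (hzU t ht), Φ.fibCoord_dualSec m _ hx]
  obtain ⟨h4, h5⟩ := Φ.coordDeriv_horLift_dual cov hx (γ.p t) (L.anchor _ (Φ.sec u (γ.q t)))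
  refine Prod.ext ?_ (ContinuousLinearMap.ext fun c ↦ ?_)
  · rw [Prod.fst_add, h4, add_zero, Φ.chartDeriv_anchor L hx, Φ.fibCoord_sec u _ hx]
    rfl
  · rw [Prod.snd_add, add_apply, h5, ← fibCoord_dual_apply hxc]
    have hn : fibCoord F x₀ (cov (fun y ↦ Φ.sec c y) (γ.q t) (L.anchor _ (Φ.sec u (γ.q t)))) =
        Φ.matrixCoord (Φ.nablaFamily L hcov u) (baseCoord E x₀ γ t) c :=
      (Φ.matrixCoord_apply (Φ.nablaFamily L hcov u) hx c).symm
    rw [hn]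
    exact add_comm _ _

theorem IsPairPath.contDiffOn_pairing (hγ : IsPairPath L t₀ t₁ γ) (σ : Sec E F A) :
    ContDiffOn ℝ 1 (fun t ↦ γ.p t (σ (γ.q t))) (Icc t₀ t₁) := by
  rw [← contMDiffOn_iff_contDiffOn]
  have hb : IsC1Along E F t₀ t₁ γ.q (fun t ↦ σ (γ.q t)) :=
    (σ.contMDiff.of_le (by simp)).comp_contMDiffOn (hγ.base.of_le (by norm_num))
  have h4 := ContMDiffOn.clm_bundle_apply (F₁ := F) (F₂ := ℝ) (E₂ := Bundle.Trivial Q ℝ)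
    (b := fun t : ℝ ↦ γ.q t) hγ.snd hb
  intro z hz
  have := h4 z hz
  rw [contMDiffWithinAt_totalSpace] at this
  exact this.2

/-- The Euler-Lagrange equation of a critical point, in terms of a frame. -/
theorem IsCritical.derivWithin_pairing {s : ℝ} {H : TotalSpace (F →L[ℝ] ℝ) (Dual A) → ℝ}
    (hH : ContMDiff (𝓘(ℝ, E).prod 𝓘(ℝ, F →L[ℝ] ℝ)) 𝓘(ℝ, ℝ) ∞ H)
    (h : IsCritical L cov t₀ t₁ (action s H t₀ t₁) γ)
    (hcov : cov.ContMDiffCovariantDerivative ∞) (htt : t₀ < t₁) (hγ : IsPairPath L t₀ t₁ γ)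
    {X : ℝ → Sec E F A} (hX : ∀ t, X t (γ.q t) = γ.a t) {t : ℝ} (ht : t ∈ Icc t₀ t₁)
    (Φ : FrameAt E F A (γ.q t)) (u : F) (m : F →L[ℝ] ℝ) :
    derivWithin (fun r ↦ γ.p r (Φ.sec u (γ.q r))) (Icc t₀ t₁) t =
      variationDensity L cov s H γ X (Φ.sec u) (Φ.dualSec m) t := by
  obtain ⟨Λ, htΛ⟩ := exists_pathFlow hγ ht Φ u
  exact derivWithin_eq_of_forall_integral_eq_zero htt ht Λ.isOpen_times htΛ
    ((hγ.contDiffOn_pairing _).mono inter_subset_left)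
    (Λ.continuousOn_variationDensity hH hcov m hγ hX) fun φ h1 h2 h3 ↦
      h.integral_eq_zero hH Λ hcov m htt hγ ⟨h1, h2, h3⟩ hX

/-- The path p is extended by letting μ at time r be the section whose constant coordinate is that
of p(r); this is jointly C¹ near (t, q t). -/
theorem exists_isBarNablaDualAlong (hγ : IsPairPath L t₀ t₁ γ) {t : ℝ} (ht : t ∈ Icc t₀ t₁) :
    ∃ w, IsBarNablaDualAlong L cov t₀ t₁ γ.q γ.a γ.p t w := by
  obtain ⟨Φ⟩ := nonempty_frameAt E F A (γ.q t)
  obtain ⟨X, hX⟩ := exists_sec (E := E) (F := F) (γ.a t)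
  let μ : ℝ → Sec E (F →L[ℝ] ℝ) (Dual A) := fun r ↦ Φ.dualSec (sndCoord F (γ.q t) γ r)
  obtain ⟨ν, hν⟩ := exists_isBarNablaDual L cov X (μ t) (γ.q t)
  have hxc : γ.q t ∈ coordSet E (F →L[ℝ] ℝ) (Dual A) (γ.q t) := by
    rw [coordSet_dual]; exact Φ.dom_subset Φ.mem_dom
  have hdom : ∀ᶠ z : ℝ × Q in 𝓝[Icc t₀ t₁ ×ˢ univ] (t, γ.q t), z.2 ∈ Φ.dom :=
    mem_nhdsWithin_of_mem_nhds (continuousAt_snd.eventually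
      (Φ.eventually_mem_dom (x := (t, γ.q t).2) Φ.mem_dom))
  refine ⟨_, X, μ, ν, hX, ⟨?_, ?_⟩, hν, rfl⟩
  · refine contMDiffWithinAt_of_bundleCoord (x₀ := γ.q t) ⟨ht, trivial⟩ ?_ ?_
    · filter_upwards [hdom] with z hz
      rw [coordSet_dual]
      exact Φ.dom_subset hz
    · have h1 : ContMDiffWithinAt (𝓘(ℝ, ℝ).prod 𝓘(ℝ, E)) 𝓘(ℝ, E) 1
          (fun z : ℝ × Q ↦ extChartAt 𝓘(ℝ, E) (γ.q t) z.2) (Icc t₀ t₁ ×ˢ univ) (t, γ.q t) :=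
        (contMDiffAt_extChartAt.comp (t, γ.q t) contMDiffAt_snd).contMDiffWithinAt
      have h2 : ContMDiffWithinAt 𝓘(ℝ, ℝ) 𝓘(ℝ, F →L[ℝ] ℝ) 1 (sndCoord F (γ.q t) γ)
          (Icc t₀ t₁) t :=
        (contMDiffWithinAt_bundleCoord hxc (hγ.snd t ht)).contDiffWithinAt.snd.contMDiffWithinAt
      have h3 : ContMDiffWithinAt (𝓘(ℝ, ℝ).prod 𝓘(ℝ, E)) 𝓘(ℝ, F →L[ℝ] ℝ) 1
          (fun z : ℝ × Q ↦ sndCoord F (γ.q t) γ z.1) (Icc t₀ t₁ ×ˢ univ) (t, γ.q t) :=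
        ContMDiffWithinAt.comp (t := Icc t₀ t₁) (f := Prod.fst) (t, γ.q t) h2
          contMDiffWithinAt_fst fun z hz ↦ hz.1
      refine (h1.prodMk_space h3).congr_of_eventuallyEq_of_mem ?_ ⟨ht, trivial⟩
      filter_upwards [hdom] with z hz
      exact Prod.ext rfl (Φ.fibCoord_dualSec _ _ hz)
  · filter_upwards [(hγ.base t ht).continuousWithinAt (Φ.eventually_mem_dom Φ.mem_dom)] with r hr
    exact Φ.dualSec_fibCoord hr _

/-- Critical points satisfy the generalized Lie-Poisson equations. -/
theorem IsCritical.liePoissonEquations {s : ℝ} (hs : s = 1 ∨ s = -1)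
    {H : TotalSpace (F →L[ℝ] ℝ) (Dual A) → ℝ}
    (hH : ContMDiff (𝓘(ℝ, E).prod 𝓘(ℝ, F →L[ℝ] ℝ)) 𝓘(ℝ, ℝ) ∞ H)
    (h : IsCritical L cov t₀ t₁ (action s H t₀ t₁) γ)
    (hcov : cov.ContMDiffCovariantDerivative ∞) (htt : t₀ < t₁) (hγ : IsPairPath L t₀ t₁ γ) :
    LiePoissonEquations L cov s H t₀ t₁ γ := by
  choose X hX using fun t ↦ exists_sec (E := E) (F := F) (γ.a t)
  have hss : s * s = 1 := by rcases hs with rfl | rfl <;> norm_num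
  refine ⟨fun t ht ↦ ?_, hγ.anchor, fun t ht ↦ ?_⟩
  · obtain ⟨Φ⟩ := nonempty_frameAt E F A (γ.q t)
    -- Solving a = -s u with s² = 1 gives u = -s a.
    refine ⟨-(s • γ.a t), fun r ↦ ?_, by rw [smul_neg, smul_smul, hss, one_smul, neg_neg]⟩
    -- The pairing ⟨p, σ⟩' does not depend on the dual section. Equating the densities for the
    -- coordinate of r and for 0 isolates ⟨r, a⟩ + s dH(p)(V_p r) = 0.
    have h1 := (h.derivWithin_pairing hH hcov htt hγ hX ht Φ 0 (fibCoord (F →L[ℝ] ℝ) (γ.q t) r)).symm.trans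
      (h.derivWithin_pairing hH hcov htt hγ hX ht Φ 0 0)
    unfold variationDensity at h1
    rw [Φ.dualSec_fibCoord Φ.mem_dom, diffH_add, diffH_add, map_zero Φ.dualSec] at h1
    change _ = (0 : Dual A (γ.q t)) (γ.a t) + _ +
      s * (_ + diffH E H (γ.p t) (vertLift E (F →L[ℝ] ℝ) (γ.p t) 0)) at h1
    have h2 := diffH_smul H (γ.p t) 0 (0 : TotalTangent E (F →L[ℝ] ℝ) (γ.p t))
    rw [zero_smul, zero_mul] at h2
    rw [vertLift_zero, h2, zero_apply] at h1
    rw [map_neg, map_smul, smul_eq_mul]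
    linear_combination (-s) * h1 + diffH E H (γ.p t) (vertLift E (F →L[ℝ] ℝ) (γ.p t) r) * hss
  · obtain ⟨w, hw⟩ := exists_isBarNablaDualAlong (cov := cov) hγ ht
    refine ⟨w, hw, fun v ↦ ?_⟩
    obtain ⟨Φ⟩ := nonempty_frameAt E F A (γ.q t)
    obtain ⟨c, rfl⟩ : ∃ c, Φ.sec c (γ.q t) = v := ⟨_, Φ.sec_fibCoord Φ.mem_dom v⟩
    -- With zero dual section the Euler-Lagrange equation gives ⟨p, σ⟩' = ⟨p, ∇̄_a σ⟩ + s
    -- dH^hor(p)(ρ(σ)). The product rule for the same derivative gives ⟨p, ∇̄_a σ⟩ + ⟨w, σ⟩, and the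
    -- common term is cancelled.
    have h1 := h.derivWithin_pairing hH hcov htt hγ hX ht Φ c 0
    have h2 := hasDerivWithinAt_pairing_barNabla htt hγ ht
      (isBarNablaAlong_smul (cov := cov) (L := L) htt ht (hX t) (Φ.sec c) (f := fun _ ↦ 1) contDiff_const) hw
    simp only [deriv_const, zero_smul, zero_add, one_smul] at h2
    rw [h2.derivWithin (uniqueDiffOn_Icc htt t ht)] at h1
    unfold variationDensity at h1
    rw [map_zero Φ.dualSec] at h1
    change _ = (0 : Dual A (γ.q t)) (γ.a t) + _ +
      s * diffH E H (γ.p t) (_ + vertLift E (F →L[ℝ] ℝ) (γ.p t) 0) at h1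
    rw [vertLift_zero, add_zero, zero_apply, zero_add] at h1
    exact add_left_cancel h1

end Necessity

end AlgebroidMechanics
end

theorem mainTheorem2
    {E : Type*} [NormedAddCommGroup E] [NormedSpace ℝ E] [FiniteDimensional ℝ E]
    {Q : Type*} [TopologicalSpace Q] [T2Space Q] [ChartedSpace E Q] [IsManifold 𝓘(ℝ, E) ∞ Q]
    {F : Type*} [NormedAddCommGroup F] [NormedSpace ℝ F] [FiniteDimensional ℝ F]
    {A : Q → Type*} [TopologicalSpace (TotalSpace F A)]
    [∀ x, AddCommGroup (A x)] [∀ x, Module ℝ (A x)] [∀ x, TopologicalSpace (A x)]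
    [∀ x, IsTopologicalAddGroup (A x)] [∀ x, ContinuousSMul ℝ (A x)]
    [FiberBundle F A] [VectorBundle ℝ F A] [ContMDiffVectorBundle ∞ F A 𝓘(ℝ, E)]
    (L : LieAlgebroid E F A)
    (cov : CovariantDerivative 𝓘(ℝ, E) F A) (hcov : cov.ContMDiffCovariantDerivative ∞)
    (s : ℝ) (hs : s = 1 ∨ s = -1)
    (H : TotalSpace (F →L[ℝ] ℝ) (Dual A) → ℝ)
    (hH : ContMDiff (𝓘(ℝ, E).prod 𝓘(ℝ, F →L[ℝ] ℝ)) 𝓘(ℝ, ℝ) ∞ H)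
    (t₀ t₁ : ℝ) (ht : t₀ < t₁)
    (γ : PairPath A) (hγ : IsPairPath L t₀ t₁ γ) :
    LiePoissonEquations L cov s H t₀ t₁ γ ↔ IsCritical L cov t₀ t₁ (action s H t₀ t₁) γ :=
  ⟨fun h ↦ h.isCritical hH ht hγ, fun h ↦ h.liePoissonEquations hs hH hcov ht hγ⟩
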